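/- A lattice in the Euclidean plane is called well-rounded if its non-zero vectors of minimal length span the plane. Let $a_\square(n)$ be the number of well-rounded sublattices of index $n$ in the square lattice $\mathbb{Z}[\mathrm{i}]\subset\mathbb{C}$, let $\Phi_{\square,\mathsf{wr}}(s)=\sum_{n\ge1}a_\square(n)n^{-s}$ be its Dirichlet series and $A_\square(x)=\sum_{n\le x}a_\square(n)$ its summatory function. Let $\Phi_\square(s)$ be the Dirichlet series counting, by index, the sublattices of $\mathbb{Z}[\mathrm{i}]$ that are similar to $\mathbb{Z}[\mathrm{i}]$, and let $\Phi^{\mathsf{pr}}_\square(s)$ be the Dirichlet series counting those among them that are primitive, i.e. contained in no $m\mathbb{Z}[\mathrm{i}]$ with $m\ge 2$. With the Riemann zeta function $\zeta$ and the $L$-function of the non-trivial Dirichlet character $\chi_{-4}$ modulo $4$, one has, for $\operatorname{Re}s>1$, $$\Phi_\square(s)=\zeta(s)L(s,\chi_{-4}),\qquad \Phi^{\mathsf{pr}}_\square(s)=\frac{\zeta(s)L(s,\chi_{-4})}{\zeta(2s)}.$$ (1) For $\operatorname{Re}s>1$ the series $\Phi_{\square,\mathsf{wr}}(s)$ converges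 absolutely and $$\Phi_{\square,\mathsf{wr}}(s)=\Phi_\square(s)+\Phi_{\mathsf{wr},\mathrm{even}}(s)+\Phi_{\mathsf{wr},\mathrm{odd}}(s),$$ where $$\Phi_{\mathsf{wr},\mathrm{even}}(s)=\frac{2}{2^s}\sum_{p\ge1}\ \sum_{p<q<\sqrt3\,p}\frac{1}{p^sq^s}\;\Phi^{\mathsf{pr}}_\square(s),$$ $$\Phi_{\mathsf{wr},\mathrm{odd}}(s)=\frac{2}{1+2^{-s}}\,\Phi^{\mathsf{pr}}_\square(s)\sum_{k\ge1}\ \sum_{k<\ell<\sqrt3\,k+\frac{\sqrt3-1}{2}}\frac{1}{(2k+1)^s(2\ell+1)^s},$$ the sums over $p$ and over $k$ being convergent. (2) $\Phi_{\square,\mathsf{wr}}$ extends meromorphically to the half plane $\{\operatorname{Re}s>\frac12\}$; the extension has a pole of order $2$ at $s=1$ and no other pole in $\{\operatorname{Re}s\ge1\}$. (3) For real $s>1$, $$D_\square(s)-\Phi_\square(s)<\Phi_{\square,\mathsf{wr}}(s)<D_\square(s)+\Phi_\square(s),$$ where $$D_\square(s)=\frac{2+2^s}{1+2^s}\cdot\frac{1-\sqrt3^{\,1-s}}{s-1}\cdot\frac{L(s,\chi_{-4})}{\zeta(2s)}\,\zeta(s)\,\zeta(2s-1).$$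 (4) As $x\to\infty$, $\displaystyle A_\square(x)=\frac{\log 3}{2\pi}\,x\log x+o(x\log x)$. -/

import Mathlib

open Filter Asymptotics
open scoped ComplexOrder

noncomputable section

namespace SquareLattice

section General

variable {E : Type*} [NormedAddCommGroup E] [NormedSpace ℝ E]

/-- A lattice `Λ` is well-rounded if its non-zero vectors of minimal length span the space. -/
def IsWellRounded (Λ : AddSubgroup E) : Prop :=
  Submodule.span ℝ {v : E | v ∈ Λ ∧ v ≠ 0 ∧ ∀ w ∈ Λ, w ≠ 0 → ‖v‖ ≤ ‖w‖} = ⊤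

/-- `Λ` is similar to `Γ`: it is the image of `Γ` under a linear isometry followed by a
positive scaling. -/
def IsSimilarTo (Λ Γ : AddSubgroup E) : Prop :=
  ∃ (c : ℝ) (R : E ≃ₗᵢ[ℝ] E), 0 < c ∧ (Λ : Set E) = (fun x => c • R x) '' (Γ : Set E)

/-- `Λ` is primitive in `Γ`: it is contained in no `m Γ` with `m ≥ 2`. -/
def IsPrimitiveIn (Λ Γ : AddSubgroup E) : Prop :=
  ∀ m : ℕ, 2 ≤ m → ¬ ((Λ : Set E) ⊆ (fun x => m • x) '' (Γ : Set E))

/-- The number of well-rounded sublattices of index `n` in `Γ`. -/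
def wellRoundedCount (Γ : AddSubgroup E) (n : ℕ) : ℕ :=
  {Λ : AddSubgroup E | Λ ≤ Γ ∧ Λ.relIndex Γ = n ∧ IsWellRounded Λ}.ncard

/-- The number of similar sublattices of index `n` in `Γ`. -/
def similarCount (Γ : AddSubgroup E) (n : ℕ) : ℕ :=
  {Λ : AddSubgroup E | Λ ≤ Γ ∧ Λ.relIndex Γ = n ∧ IsSimilarTo Λ Γ}.ncard

/-- The number of primitive similar sublattices of index `n` in `Γ`. -/
def primitiveSimilarCount (Γ : AddSubgroup E) (n : ℕ) : ℕ :=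
  {Λ : AddSubgroup E |
    Λ ≤ Γ ∧ Λ.relIndex Γ = n ∧ IsSimilarTo Λ Γ ∧ IsPrimitiveIn Λ Γ}.ncard

end General

/-- The square lattice: the Gaussian integers inside the Euclidean plane `ℂ`. -/
def squareLattice : AddSubgroup ℂ := GaussianInt.toComplex.toAddMonoidHom.range

/-- `a(n)`: the number of well-rounded sublattices of index `n` in the square lattice. -/
def aSquare (n : ℕ) : ℕ := wellRoundedCount squareLattice n

/-- The summatory function `A(x) = ∑_{1 ≤ n ≤ x} a(n)`. -/
def ASquare (x : ℝ) : ℝ := ∑ n ∈ Finset.Icc 1 ⌊x⌋₊, (aSquare n : ℝ)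

/-- The Dirichlet series of the well-rounded sublattices. -/
def PhiSquareWr (s : ℂ) : ℂ := LSeries (fun n => (aSquare n : ℂ)) s

/-- The Dirichlet series of the similar (that is, square) sublattices. -/
def PhiSquare (s : ℂ) : ℂ := LSeries (fun n => (similarCount squareLattice n : ℂ)) s

/-- The Dirichlet series of the primitive similar sublattices. -/
def PhiSquarePr (s : ℂ) : ℂ := LSeries (fun n => (primitiveSimilarCount squareLattice n : ℂ)) s

/-- The character modulo 4 with values `0, 1, 0, -1` at `0, 1, 2, 3`. -/
def chiNegFour : DirichletCharacter ℂ 4 := ZMod.χ₄.ringHomComp (Int.castRingHom ℂ)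

/-- `∑_{p < q < √3 p} p^{-s} q^{-s}` for fixed `p`; it is empty for `p = 0`. -/
def evenTerm (s : ℂ) (p : ℕ) : ℂ :=
  ∑ q ∈ Finset.Ioo p ⌈√3 * (p : ℝ)⌉₊, 1 / ((p : ℂ) ^ s * (q : ℂ) ^ s)

/-- `∑_{k < ℓ < √3 k + (√3 - 1) / 2} (2k+1)^{-s} (2ℓ+1)^{-s}` for fixed `k`; it is empty for
`k = 0`. -/
def oddTerm (s : ℂ) (k : ℕ) : ℂ :=
  ∑ l ∈ Finset.Ioo k ⌈√3 * (k : ℝ) + (√3 - 1) / 2⌉₊,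
    1 / ((2 * (k : ℂ) + 1) ^ s * (2 * (l : ℂ) + 1) ^ s)

/-- The contribution of the rhombic sublattices of even index. -/
def PhiWrEven (s : ℂ) : ℂ := 2 / 2 ^ s * (∑' p : ℕ, evenTerm s p) * PhiSquarePr s

/-- The contribution of the rhombic sublattices of odd index. -/
def PhiWrOdd (s : ℂ) : ℂ := 2 / (1 + 2 ^ (-s)) * PhiSquarePr s * ∑' k : ℕ, oddTerm s k

/-- The explicit function in the middle of the two bounds. -/
def DSquare (s : ℂ) : ℂ :=
  (2 + 2 ^ s) / (1 + 2 ^ s) * ((1 - ((√3 : ℝ) : ℂ) ^ (1 - s)) / (s - 1)) *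
    (chiNegFour.LFunction s / riemannZeta (2 * s)) * riemannZeta s * riemannZeta (2 * s - 1)

end SquareLattice

end

/-! Geometry. Two independent minimal vectors v, w of a well-rounded sublattice generate it. Since
|v| = |w|, the diagonals v + w and v − w are orthogonal, so up to sign and order they are za and zbi
with z a primitive Gaussian integer and a, b positive integers. Minimality becomes a² ≤ 3b² and b² ≤
3a², integrality becomes 2 ∣ z(a + bi), and the index is N(z)ab/2. As √3 is irrational, both
inequalities are strict; hence ±v, ±w are the only minimal vectors, and (z, a, b) is unique once z
is confined to a half-open quadrant (`wrLattice_injOn`, `wrLattice_surj`). The case a = b gives the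
square sublattices, the cases a < b and b < a are exchanged by a quarter turn, and a, b have equal
parity. If a = 2p and b = 2q, the index is 2N(z)pq; if both are odd, N(z) must be even. So
`aSquare_eq` expresses the count by Dirichlet convolutions.

Arithmetic. Primitive Gaussian integers of norm n in the quadrant correspond to square roots of −1
modulo n. Their number is multiplicative, and a check at prime powers shows that its convolution
with the indicator of the squares is χ₋₄ * 1 (`rootCount_convolution`). This yields ζ(s)L(s, χ₋₄)
and, after division by ζ(2s), the primitive series.

Analysis. Both double sums have inner sums over m + δj < √3 m, with δ = 1 or 2. Such a sum of (m +
δj)⁻ˢ is m¹⁻ˢc(s)/δ, where c(s) = ∫₁^√3 x⁻ˢ dx, up to an error of order m^(−Re s). Multiplied by m⁻ˢ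
and summed over m, the main terms give c(s)ζ(2s − 1), with an Euler factor removed when m is odd,
and the errors a series holomorphic for Re s > 1/2. The poles of ζ(2s − 1) and of the factor ζ(s)
combine to a double pole at 1, which survives since c(1) = log √3 and L(1, χ₋₄) are non-zero. For
real s the summands decrease, so the errors are one-sided, and their total over the even and odd
parts produces exactly the bounds ±Φ.

Growth. The asymptotics are elementary. Lattice points in discs give the mean π/4 of the similar
count. Division by ζ(2s) and by 1 + 2⁻ˢ is carried out on means by the contraction argument
`tendsto_of_tendsto_add_tsum`. The logarithmic means of the ratio counts come from the same
comparison with an integral at s = 1, and `tendsto_summatory_convolution` multiplies a mean by a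
logarithmic mean. -/

open SquareLattice

/-! ### Lattices generated by two vectors: index and minimal vectors. -/

section Lattice

/-- Coordinates of a Gaussian integer in the rational plane. -/
def gaussianCoord : GaussianInt →+ (Fin 2 → ℚ) where
  toFun z := ![z.re, z.im]
  map_zero' := by ext i; fin_cases i <;> simp
  map_add' x y := by ext i; fin_cases i <;> simp

theorem gaussianCoord_injective : Function.Injective gaussianCoord := by
  intro x y h
  have h0 := congrFun h 0
  have h1 := congrFun h 1
  simp [gaussianCoord] at h0 h1
  exact Zsqrtd.ext h0 h1

/-- The relative index of two full lattices in ℚ² is the absolute determinant of one ℤ-basis with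
respect to the other; the second lattice here is the whole ring with basis 1, i. -/
theorem gaussian_index_closure_pair (v w : GaussianInt)
    (h : v.re * w.im - v.im * w.re ≠ 0) :
    (AddSubgroup.closure {v, w}).index = (v.re * w.im - v.im * w.re).natAbs := by
  classical
  have key : ∀ v w : GaussianInt, v.re * w.im - v.im * w.re ≠ 0 →
      ∃ b : Module.Basis (Fin 2) ℚ (Fin 2 → ℚ), b 0 = gaussianCoord v ∧ b 1 = gaussianCoord w := by
    intro v w h
    have hd : (Matrix.of ![gaussianCoord v, gaussianCoord w]).det ≠ 0 := by
      rw [Matrix.det_fin_two]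
      simp [gaussianCoord]
      exact_mod_cast h
    have hli : LinearIndependent ℚ ![gaussianCoord v, gaussianCoord w] :=
      Matrix.linearIndependent_rows_of_det_ne_zero hd
    refine ⟨basisOfPiSpaceOfLinearIndependent hli, ?_, ?_⟩ <;>
    simp [basisOfPiSpaceOfLinearIndependent, dif_pos (inferInstance : Nonempty (Fin 2))]
  obtain ⟨b₁, h10, h11⟩ := key v w h
  obtain ⟨b₂, h20, h21⟩ := key 1 ⟨0, 1⟩ (by simp)
  have hr : ∀ (b : Module.Basis (Fin 2) ℚ (Fin 2 → ℚ)), Set.range b = {b 0, b 1} := by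
    intro b
    ext x
    simp [Fin.exists_fin_two, eq_comm]
  have hm : ∀ x y : GaussianInt, (AddSubgroup.closure {x, y}).map gaussianCoord =
      AddSubgroup.closure {gaussianCoord x, gaussianCoord y} := by
    intro x y
    rw [AddMonoidHom.map_closure, Set.image_pair]
  have htop : (AddSubgroup.closure {(1 : GaussianInt), ⟨0, 1⟩}) = ⊤ := by
    rw [eq_top_iff]
    intro x _
    rw [AddSubgroup.mem_closure_pair]
    exact ⟨x.re, x.im, by ext <;> simp⟩
  have e1 := AddSubgroup.relIndex_eq_abs_det
    ((AddSubgroup.closure {v, w}).map gaussianCoord)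
    ((AddSubgroup.closure {(1 : GaussianInt), ⟨0, 1⟩}).map gaussianCoord)
    (AddSubgroup.map_mono (by rw [htop]; exact le_top)) b₁ b₂
    (by rw [hm, hr, h10, h11]) (by rw [hm, hr, h20, h21])
  rw [AddSubgroup.relIndex_map_map_of_injective _ _ gaussianCoord_injective, htop,
    AddSubgroup.relIndex_top_right] at e1
  have hb2 : b₂ = Pi.basisFun ℚ (Fin 2) := by
    apply Module.Basis.eq_of_apply_eq
    intro i
    fin_cases i
    · simp [h20, gaussianCoord]; ext j; fin_cases j <;> simp
    · simp [h21, gaussianCoord]; ext j; fin_cases j <;> simp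
  have e2 : b₂.det b₁ = ((v.re * w.im - v.im * w.re : ℤ) : ℚ) := by
    rw [hb2, Pi.basisFun_det_apply, Matrix.det_fin_two]
    simp only [Matrix.of_apply, h10, h11, gaussianCoord]
    simp
  rw [e2] at e1
  have : (((AddSubgroup.closure {v, w}).index : ℤ) : ℚ) =
      (((v.re * w.im - v.im * w.re).natAbs : ℤ) : ℚ) := by
    rw [Int.natCast_natAbs]
    push_cast
    push_cast at e1
    exact e1
  exact_mod_cast this

theorem mem_squareLattice {x : ℂ} : x ∈ squareLattice ↔ ∃ z : GaussianInt, (z : ℂ) = x := by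
  simp [squareLattice]

theorem closure_pair_le_squareLattice (v w : GaussianInt) :
    AddSubgroup.closure {(v : ℂ), (w : ℂ)} ≤ squareLattice := by
  rw [AddSubgroup.closure_le]
  rintro x (rfl | rfl)
  · exact mem_squareLattice.2 ⟨v, rfl⟩
  · exact mem_squareLattice.2 ⟨w, rfl⟩

theorem relIndex_closure_pair (v w : GaussianInt) (h : v.re * w.im - v.im * w.re ≠ 0) :
    (AddSubgroup.closure {(v : ℂ), (w : ℂ)}).relIndex squareLattice =
      (v.re * w.im - v.im * w.re).natAbs := by
  rw [← gaussian_index_closure_pair v w h, ← AddSubgroup.relIndex_top_right,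
    ← AddSubgroup.relIndex_map_map_of_injective _ _
      (f := GaussianInt.toComplex.toAddMonoidHom) (fun x y hxy => GaussianInt.toComplex_inj.1 hxy),
    AddMonoidHom.map_closure, Set.image_pair, ← AddMonoidHom.range_eq_map]
  rfl

/-- A pair of vectors of equal length `√ρ` with longer sum and difference. -/
structure IsReducedPair (v w : ℂ) : Prop where
  pos : 0 < Complex.normSq v
  eq : Complex.normSq w = Complex.normSq v
  add : Complex.normSq v < Complex.normSq (v + w)
  sub : Complex.normSq v < Complex.normSq (v - w)

theorem normSq_int_comb (v w : ℂ) (m n : ℝ) :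
    Complex.normSq (m * v + n * w) = m ^ 2 * Complex.normSq v + n ^ 2 * Complex.normSq w +
      2 * m * n * (v.re * w.re + v.im * w.im) := by
  simp [Complex.normSq_apply]
  ring

/-- Expanding |v ± w|² shows that the two strict inequalities confine the angle between v and w
strictly between 60° and 120°. -/
theorem IsReducedPair.abs_lt {v w : ℂ} (h : IsReducedPair v w) :
    |2 * (v.re * w.re + v.im * w.im)| < Complex.normSq v := by
  have h1 := normSq_int_comb v w 1 1
  have h2 := normSq_int_comb v w 1 (-1)
  have ha := h.add
  have hs := h.sub
  have he := h.eq
  norm_num at h1 h2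
  rw [← sub_eq_add_neg] at h2
  rw [_root_.abs_lt]
  constructor <;> linarith

/-- In the lattice of a reduced pair the minimal vectors are `±v`, `±w`. -/
theorem IsReducedPair.minimal {v w : ℂ} (h : IsReducedPair v w) (m n : ℤ)
    (hmn : (m : ℂ) * v + n * w ≠ 0) :
    Complex.normSq v ≤ Complex.normSq (m * v + n * w) ∧
      (Complex.normSq (m * v + n * w) ≤ Complex.normSq v →
        (m : ℂ) * v + n * w = v ∨ (m : ℂ) * v + n * w = -v ∨ (m : ℂ) * v + n * w = w ∨
          (m : ℂ) * v + n * w = -w) := by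
  have hc := h.abs_lt
  have hp := h.pos
  have e := normSq_int_comb v w m n
  rw [h.eq] at e
  push_cast at e
  set ρ := Complex.normSq v
  set c := v.re * w.re + v.im * w.im
  rw [_root_.abs_lt] at hc
  by_cases hm : m = 0
  · subst hm
    have hn : n ≠ 0 := by rintro rfl; simp at hmn
    have hn1 : (1 : ℝ) ≤ (n : ℝ) ^ 2 := by
      have : 0 < n ^ 2 := by positivity
      exact_mod_cast this
    rw [e]
    constructor
    · simp; nlinarith
    · intro h1
      have : (n : ℝ) ^ 2 ≤ 1 := by
        by_contra hh
        push Not at hh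
        simp at h1
        nlinarith
      have h3 : n ^ 2 ≤ 1 := by exact_mod_cast this
      have h4 : n = 1 ∨ n = -1 := by
        have := abs_le_of_sq_le_sq' (by linarith : n ^ 2 ≤ 1 ^ 2) (by norm_num)
        omega
      rcases h4 with rfl | rfl <;> simp
  by_cases hn : n = 0
  · subst hn
    have hm1 : (1 : ℝ) ≤ (m : ℝ) ^ 2 := by
      have : 0 < m ^ 2 := by positivity
      exact_mod_cast this
    rw [e]
    constructor
    · simp; nlinarith
    · intro h1
      have : (m : ℝ) ^ 2 ≤ 1 := by
        by_contra hh
        push Not at hh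
        simp at h1
        nlinarith
      have h3 : m ^ 2 ≤ 1 := by exact_mod_cast this
      have h4 : m = 1 ∨ m = -1 := by
        have := abs_le_of_sq_le_sq' (by linarith : m ^ 2 ≤ 1 ^ 2) (by norm_num)
        omega
      rcases h4 with rfl | rfl <;> simp
  · have hlt : ρ < Complex.normSq (m * v + n * w) := by
      rw [e]
      have h0 : m * n ≠ 0 := mul_ne_zero hm hn
      -- As |2c| < ρ, the form (m² + n²)ρ + 2mnc exceeds (m² + n² − |mn|)ρ, which is at least |mn|ρ
      -- ≥ ρ.
      rcases lt_or_gt_of_ne h0 with h0 | h0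
      · have h1 : (m : ℝ) * n ≤ -1 := by
          have : m * n ≤ -1 := by omega
          exact_mod_cast this
        nlinarith [sq_nonneg ((m : ℝ) + n)]
      · have h1 : 1 ≤ (m : ℝ) * n := by
          have : 1 ≤ m * n := by omega
          exact_mod_cast this
        nlinarith [sq_nonneg ((m : ℝ) - n)]
    exact ⟨hlt.le, fun h1 => absurd h1 (not_le.2 hlt)⟩

theorem norm_le_norm_iff_normSq (x y : ℂ) : ‖x‖ ≤ ‖y‖ ↔ Complex.normSq x ≤ Complex.normSq y := by
  rw [Complex.normSq_eq_norm_sq, Complex.normSq_eq_norm_sq, sq_le_sq₀ (norm_nonneg _) (norm_nonneg _)]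

theorem mem_closure_pair_complex {v w x : ℂ} :
    x ∈ AddSubgroup.closure {v, w} ↔ ∃ m n : ℤ, (m : ℂ) * v + n * w = x := by
  simp [AddSubgroup.mem_closure_pair]

theorem IsReducedPair.isMinimal_left {v w : ℂ} (h : IsReducedPair v w) :
    v ∈ AddSubgroup.closure {v, w} ∧ v ≠ 0 ∧
      ∀ x ∈ AddSubgroup.closure {v, w}, x ≠ 0 → ‖v‖ ≤ ‖x‖ := by
  refine ⟨AddSubgroup.subset_closure (by simp), Complex.normSq_pos.1 h.pos, ?_⟩
  intro x hx hx0
  obtain ⟨m, n, rfl⟩ := mem_closure_pair_complex.1 hx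
  rw [norm_le_norm_iff_normSq]
  exact (h.minimal m n hx0).1

theorem IsReducedPair.symm {v w : ℂ} (h : IsReducedPair v w) : IsReducedPair w v :=
  ⟨h.eq ▸ h.pos, h.eq.symm, by rw [add_comm, h.eq]; exact h.add,
    by rw [← neg_sub, Complex.normSq_neg, h.eq]; exact h.sub⟩

theorem IsReducedPair.isMinimal_right {v w : ℂ} (h : IsReducedPair v w) :
    w ∈ AddSubgroup.closure {v, w} ∧ w ≠ 0 ∧
      ∀ x ∈ AddSubgroup.closure {v, w}, x ≠ 0 → ‖w‖ ≤ ‖x‖ := by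
  have := h.symm.isMinimal_left
  rwa [Set.pair_comm] at this

/-- By Lagrange's identity det² + ⟨v, w⟩² = |v|²|w|², a vanishing determinant would force |⟨v, w⟩| =
|v|², against `IsReducedPair.abs_lt`. -/
theorem IsReducedPair.det_ne_zero {v w : ℂ} (h : IsReducedPair v w) :
    v.re * w.im - v.im * w.re ≠ 0 := by
  intro h0
  have h1 : (v.re * w.im - v.im * w.re) ^ 2 + (v.re * w.re + v.im * w.im) ^ 2 =
      Complex.normSq v * Complex.normSq w := by
    simp [Complex.normSq_apply]; ring
  rw [h0, h.eq] at h1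
  have h2 := h.abs_lt
  have h3 := h.pos
  rw [_root_.abs_lt] at h2
  nlinarith

theorem span_pair_eq_top {v w : ℂ} (h : v.re * w.im - v.im * w.re ≠ 0) (S : Submodule ℝ ℂ)
    (hv : v ∈ S) (hw : w ∈ S) : S = ⊤ := by
  rw [eq_top_iff]
  intro x _
  have : x = ((x.re * w.im - x.im * w.re) / (v.re * w.im - v.im * w.re) : ℝ) • v +
      ((v.re * x.im - v.im * x.re) / (v.re * w.im - v.im * w.re) : ℝ) • w := by
    apply Complex.ext
    · simp only [Complex.add_re, Complex.smul_re, smul_eq_mul]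
      rw [div_mul_eq_mul_div, div_mul_eq_mul_div, ← add_div, eq_div_iff h]
      ring
    · simp only [Complex.add_im, Complex.smul_im, smul_eq_mul]
      rw [div_mul_eq_mul_div, div_mul_eq_mul_div, ← add_div, eq_div_iff h]
      ring
  rw [this]
  exact S.add_mem (S.smul_mem _ hv) (S.smul_mem _ hw)

theorem IsReducedPair.isWellRounded {v w : ℂ} (h : IsReducedPair v w) :
    IsWellRounded (AddSubgroup.closure {v, w}) :=
  span_pair_eq_top h.det_ne_zero _ (Submodule.subset_span h.isMinimal_left)
    (Submodule.subset_span h.isMinimal_right)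

end Lattice

/-! ### Parametrization of the well-rounded sublattices by their diagonals. -/

theorem gaussian_re (z : GaussianInt) : (z : ℂ).re = (z.re : ℝ) :=
  (GaussianInt.intCast_re z).symm

theorem gaussian_im (z : GaussianInt) : (z : ℂ).im = (z.im : ℝ) :=
  (GaussianInt.intCast_im z).symm

/-- The half-open first quadrant, a fundamental domain for multiplication by units. -/
def InQuadrant (z : GaussianInt) : Prop := 0 < z.re ∧ 0 ≤ z.im

/-- Primitive Gaussian integers of the quadrant with norm `n`. -/
def primSet (n : ℕ) : Set GaussianInt :=
  {z | InQuadrant z ∧ IsCoprime z.re z.im ∧ z.norm = n}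

/-- Gaussian integers of the quadrant with norm `n`. -/
def simSet (n : ℕ) : Set GaussianInt := {z | InQuadrant z ∧ z.norm = n}

/-- Parameters `(z, a, b)` of the well-rounded sublattices of index `n`. -/
def wrSet (n : ℕ) : Set (GaussianInt × ℕ × ℕ) :=
  {t | InQuadrant t.1 ∧ IsCoprime t.1.re t.1.im ∧ 0 < t.2.1 ∧ 0 < t.2.2 ∧
    t.2.1 ^ 2 ≤ 3 * t.2.2 ^ 2 ∧ t.2.2 ^ 2 ≤ 3 * t.2.1 ^ 2 ∧
    (2 ∣ t.1.re * t.2.1 - t.1.im * t.2.2 ∧ 2 ∣ t.1.re * t.2.2 + t.1.im * t.2.1) ∧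
    t.1.norm * t.2.1 * t.2.2 = 2 * n}

/-- The lattice generated by `(u + t) / 2` and `(u - t) / 2`. -/
def halfLattice (u t : ℂ) : AddSubgroup ℂ := AddSubgroup.closure {(u + t) / 2, (u - t) / 2}

/-- A change of sign or of order of the diagonals only permutes the two generators up to sign. -/
theorem halfLattice_neg_left (u t : ℂ) : halfLattice (-u) t = halfLattice u t := by
  ext x
  simp only [halfLattice, mem_closure_pair_complex]
  constructor <;> rintro ⟨m, n, rfl⟩ <;> refine ⟨-n, -m, ?_⟩ <;> push_cast <;> ring

theorem halfLattice_neg_right (u t : ℂ) : halfLattice u (-t) = halfLattice u t := by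
  ext x
  simp only [halfLattice, mem_closure_pair_complex]
  constructor <;> rintro ⟨m, n, rfl⟩ <;> refine ⟨n, m, ?_⟩ <;> ring

theorem halfLattice_swap (u t : ℂ) : halfLattice u t = halfLattice t u := by
  ext x
  simp only [halfLattice, mem_closure_pair_complex]
  constructor <;> rintro ⟨m, n, rfl⟩ <;> refine ⟨m, -n, ?_⟩ <;> push_cast <;> ring

/-- The well-rounded lattice with parameters `(z, a, b)`. -/
def wrLattice (p : GaussianInt × ℕ × ℕ) : AddSubgroup ℂ :=
  halfLattice ((p.1 : ℂ) * p.2.1) ((p.1 : ℂ) * p.2.2 * Complex.I)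

/-- The 3-adic valuations of the two sides have different parity. This excludes hexagonal
sublattices and makes the weak inequalities of `wrSet` strict. -/
theorem sq_ne_three_mul_sq {a b : ℕ} (ha : 0 < a) : a ^ 2 ≠ 3 * b ^ 2 := by
  intro h
  have hb : b ≠ 0 := by rintro rfl; simp at h; omega
  have h1 := congrArg (padicValNat 3) h
  rw [padicValNat.pow, padicValNat.mul (by norm_num) (by positivity), padicValNat.pow,
    padicValNat.self (by norm_num)] at h1
  omega

theorem InQuadrant.ne_zero {z : GaussianInt} (h : InQuadrant z) : z ≠ 0 := by
  rintro rfl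
  simp [InQuadrant] at h

/-- Both generators have squared length N(z)(a² + b²)/4, while their sum and difference have N(z)a²
and N(z)b²; being reduced is therefore b² < 3a² and a² < 3b². -/
theorem wrLattice_reduced {p : GaussianInt × ℕ × ℕ} {n : ℕ} (hp : p ∈ wrSet n) :
    IsReducedPair (((p.1 : ℂ) * p.2.1 + (p.1 : ℂ) * p.2.2 * Complex.I) / 2)
      (((p.1 : ℂ) * p.2.1 - (p.1 : ℂ) * p.2.2 * Complex.I) / 2) := by
  obtain ⟨hQ, -, ha, hb, hab, hba, -, -⟩ := hp
  obtain ⟨z, a, b⟩ := p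
  simp only at *
  have hz : 0 < Complex.normSq (z : ℂ) := by
    rw [Complex.normSq_pos]
    exact fun h => hQ.ne_zero (GaussianInt.toComplex_eq_zero.1 h)
  have hlt1 : (a : ℝ) ^ 2 < 3 * b ^ 2 := by
    exact_mod_cast lt_of_le_of_ne hab (sq_ne_three_mul_sq ha)
  have hlt2 : (b : ℝ) ^ 2 < 3 * a ^ 2 := by
    exact_mod_cast lt_of_le_of_ne hba (sq_ne_three_mul_sq hb)
  have e1 : Complex.normSq (((z : ℂ) * a + (z : ℂ) * b * Complex.I) / 2) =
      Complex.normSq z * (a ^ 2 + b ^ 2) / 4 := by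
    simp [Complex.normSq_apply]; ring
  have e2 : Complex.normSq (((z : ℂ) * a - (z : ℂ) * b * Complex.I) / 2) =
      Complex.normSq z * (a ^ 2 + b ^ 2) / 4 := by
    simp [Complex.normSq_apply]; ring
  have e3 : Complex.normSq (((z : ℂ) * a + (z : ℂ) * b * Complex.I) / 2 +
      ((z : ℂ) * a - (z : ℂ) * b * Complex.I) / 2) = Complex.normSq z * a ^ 2 := by
    rw [← add_div]
    simp [Complex.normSq_apply]; ring
  have e4 : Complex.normSq (((z : ℂ) * a + (z : ℂ) * b * Complex.I) / 2 -
      ((z : ℂ) * a - (z : ℂ) * b * Complex.I) / 2) = Complex.normSq z * b ^ 2 := by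
    rw [← sub_div]
    simp [Complex.normSq_apply]; ring
  refine ⟨?_, by rw [e1, e2], ?_, ?_⟩
  · rw [e1]; positivity
  · rw [e1, e3]; nlinarith
  · rw [e1, e4]; nlinarith

theorem wrLattice_mem {p : GaussianInt × ℕ × ℕ} {n : ℕ} (hn : n ≠ 0) (hp : p ∈ wrSet n) :
    wrLattice p ≤ squareLattice ∧ (wrLattice p).relIndex squareLattice = n ∧
      IsWellRounded (wrLattice p) := by
  have hred := wrLattice_reduced hp
  obtain ⟨hQ, -, ha, hb, hab, hba, ⟨⟨c, hc⟩, ⟨d, hd⟩⟩, hnorm⟩ := hp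
  obtain ⟨z, a, b⟩ := p
  simp only at *
  -- The parity condition makes z(a + bi)/2 the Gaussian integer c + di; the other generator is za
  -- minus it.
  have hv : ((⟨c, d⟩ : GaussianInt) : ℂ) = ((z : ℂ) * a + (z : ℂ) * b * Complex.I) / 2 := by
    rw [eq_div_iff (by norm_num)]
    have hc' : (z.re * a - z.im * b : ℝ) = 2 * c := by exact_mod_cast hc
    have hd' : (z.re * b + z.im * a : ℝ) = 2 * d := by exact_mod_cast hd
    apply Complex.ext <;> simp [gaussian_re, gaussian_im, -GaussianInt.intCast_re, -GaussianInt.intCast_im] <;> linarith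
  have hw : ((⟨z.re * a - c, z.im * a - d⟩ : GaussianInt) : ℂ) =
      ((z : ℂ) * a - (z : ℂ) * b * Complex.I) / 2 := by
    rw [eq_div_iff (by norm_num)]
    have hc' : (z.re * a - z.im * b : ℝ) = 2 * c := by exact_mod_cast hc
    have hd' : (z.re * b + z.im * a : ℝ) = 2 * d := by exact_mod_cast hd
    apply Complex.ext <;> simp [gaussian_re, gaussian_im, -GaussianInt.intCast_re, -GaussianInt.intCast_im] <;> linarith
  have hdet : c * (z.im * a - d) - d * (z.re * a - c) = -n := by
    have hN : (z.re * z.re + z.im * z.im) * a * b = 2 * n := by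
      rw [← hnorm, Zsqrtd.norm_def]; ring
    have : 2 * (c * (z.im * a - d) - d * (z.re * a - c)) = 2 * (-n) := by
      linear_combination (-z.im * a) * hc + (z.re * a) * hd - hN
    linarith
  have hL : wrLattice (z, a, b) = AddSubgroup.closure {((⟨c, d⟩ : GaussianInt) : ℂ),
      ((⟨z.re * a - c, z.im * a - d⟩ : GaussianInt) : ℂ)} := by
    rw [hv, hw]; rfl
  refine ⟨?_, ?_, ?_⟩
  · rw [hL]; exact closure_pair_le_squareLattice _ _
  · rw [hL, relIndex_closure_pair]
    · simp only [hdet]; simp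
    · simp only [hdet]; simpa using hn
  · exact hred.isWellRounded

/-- A minimal vector of a lattice generated by a reduced pair is one of the obvious four. -/
theorem IsReducedPair.eq_of_minimal {v w x : ℂ} (h : IsReducedPair v w)
    (hx : x ∈ AddSubgroup.closure {v, w}) (hx0 : x ≠ 0) (hxn : Complex.normSq x ≤ Complex.normSq v) :
    x = v ∨ x = -v ∨ x = w ∨ x = -w := by
  obtain ⟨m, n, rfl⟩ := mem_closure_pair_complex.1 hx
  exact (h.minimal m n hx0).2 hxn

theorem normSq_eq_of_closure_eq {v w v' w' : ℂ} (h : IsReducedPair v w) (h' : IsReducedPair v' w')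
    (e : AddSubgroup.closure {v', w'} = AddSubgroup.closure {v, w}) :
    Complex.normSq v' = Complex.normSq v := by
  apply le_antisymm
  · rw [← norm_le_norm_iff_normSq]
    exact h'.isMinimal_left.2.2 v (e ▸ h.isMinimal_left.1) h.isMinimal_left.2.1
  · rw [← norm_le_norm_iff_normSq]
    exact h.isMinimal_left.2.2 v' (e ▸ h'.isMinimal_left.1) h'.isMinimal_left.2.1

/-- The sums of the generators of reduced pairs of the same lattice agree up to sign and up to
exchanging sum and difference. -/
theorem IsReducedPair.add_eq {v w v' w' : ℂ} (h : IsReducedPair v w) (h' : IsReducedPair v' w')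
    (e : AddSubgroup.closure {v', w'} = AddSubgroup.closure {v, w}) :
    v' + w' = v + w ∨ v' + w' = -(v + w) ∨ v' + w' = v - w ∨ v' + w' = -(v - w) := by
  have hn := normSq_eq_of_closure_eq h h' e
  have hv := h.eq_of_minimal (e ▸ h'.isMinimal_left.1) h'.isMinimal_left.2.1 hn.le
  have hw := h.eq_of_minimal (e ▸ h'.isMinimal_right.1) h'.isMinimal_right.2.1
    (h'.eq.trans hn).le
  have h1 : v' + w' ≠ 0 := by
    intro h0
    have h1 := h'.add
    have h2 := h'.pos
    rw [h0] at h1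
    simp at h1
    linarith
  have h2 : v' - w' ≠ 0 := by
    intro h0
    have h1 := h'.sub
    have h2 := h'.pos
    rw [h0] at h1
    simp at h1
    linarith
  -- Of the sixteen sign choices, those with v' = ± w' contradict the non-vanishing of sum and
  -- difference; the others are the four alternatives.
  rcases hv with rfl | rfl | rfl | rfl <;> rcases hw with rfl | rfl | rfl | rfl <;>
    first
    | exact absurd (sub_self _) h2
    | (exfalso; exact h1 (by ring1))
    | (left; ring1)
    | (right; left; ring1)
    | (right; right; left; ring1)
    | (right; right; right; ring1)

/-- The half-open quadrant is disjoint from its three rotated copies, so a unit relating two of its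
elements is 1. -/
theorem InQuadrant.eq_of_mul_eq {z z' : GaussianInt} (hz : InQuadrant z) (hz' : InQuadrant z')
    {a a' : ℕ} (ha : 0 < a) (ha' : 0 < a') {ε : ℂ}
    (hε : ε = 1 ∨ ε = -1 ∨ ε = Complex.I ∨ ε = -Complex.I)
    (h : (z' : ℂ) * a' = ε * ((z : ℂ) * a)) : ε = 1 ∧ z'.re * a' = z.re * a ∧ z'.im * a' = z.im * a := by
  have p1 := mul_pos hz.1 (Int.natCast_pos.2 ha)
  have p2 := mul_nonneg hz.2 (Int.natCast_pos.2 ha).le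
  have p3 := mul_pos hz'.1 (Int.natCast_pos.2 ha')
  have p4 := mul_nonneg hz'.2 (Int.natCast_pos.2 ha').le
  have hre := congrArg Complex.re h
  have him := congrArg Complex.im h
  simp only [Complex.mul_re, Complex.mul_im, gaussian_re, gaussian_im, Complex.natCast_re,
    Complex.natCast_im, mul_zero, sub_zero, zero_add] at hre him
  rcases hε with rfl | rfl | rfl | rfl
  · simp only [Complex.one_re, Complex.one_im, one_mul, zero_mul, sub_zero, add_zero] at hre him
    exact ⟨rfl, by exact_mod_cast hre, by exact_mod_cast him⟩
  · simp only [Complex.neg_re, Complex.neg_im, Complex.one_re, Complex.one_im] at hre him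
    norm_cast at hre him
    omega
  · simp only [Complex.I_re, Complex.I_im] at hre him
    norm_cast at hre him
    omega
  · simp only [Complex.neg_re, Complex.neg_im, Complex.I_re, Complex.I_im] at hre him
    norm_cast at hre him
    omega

/-- By Bézout, a is the content of az when z is primitive, so a and a' divide each other. -/
theorem eq_of_coprime_of_mul_eq {z z' : GaussianInt} (hz : IsCoprime z.re z.im)
    (hz' : IsCoprime z'.re z'.im) {a a' : ℕ} (ha : 0 < a)
    (h1 : z'.re * a' = z.re * a) (h2 : z'.im * a' = z.im * a) : a' = a ∧ z' = z := by
  have key : ∀ {z z' : GaussianInt} {a a' : ℕ}, IsCoprime z.re z.im →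
      z'.re * a' = z.re * a → z'.im * a' = z.im * a → (a' : ℤ) ∣ a := by
    intro z z' a a' ⟨s, t, hst⟩ h1 h2
    refine ⟨s * z'.re + t * z'.im, ?_⟩
    linear_combination (-a : ℤ) * hst - s * h1 - t * h2
  have d1 := Int.natCast_dvd_natCast.1 (key hz h1 h2)
  have d2 := Int.natCast_dvd_natCast.1 (key hz' h1.symm h2.symm)
  have e := Nat.dvd_antisymm d1 d2
  subst e
  have hne : (a' : ℤ) ≠ 0 := by exact_mod_cast ha.ne'
  exact ⟨rfl, Zsqrtd.ext (mul_right_cancel₀ hne h1) (mul_right_cancel₀ hne h2)⟩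

/-- The lattice determines its minimal vectors up to sign, hence the diagonal za up to sign and
exchange with the other diagonal. The quadrant and primitivity then give z and a, and the common
index gives b. -/
theorem wrLattice_injOn (n : ℕ) : Set.InjOn wrLattice (wrSet n) := by
  intro p hp p' hp' e
  have hr := wrLattice_reduced hp
  have hr' := wrLattice_reduced hp'
  have hs := hr.add_eq hr' e.symm
  obtain ⟨hQ, hc, ha, hb, -, -, -, hN⟩ := hp
  obtain ⟨hQ', hc', ha', hb', -, -, -, hN'⟩ := hp'
  obtain ⟨z, a, b⟩ := p
  obtain ⟨z', a', b'⟩ := p'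
  simp only at *
  have hkey : a' = a ∧ z' = z := by
    have e0 : ∀ x y : ℂ, (x + y) / 2 + (x - y) / 2 = x := fun x y => by ring
    have e1 : ∀ x y : ℂ, (x + y) / 2 - (x - y) / 2 = y := fun x y => by ring
    rw [e0, e0, e1] at hs
    rcases hs with hs | hs | hs | hs
    · have := hQ.eq_of_mul_eq hQ' ha ha' (ε := 1) (by simp) (by rw [hs]; ring)
      exact eq_of_coprime_of_mul_eq hc hc' ha this.2.1 this.2.2
    · have := hQ.eq_of_mul_eq hQ' ha ha' (ε := -1) (by simp) (by rw [hs]; ring)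
      exact eq_of_coprime_of_mul_eq hc hc' ha this.2.1 this.2.2
    -- Exchanged diagonals would differ by a factor ± i between elements of the quadrant.
    · have := hQ.eq_of_mul_eq hQ' hb ha' (ε := Complex.I) (by simp) (by rw [hs]; ring)
      simpa using congrArg Complex.re this.1
    · have := hQ.eq_of_mul_eq hQ' hb ha' (ε := -Complex.I) (by simp) (by rw [hs]; ring)
      simpa using congrArg Complex.re this.1
  obtain ⟨rfl, rfl⟩ := hkey
  have hpos : 0 < z'.norm * (a' : ℤ) :=
    mul_pos (GaussianInt.norm_pos.2 hQ.ne_zero) (by exact_mod_cast ha)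
  have hbb : (b : ℤ) = b' := mul_left_cancel₀ hpos.ne' (hN.trans hN'.symm)
  rw [Int.natCast_inj.1 hbb]

/-- A well-rounded lattice has two independent minimal vectors. -/
theorem exists_minimal_pair {Λ : AddSubgroup ℂ} (h : IsWellRounded Λ) :
    ∃ v w : ℂ, (v ∈ Λ ∧ v ≠ 0 ∧ ∀ x ∈ Λ, x ≠ 0 → ‖v‖ ≤ ‖x‖) ∧
      (w ∈ Λ ∧ w ≠ 0 ∧ ∀ x ∈ Λ, x ≠ 0 → ‖w‖ ≤ ‖x‖) ∧ v.re * w.im - v.im * w.re ≠ 0 := by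
  unfold IsWellRounded at h
  set M := {v : ℂ | v ∈ Λ ∧ v ≠ 0 ∧ ∀ w ∈ Λ, w ≠ 0 → ‖v‖ ≤ ‖w‖} with hM
  by_contra hcon
  push Not at hcon
  have hne : M.Nonempty := by
    rw [Set.nonempty_iff_ne_empty]
    intro h0
    rw [h0, Submodule.span_empty] at h
    exact bot_ne_top h
  obtain ⟨v, hv⟩ := hne
  have hle : (⊤ : Submodule ℝ ℂ) ≤ Submodule.span ℝ {v} := by
    rw [← h, Submodule.span_le]
    intro w hw
    have hd := hcon v w hv hw
    have hv0 : 0 < Complex.normSq v := Complex.normSq_pos.2 hv.2.1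
    rw [SetLike.mem_coe, Submodule.mem_span_singleton]
    refine ⟨(v.re * w.re + v.im * w.im) / Complex.normSq v, ?_⟩
    have hns : Complex.normSq v = v.re * v.re + v.im * v.im := Complex.normSq_apply v
    apply Complex.ext
    · rw [Complex.smul_re, smul_eq_mul, div_mul_eq_mul_div, div_eq_iff hv0.ne', hns]
      linear_combination v.im * hd
    · rw [Complex.smul_im, smul_eq_mul, div_mul_eq_mul_div, div_eq_iff hv0.ne', hns]
      linear_combination -v.re * hd
  have h1 := Submodule.finrank_mono hle
  rw [finrank_top, Complex.finrank_real_complex] at h1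
  have h2 := finrank_span_le_card (R := ℝ) ({v} : Set ℂ)
  simp at h2
  omega

/-- Independent minimal vectors generate the lattice. -/
theorem eq_closure_of_minimal {Λ : AddSubgroup ℂ} {v w : ℂ}
    (hv : v ∈ Λ ∧ v ≠ 0 ∧ ∀ x ∈ Λ, x ≠ 0 → ‖v‖ ≤ ‖x‖)
    (hw : w ∈ Λ ∧ w ≠ 0 ∧ ∀ x ∈ Λ, x ≠ 0 → ‖w‖ ≤ ‖x‖)
    (hd : v.re * w.im - v.im * w.re ≠ 0) : Λ = AddSubgroup.closure {v, w} := by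
  apply le_antisymm
  · intro x hx
    set D := v.re * w.im - v.im * w.re with hD
    set α := (x.re * w.im - x.im * w.re) / D with hα
    set β := (v.re * x.im - v.im * x.re) / D with hβ
    have hx' : x = (α : ℂ) * v + β * w := by
      apply Complex.ext
      · simp only [Complex.add_re, Complex.re_ofReal_mul]
        rw [hα, hβ, div_mul_eq_mul_div, div_mul_eq_mul_div, ← add_div, eq_div_iff hd, hD]
        ring
      · simp only [Complex.add_im, Complex.im_ofReal_mul]
        rw [hα, hβ, div_mul_eq_mul_div, div_mul_eq_mul_div, ← add_div, eq_div_iff hd, hD]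
        ring
    rw [mem_closure_pair_complex]
    -- Otherwise the remainder y is a non-zero lattice vector with coefficients at most 1/2 in
    -- absolute value, so |y|² ≤ |v|²/2 + |c|/2 < |v|², against minimality. The strict bound |c| <
    -- |v|² is Cauchy–Schwarz for independent vectors.
    refine ⟨round α, round β, ?_⟩
    by_contra hne
    set y := x - ((round α : ℂ) * v + (round β : ℂ) * w) with hy
    have hy0 : y ≠ 0 := sub_ne_zero.2 (Ne.symm hne)
    have hyΛ : y ∈ Λ := by
      refine Λ.sub_mem hx (Λ.add_mem ?_ ?_)
      · simpa using Λ.zsmul_mem hv.1 (round α)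
      · simpa using Λ.zsmul_mem hw.1 (round β)
    have hye : y = ((α - round α : ℝ) : ℂ) * v + ((β - round β : ℝ) : ℂ) * w := by
      rw [hy, hx']; push_cast; ring
    have h1 := (norm_le_norm_iff_normSq _ _).1 (hv.2.2 y hyΛ hy0)
    have heq : Complex.normSq w = Complex.normSq v := le_antisymm
      ((norm_le_norm_iff_normSq _ _).1 (hw.2.2 v hv.1 hv.2.1))
      ((norm_le_norm_iff_normSq _ _).1 (hv.2.2 w hw.1 hw.2.1))
    have hpos : 0 < Complex.normSq v := Complex.normSq_pos.2 hv.2.1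
    rw [hye, normSq_int_comb, heq] at h1
    have ha := abs_sub_round α
    have hb := abs_sub_round β
    set a := α - round α
    set b := β - round β
    set c := v.re * w.re + v.im * w.im with hc
    have hcD : c ^ 2 + D ^ 2 = Complex.normSq v * Complex.normSq w := by
      rw [hc, hD]; simp [Complex.normSq_apply]; ring
    have hclt : |c| < Complex.normSq v := by
      apply abs_lt_of_sq_lt_sq _ hpos.le
      have : 0 < D ^ 2 := by positivity
      rw [heq] at hcD
      nlinarith
    have h2 : |a * b * c| = |a| * |b| * |c| := by rw [abs_mul, abs_mul]
    have h3 := le_abs_self (a * b * c)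
    have h4 : |a| * |b| ≤ 1 / 4 := by
      nlinarith [abs_nonneg a, abs_nonneg b]
    have h5 : a ^ 2 ≤ 1 / 4 := by rw [← sq_abs]; nlinarith [abs_nonneg a]
    have h6 : b ^ 2 ≤ 1 / 4 := by rw [← sq_abs]; nlinarith [abs_nonneg b]
    have h7 : |a| * |b| * |c| ≤ 1 / 4 * |c| := mul_le_mul_of_nonneg_right h4 (abs_nonneg c)
    nlinarith
  · rw [AddSubgroup.closure_le]
    rintro x (rfl | rfl)
    · exact hv.1
    · exact hw.1

theorem exists_inQuadrant_rotation {u : GaussianInt} (hu : u ≠ 0) :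
    ∃ z : GaussianInt, InQuadrant z ∧ (IsCoprime u.re u.im → IsCoprime z.re z.im) ∧
      ((u : ℂ) = z ∨ (u : ℂ) = -z ∨ (u : ℂ) = Complex.I * z ∨ (u : ℂ) = -(Complex.I * z)) := by
  have h0 : u.re ≠ 0 ∨ u.im ≠ 0 := by
    by_contra h
    push Not at h
    exact hu (Zsqrtd.ext h.1 h.2)
  have hI : ∀ z w : GaussianInt, w.re = -z.im → w.im = z.re → (w : ℂ) = Complex.I * z := by
    intro z w h1 h2
    apply Complex.ext
    · rw [gaussian_re, h1, Complex.mul_re, gaussian_im]; simp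
    · rw [gaussian_im, h2, Complex.mul_im, gaussian_re]; simp
  by_cases h1 : 0 < u.re ∧ 0 ≤ u.im
  · exact ⟨u, h1, id, Or.inl rfl⟩
  by_cases h2 : u.re < 0 ∧ u.im ≤ 0
  · refine ⟨-u, ⟨by simp; omega, by simp; omega⟩, fun hc => by simpa using hc.neg_neg, Or.inr (Or.inl ?_)⟩
    simp
  by_cases h3 : u.re ≤ 0 ∧ 0 < u.im
  · refine ⟨⟨u.im, -u.re⟩, ⟨h3.2, by simp; omega⟩, fun hc => hc.symm.neg_right,
      Or.inr (Or.inr (Or.inl (hI _ _ (by simp) rfl)))⟩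
  · refine ⟨⟨-u.im, u.re⟩, ⟨by simp; omega, by simp; omega⟩, fun hc => hc.symm.neg_left,
      Or.inr (Or.inr (Or.inr ?_))⟩
    rw [← hI _ (-u) (by simp) (by simp)]
    simp

theorem halfLattice_normalize {z : ℂ} {g k : ℤ} (hg : g ≠ 0) (hk : k ≠ 0) :
    ∃ a b : ℕ, 0 < a ∧ 0 < b ∧ (a : ℤ) ^ 2 = g ^ 2 ∧ (b : ℤ) ^ 2 = k ^ 2 ∧
      halfLattice (z * g) (z * k * Complex.I) = halfLattice (z * a) (z * b * Complex.I) := by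
  refine ⟨g.natAbs, k.natAbs, Int.natAbs_pos.2 hg, Int.natAbs_pos.2 hk, by simp, by simp, ?_⟩
  have h1 : (g : ℂ) = g.natAbs ∨ (g : ℂ) = -g.natAbs := by
    rcases Int.natAbs_eq g with h | h
    · left
      simpa only [Int.cast_natCast] using congrArg (Int.cast : ℤ → ℂ) h
    · right
      simpa only [Int.cast_natCast, Int.cast_neg] using congrArg (Int.cast : ℤ → ℂ) h
  have h2 : (k : ℂ) = k.natAbs ∨ (k : ℂ) = -k.natAbs := by
    rcases Int.natAbs_eq k with h | h
    · left
      simpa only [Int.cast_natCast] using congrArg (Int.cast : ℤ → ℂ) h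
    · right
      simpa only [Int.cast_natCast, Int.cast_neg] using congrArg (Int.cast : ℤ → ℂ) h
  rcases h1 with h1 | h1 <;> rcases h2 with h2 | h2 <;> rw [h1, h2] <;>
    simp only [mul_neg, neg_mul, halfLattice_neg_left, halfLattice_neg_right]

/-- Write U = gu with u primitive. A Gaussian integer orthogonal to u is an integer multiple of iu,
so T = kiu. Rotating u into the quadrant changes signs and possibly exchanges the two diagonals. -/
theorem exists_wr_parameters {U T : GaussianInt} (hU : U ≠ 0) (hT : T ≠ 0)
    (hUT : U.re * T.re + U.im * T.im = 0) :
    ∃ (z : GaussianInt) (a b : ℕ), InQuadrant z ∧ IsCoprime z.re z.im ∧ 0 < a ∧ 0 < b ∧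
      halfLattice (U : ℂ) (T : ℂ) = wrLattice (z, a, b) ∧
      Complex.normSq U + Complex.normSq T = Complex.normSq z * (a ^ 2 + b ^ 2) := by
  have hgpos : 0 < Int.gcd U.re U.im := by
    rw [Nat.pos_iff_ne_zero, Ne, Int.gcd_eq_zero_iff]
    exact fun h => hU (Zsqrtd.ext h.1 h.2)
  obtain ⟨x, y, hxy, hx, hy⟩ := Int.exists_gcd_one hgpos
  set g : ℤ := (Int.gcd U.re U.im : ℤ) with hg
  have hg0 : g ≠ 0 := by rw [hg]; exact_mod_cast hgpos.ne'
  have hcop : IsCoprime x y := Int.isCoprime_iff_gcd_eq_one.2 hxy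
  obtain ⟨s, t, hst⟩ := hcop
  have hort : x * T.re + y * T.im = 0 := by
    rw [hx, hy] at hUT
    apply mul_left_cancel₀ hg0
    linear_combination hUT
  -- With the Bézout relation sx + ty = 1, this is the only possible k in T = ki(x + yi).
  set k := s * T.im - t * T.re with hk
  have hTim : T.im = k * x := by
    rw [hk]; linear_combination (-T.im) * hst + t * hort
  have hTre : T.re = -(k * y) := by
    rw [hk]; linear_combination (-T.re) * hst + s * hort
  have hk0 : k ≠ 0 := by
    intro h
    rw [h] at hTim hTre
    exact hT (Zsqrtd.ext (by simpa using hTre) (by simpa using hTim))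
  have hu0 : (⟨x, y⟩ : GaussianInt) ≠ 0 := by
    intro h
    have h1 := congrArg Zsqrtd.re h
    have h2 := congrArg Zsqrtd.im h
    simp at h1 h2
    rw [h1, h2] at hst
    simp at hst
  obtain ⟨z, hzQ, hzc, hz⟩ := exists_inQuadrant_rotation hu0
  replace hzc := hzc ⟨s, t, hst⟩
  have hUe : (U : ℂ) = ((⟨x, y⟩ : GaussianInt) : ℂ) * g := by
    apply Complex.ext
    · simp [gaussian_re, gaussian_im, -GaussianInt.intCast_re, -GaussianInt.intCast_im]
      exact_mod_cast hx
    · simp [gaussian_re, gaussian_im, -GaussianInt.intCast_re, -GaussianInt.intCast_im]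
      exact_mod_cast hy
  have hTe : (T : ℂ) = ((⟨x, y⟩ : GaussianInt) : ℂ) * k * Complex.I := by
    apply Complex.ext
    · simp [gaussian_re, gaussian_im, -GaussianInt.intCast_re, -GaussianInt.intCast_im]
      rw [hTre]; push_cast; ring
    · simp [gaussian_re, gaussian_im, -GaussianInt.intCast_re, -GaussianInt.intCast_im]
      rw [hTim]; push_cast; ring
  obtain ⟨a, b, ha, hb, hag, hbk, hL⟩ := halfLattice_normalize (z := (z : ℂ)) hg0 hk0
  obtain ⟨a', b', ha', hb', hag', hbk', hL'⟩ := halfLattice_normalize (z := (z : ℂ)) hk0 hg0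
  have haR : (a : ℝ) ^ 2 = g ^ 2 := by exact_mod_cast hag
  have hbR : (b : ℝ) ^ 2 = k ^ 2 := by exact_mod_cast hbk
  have haR' : (a' : ℝ) ^ 2 = k ^ 2 := by exact_mod_cast hag'
  have hbR' : (b' : ℝ) ^ 2 = g ^ 2 := by exact_mod_cast hbk'
  have hns : ∀ m : ℤ, Complex.normSq (m : ℂ) = (m : ℝ) ^ 2 := by
    intro m
    rw [← Complex.ofReal_intCast, Complex.normSq_ofReal, sq]
  have hnz : Complex.normSq ((⟨x, y⟩ : GaussianInt) : ℂ) = Complex.normSq (z : ℂ) := by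
    rcases hz with h | h | h | h <;> rw [h] <;> simp
  have hsum : Complex.normSq (U : ℂ) + Complex.normSq (T : ℂ) =
      Complex.normSq (z : ℂ) * ((g : ℝ) ^ 2 + k ^ 2) := by
    rw [hUe, hTe, Complex.normSq_mul, Complex.normSq_mul, Complex.normSq_mul, hnz, hns, hns,
      Complex.normSq_I]
    ring
  rcases hz with h | h | h | h
  · refine ⟨z, a, b, hzQ, hzc, ha, hb, ?_, by rw [hsum, haR, hbR]⟩
    rw [hUe, hTe, h, hL]; rfl
  · refine ⟨z, a, b, hzQ, hzc, ha, hb, ?_, by rw [hsum, haR, hbR]⟩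
    rw [hUe, hTe, h]
    simp only [neg_mul, halfLattice_neg_left, halfLattice_neg_right]
    rw [hL]; rfl
  -- For u = ± iz the vector T lies along z and U along iz, so g and k trade places.
  · refine ⟨z, a', b', hzQ, hzc, ha', hb', ?_, by rw [hsum, haR', hbR', add_comm]⟩
    have e1 : Complex.I * (z : ℂ) * k * Complex.I = -((z : ℂ) * k) := by
      linear_combination ((z : ℂ) * k) * Complex.I_mul_I
    have e2 : Complex.I * (z : ℂ) * g = (z : ℂ) * g * Complex.I := by ring
    rw [hUe, hTe, h, e1, e2, halfLattice_swap, halfLattice_neg_left, hL']; rfl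
  · refine ⟨z, a', b', hzQ, hzc, ha', hb', ?_, by rw [hsum, haR', hbR', add_comm]⟩
    have e1 : -(Complex.I * (z : ℂ)) * k * Complex.I = (z : ℂ) * k := by
      linear_combination (-(z : ℂ) * k) * Complex.I_mul_I
    have e2 : -(Complex.I * (z : ℂ)) * g = -((z : ℂ) * g * Complex.I) := by ring
    rw [hUe, hTe, h, e1, e2, halfLattice_swap, halfLattice_neg_right, hL']; rfl

/-- The diagonals of two independent minimal vectors are orthogonal and supply (z, a, b). Comparing
a minimal vector with each diagonal gives the two inequalities; the parity condition holds because
z(a + bi)/2 belongs to the sublattice. -/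
theorem wrLattice_surj {n : ℕ} {Λ : AddSubgroup ℂ} (hle : Λ ≤ squareLattice)
    (hi : Λ.relIndex squareLattice = n) (hwr : IsWellRounded Λ) :
    ∃ p ∈ wrSet n, wrLattice p = Λ := by
  obtain ⟨v, w, hv, hw, hd⟩ := exists_minimal_pair hwr
  have hΛ := eq_closure_of_minimal hv hw hd
  obtain ⟨V, rfl⟩ := mem_squareLattice.1 (hle hv.1)
  obtain ⟨W, rfl⟩ := mem_squareLattice.1 (hle hw.1)
  have heq : Complex.normSq (W : ℂ) = Complex.normSq (V : ℂ) := le_antisymm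
    ((norm_le_norm_iff_normSq _ _).1 (hw.2.2 _ hv.1 hv.2.1))
    ((norm_le_norm_iff_normSq _ _).1 (hv.2.2 _ hw.1 hw.2.1))
  have hU : V + W ≠ 0 := by
    intro h
    apply hd
    rw [eq_neg_of_add_eq_zero_right h]
    simp; ring
  have hT : V - W ≠ 0 := by
    intro h
    apply hd
    rw [← sub_eq_zero.1 h]
    ring
  have hUT : (V + W).re * (V - W).re + (V + W).im * (V - W).im = 0 := by
    rw [← GaussianInt.intCast_real_norm, ← GaussianInt.intCast_real_norm] at heq
    have heq' : W.norm = V.norm := by exact_mod_cast heq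
    rw [Zsqrtd.norm_def, Zsqrtd.norm_def] at heq'
    simp only [Zsqrtd.re_add, Zsqrtd.re_sub, Zsqrtd.im_add, Zsqrtd.im_sub]
    linear_combination -heq'
  obtain ⟨z, a, b, hQ, hc, ha, hb, hL, hsum⟩ := exists_wr_parameters hU hT hUT
  have hΛ' : wrLattice (z, a, b) = Λ := by
    rw [← hL, hΛ]
    simp only [halfLattice, GaussianInt.toComplex_add, GaussianInt.toComplex_sub]
    congr 2
    · ring
    · congr 1; ring
  have hz0 : (z : ℂ) ≠ 0 := fun h => hQ.ne_zero (GaussianInt.toComplex_eq_zero.1 h)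
  have hzpos : 0 < Complex.normSq (z : ℂ) := Complex.normSq_pos.2 hz0
  have hpar : 4 * Complex.normSq (V : ℂ) = Complex.normSq (z : ℂ) * (a ^ 2 + b ^ 2) := by
    rw [← hsum]
    have : Complex.normSq (V : ℂ) + Complex.normSq (W : ℂ) = 2 * Complex.normSq (V : ℂ) := by
      rw [heq]; ring
    rw [show 4 * Complex.normSq (V : ℂ) =
      2 * (Complex.normSq (V : ℂ) + Complex.normSq (W : ℂ)) by rw [this]; ring]
    simp [Complex.normSq_apply]; ring
  have hm1 : (z : ℂ) * a ∈ Λ := by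
    rw [← hΛ']
    exact mem_closure_pair_complex.2 ⟨1, 1, by push_cast; ring⟩
  have hm2 : (z : ℂ) * b * Complex.I ∈ Λ := by
    rw [← hΛ']
    exact mem_closure_pair_complex.2 ⟨1, -1, by push_cast; ring⟩
  have hm3 : ((z : ℂ) * a + (z : ℂ) * b * Complex.I) / 2 ∈ Λ := by
    rw [← hΛ']
    exact mem_closure_pair_complex.2 ⟨1, 0, by push_cast; ring⟩
  have ha0 : (a : ℂ) ≠ 0 := by exact_mod_cast ha.ne'
  have hb0 : (b : ℂ) ≠ 0 := by exact_mod_cast hb.ne'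
  have hi1 := (norm_le_norm_iff_normSq _ _).1 (hv.2.2 _ hm1 (mul_ne_zero hz0 ha0))
  have hi2 := (norm_le_norm_iff_normSq _ _).1
    (hv.2.2 _ hm2 (mul_ne_zero (mul_ne_zero hz0 hb0) Complex.I_ne_zero))
  rw [Complex.normSq_mul, Complex.normSq_natCast] at hi1
  rw [Complex.normSq_mul, Complex.normSq_mul, Complex.normSq_natCast, Complex.normSq_I] at hi2
  have hba : b ^ 2 ≤ 3 * a ^ 2 := by
    have : Complex.normSq (z : ℂ) * (b : ℝ) ^ 2 ≤ Complex.normSq (z : ℂ) * (3 * (a : ℝ) ^ 2) := by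
      nlinarith
    exact_mod_cast le_of_mul_le_mul_left this hzpos
  have hab : a ^ 2 ≤ 3 * b ^ 2 := by
    have : Complex.normSq (z : ℂ) * (a : ℝ) ^ 2 ≤ Complex.normSq (z : ℂ) * (3 * (b : ℝ) ^ 2) := by
      nlinarith
    exact_mod_cast le_of_mul_le_mul_left this hzpos
  obtain ⟨c, hcv⟩ := mem_squareLattice.1 (hle hm3)
  rw [eq_div_iff (by norm_num)] at hcv
  have hre : z.re * a - z.im * b = 2 * c.re := by
    have := congrArg Complex.re hcv
    simp [gaussian_re, gaussian_im, -GaussianInt.intCast_re, -GaussianInt.intCast_im] at this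
    have h' : (z.re * a - z.im * b : ℝ) = 2 * c.re := by linarith
    exact_mod_cast h'
  have him : z.re * b + z.im * a = 2 * c.im := by
    have := congrArg Complex.im hcv
    simp [gaussian_re, gaussian_im, -GaussianInt.intCast_re, -GaussianInt.intCast_im] at this
    have h' : (z.re * b + z.im * a : ℝ) = 2 * c.im := by linarith
    exact_mod_cast h'
  have hnorm : z.norm * a * b = 2 * (c.im * (z.re * a - c.re) - c.re * (z.im * a - c.im)) := by
    rw [Zsqrtd.norm_def]
    linear_combination (-z.im * a) * hre + (z.re * a) * him
  -- The integer m is N(z)ab/2; that it equals n follows at the end, from the index computed in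
  -- `wrLattice_mem`.
  set m := c.im * (z.re * a - c.re) - c.re * (z.im * a - c.im) with hm
  have hmpos : 0 < m := by
    have : 0 < z.norm * a * b := by
      have := GaussianInt.norm_pos.2 hQ.ne_zero
      positivity
    omega
  have hp : (z, a, b) ∈ wrSet m.toNat := by
    refine ⟨hQ, hc, ha, hb, hab, hba, ⟨⟨_, hre⟩, ⟨_, him⟩⟩, ?_⟩
    rw [Int.toNat_of_nonneg hmpos.le]
    exact hnorm
  have hidx := (wrLattice_mem (by omega) hp).2.1
  rw [hΛ', hi] at hidx
  rw [← hidx] at hp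
  exact ⟨_, hp, hΛ'⟩

theorem aSquare_eq_ncard {n : ℕ} (hn : n ≠ 0) : aSquare n = (wrSet n).ncard := by
  rw [← (wrLattice_injOn n).ncard_image, aSquare, wellRoundedCount]
  congr 1
  ext Λ
  constructor
  · rintro ⟨h1, h2, h3⟩
    exact wrLattice_surj h1 h2 h3
  · rintro ⟨p, hp, rfl⟩
    exact wrLattice_mem hn hp

/-! ### Similar sublattices as principal ideals. -/

/-- The square lattice `w ℤ[i]`. -/
def simLattice (w : GaussianInt) : AddSubgroup ℂ :=
  AddSubgroup.closure {(w : ℂ), ((w * ⟨0, 1⟩ : GaussianInt) : ℂ)}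

theorem toComplex_mul_I (w : GaussianInt) :
    ((w * ⟨0, 1⟩ : GaussianInt) : ℂ) = w * Complex.I := by
  rw [GaussianInt.toComplex_mul]
  congr 1
  simp [GaussianInt.toComplex_def]

theorem mem_simLattice {w : GaussianInt} {x : ℂ} :
    x ∈ simLattice w ↔ ∃ y : GaussianInt, (w : ℂ) * y = x := by
  rw [simLattice, mem_closure_pair_complex]
  constructor
  · rintro ⟨m, n, rfl⟩
    refine ⟨⟨m, n⟩, ?_⟩
    rw [toComplex_mul_I, GaussianInt.toComplex_def' m n]
    ring
  · rintro ⟨y, rfl⟩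
    refine ⟨y.re, y.im, ?_⟩
    rw [toComplex_mul_I, GaussianInt.toComplex_def y]
    ring

theorem simLattice_reduced {w : GaussianInt} (h : w ≠ 0) :
    IsReducedPair (w : ℂ) ((w * ⟨0, 1⟩ : GaussianInt) : ℂ) := by
  have hp : 0 < Complex.normSq (w : ℂ) :=
    Complex.normSq_pos.2 fun h0 => h (GaussianInt.toComplex_eq_zero.1 h0)
  have e1 : Complex.normSq ((w : ℂ) + w * Complex.I) = 2 * Complex.normSq (w : ℂ) := by
    simp [Complex.normSq_apply]; ring
  have e2 : Complex.normSq ((w : ℂ) - w * Complex.I) = 2 * Complex.normSq (w : ℂ) := by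
    simp [Complex.normSq_apply]; ring
  rw [toComplex_mul_I]
  refine ⟨hp, by simp, by rw [e1]; linarith, by rw [e2]; linarith⟩

theorem simLattice_relIndex {w : GaussianInt} (h : w ≠ 0) :
    (simLattice w).relIndex squareLattice = w.norm.natAbs := by
  have hd : w.re * (w * ⟨0, 1⟩ : GaussianInt).im - w.im * (w * ⟨0, 1⟩ : GaussianInt).re = w.norm := by
    rw [Zsqrtd.norm_def]; simp
  rw [simLattice, relIndex_closure_pair _ _ (by rw [hd]; exact (GaussianInt.norm_pos.2 h).ne'), hd]

/-- A generator of the ideal is a minimal vector of it, hence determined up to a unit. -/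
theorem simLattice_injOn : Set.InjOn simLattice {z | InQuadrant z} := by
  intro w hw w' hw' e
  have h1 := simLattice_reduced hw.ne_zero
  have h2 := simLattice_reduced hw'.ne_zero
  have hn := normSq_eq_of_closure_eq h1 h2 e.symm
  have h := h1.eq_of_minimal (e ▸ h2.isMinimal_left.1 : (w' : ℂ) ∈ simLattice w)
    h2.isMinimal_left.2.1 hn.le
  rw [toComplex_mul_I] at h
  have key : ∀ ε : ℂ, (ε = 1 ∨ ε = -1 ∨ ε = Complex.I ∨ ε = -Complex.I) → (w' : ℂ) = ε * w →
      w = w' := by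
    intro ε hε h
    have := InQuadrant.eq_of_mul_eq hw hw' (a := 1) (a' := 1) one_pos one_pos hε (by simpa using h)
    exact Zsqrtd.ext (by simpa using this.2.1.symm) (by simpa using this.2.2.symm)
  rcases h with h | h | h | h
  · exact key 1 (by simp) (by rw [h]; ring)
  · exact key (-1) (by simp) (by rw [h]; ring)
  · exact key Complex.I (by simp) (by rw [h]; ring)
  · exact key (-Complex.I) (by simp) (by rw [h]; ring)

theorem simLattice_isSimilarTo {w : GaussianInt} (h : w ≠ 0) :
    IsSimilarTo (simLattice w) squareLattice := by
  have h0 : (w : ℂ) ≠ 0 := fun h0 => h (GaussianInt.toComplex_eq_zero.1 h0)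
  have hu : (‖(w : ℂ)‖ : ℂ) * (Circle.exp (Complex.arg w) : ℂ) = w := by
    rw [Circle.coe_exp, Complex.norm_mul_exp_arg_mul_I]
  refine ⟨‖(w : ℂ)‖, rotation (Circle.exp (Complex.arg w)), norm_pos_iff.2 h0, ?_⟩
  ext x
  simp only [SetLike.mem_coe, mem_simLattice, Set.mem_image, mem_squareLattice, rotation_apply,
    Complex.real_smul, ← mul_assoc, hu]
  constructor
  · rintro ⟨y, rfl⟩
    exact ⟨y, ⟨y, rfl⟩, rfl⟩
  · rintro ⟨_, ⟨y, rfl⟩, rfl⟩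
    exact ⟨y, rfl⟩

/-- A linear isometry of ℂ is a rotation, possibly preceded by conjugation, and conjugation
preserves ℤ[i]. So the sublattice is the ideal generated by the image of 1, and a unit moves the
generator into the quadrant. -/
theorem exists_simLattice_eq {Λ : AddSubgroup ℂ} (hle : Λ ≤ squareLattice)
    (hs : IsSimilarTo Λ squareLattice) : ∃ w : GaussianInt, InQuadrant w ∧ simLattice w = Λ := by
  obtain ⟨c, R, hc, hΛ⟩ := hs
  have hex : ∃ w : GaussianInt, w ≠ 0 ∧ simLattice w = Λ := by
    obtain ⟨u, hu | hu⟩ := linear_isometry_complex R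
    · have h1 : (c : ℂ) * u ∈ Λ := by
        rw [← SetLike.mem_coe, hΛ]
        refine ⟨1, mem_squareLattice.2 ⟨1, by simp⟩, ?_⟩
        simp [hu, rotation_apply]
      obtain ⟨w, hw⟩ := mem_squareLattice.1 (hle h1)
      refine ⟨w, ?_, ?_⟩
      · rintro rfl
        simp [hc.ne'] at hw
      · apply SetLike.coe_injective
        rw [hΛ]
        ext x
        simp only [SetLike.mem_coe, mem_simLattice, Set.mem_image, mem_squareLattice, hw]
        constructor
        · rintro ⟨y, rfl⟩
          refine ⟨y, ⟨y, rfl⟩, ?_⟩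
          simp [hu, rotation_apply]; ring
        · rintro ⟨_, ⟨y, rfl⟩, rfl⟩
          refine ⟨y, ?_⟩
          simp [hu, rotation_apply]; ring
    · have h1 : (c : ℂ) * u ∈ Λ := by
        rw [← SetLike.mem_coe, hΛ]
        refine ⟨1, mem_squareLattice.2 ⟨1, by simp⟩, ?_⟩
        simp [hu, rotation_apply]
      obtain ⟨w, hw⟩ := mem_squareLattice.1 (hle h1)
      refine ⟨w, ?_, ?_⟩
      · rintro rfl
        simp [hc.ne'] at hw
      · apply SetLike.coe_injective
        rw [hΛ]
        ext x
        simp only [SetLike.mem_coe, mem_simLattice, Set.mem_image, mem_squareLattice, hw]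
        constructor
        · rintro ⟨y, rfl⟩
          refine ⟨(star y : GaussianInt), ⟨star y, rfl⟩, ?_⟩
          simp [hu, rotation_apply]; ring
        · rintro ⟨_, ⟨y, rfl⟩, rfl⟩
          refine ⟨star y, ?_⟩
          simp [hu, rotation_apply]; ring
  obtain ⟨w, hw0, hw⟩ := hex
  obtain ⟨z, hz, -, h⟩ := exists_inQuadrant_rotation hw0
  refine ⟨z, hz, ?_⟩
  rw [← hw]
  have hI : ((⟨0, 1⟩ : GaussianInt) : ℂ) = Complex.I := by simp [GaussianInt.toComplex_def]
  have key : ∀ e f : GaussianInt, e * f = 1 → (w : ℂ) = e * z → simLattice z = simLattice w := by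
    intro e f hef h
    have hef' : (e : ℂ) * f = 1 := by rw [← GaussianInt.toComplex_mul, hef, GaussianInt.toComplex_one]
    ext x
    simp only [mem_simLattice, h]
    constructor
    · rintro ⟨y, rfl⟩
      refine ⟨f * y, ?_⟩
      rw [GaussianInt.toComplex_mul]
      linear_combination ((z : ℂ) * y) * hef'
    · rintro ⟨y, rfl⟩
      refine ⟨e * y, ?_⟩
      rw [GaussianInt.toComplex_mul]
      ring
  rcases h with h | h | h | h
  · exact key 1 1 (by simp) (by rw [h]; simp)
  · exact key (-1) (-1) (by simp) (by rw [h]; simp)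
  · exact key ⟨0, 1⟩ ⟨0, -1⟩ (by ext <;> simp) (by rw [h, hI])
  · exact key (-⟨0, 1⟩) ⟨0, 1⟩ (by ext <;> simp) (by rw [h, GaussianInt.toComplex_neg, hI]; ring)

theorem similarCount_eq_ncard (n : ℕ) :
    similarCount squareLattice n = (simSet n).ncard := by
  rw [← (simLattice_injOn.mono (fun z hz => hz.1 : simSet n ⊆ _)).ncard_image, similarCount]
  congr 1
  ext Λ
  constructor
  · rintro ⟨h1, h2, h3⟩
    obtain ⟨w, hw, rfl⟩ := exists_simLattice_eq h1 h3
    refine ⟨w, ⟨hw, ?_⟩, rfl⟩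
    rw [simLattice_relIndex hw.ne_zero] at h2
    rw [← h2, GaussianInt.abs_natCast_norm]
  · rintro ⟨w, hw, rfl⟩
    refine ⟨closure_pair_le_squareLattice _ _, ?_, simLattice_isSimilarTo hw.1.ne_zero⟩
    rw [simLattice_relIndex hw.1.ne_zero, hw.2]
    simp

theorem simLattice_isPrimitiveIn {w : GaussianInt} (h : w ≠ 0) :
    IsPrimitiveIn (simLattice w) squareLattice ↔ IsCoprime w.re w.im := by
  constructor
  · intro hp
    rw [Int.isCoprime_iff_gcd_eq_one]
    by_contra hne
    have h0 : Int.gcd w.re w.im ≠ 0 := by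
      rw [Ne, Int.gcd_eq_zero_iff]
      exact fun h' => h (Zsqrtd.ext h'.1 h'.2)
    refine hp (Int.gcd w.re w.im) (by omega) ?_
    obtain ⟨x, hx⟩ := Int.gcd_dvd_left w.re w.im
    obtain ⟨y, hy⟩ := Int.gcd_dvd_right w.re w.im
    intro v hv
    obtain ⟨c, rfl⟩ := mem_simLattice.1 hv
    refine ⟨((⟨x, y⟩ * c : GaussianInt) : ℂ), mem_squareLattice.2 ⟨_, rfl⟩, ?_⟩
    have hw : w = ((Int.gcd w.re w.im : ℕ) : GaussianInt) * ⟨x, y⟩ := by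
      ext
      · simpa using hx
      · simpa using hy
    have hw' := congrArg GaussianInt.toComplex hw
    rw [GaussianInt.toComplex_mul, map_natCast] at hw'
    simp only [nsmul_eq_mul]
    rw [GaussianInt.toComplex_mul, ← mul_assoc, ← hw']
  · intro hc m hm hsub
    obtain ⟨_, hx, hxw⟩ := hsub (mem_simLattice.2 ⟨1, by simp⟩ : (w : ℂ) ∈ simLattice w)
    obtain ⟨y, rfl⟩ := mem_squareLattice.1 hx
    have hw : w = m * y := by
      apply GaussianInt.toComplex_inj.1
      rw [← hxw, GaussianInt.toComplex_mul]
      simp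
    have h1 : (m : ℤ) ∣ w.re := ⟨y.re, by rw [hw]; simp⟩
    have h2 : (m : ℤ) ∣ w.im := ⟨y.im, by rw [hw]; simp⟩
    have h3 := Int.isUnit_iff.1 (hc.isUnit_of_dvd' h1 h2)
    omega

theorem primitiveSimilarCount_eq_ncard (n : ℕ) :
    primitiveSimilarCount squareLattice n = (primSet n).ncard := by
  rw [← (simLattice_injOn.mono (fun z hz => hz.1 : primSet n ⊆ _)).ncard_image,
    primitiveSimilarCount]
  congr 1
  ext Λ
  constructor
  · rintro ⟨h1, h2, h3, h4⟩
    obtain ⟨w, hw, rfl⟩ := exists_simLattice_eq h1 h3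
    refine ⟨w, ⟨hw, (simLattice_isPrimitiveIn hw.ne_zero).1 h4, ?_⟩, rfl⟩
    rw [simLattice_relIndex hw.ne_zero] at h2
    rw [← h2, GaussianInt.abs_natCast_norm]
  · rintro ⟨w, hw, rfl⟩
    refine ⟨closure_pair_le_squareLattice _ _, ?_, simLattice_isSimilarTo hw.1.ne_zero,
      (simLattice_isPrimitiveIn hw.1.ne_zero).2 hw.2.1⟩
    rw [simLattice_relIndex hw.1.ne_zero, hw.2.2]
    simp

/-! ### Counting Gaussian integers of given norm. -/

theorem finite_setOf_norm_le (C : ℤ) : {z : GaussianInt | z.norm ≤ C}.Finite := by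
  refine Set.Finite.of_finite_image (f := fun z : GaussianInt => (z.re, z.im)) ?_ ?_
  · refine ((Set.finite_Icc (-C) C).prod (Set.finite_Icc (-C) C)).subset ?_
    rintro _ ⟨z, hz, rfl⟩
    rw [Set.mem_ofPred_eq, Zsqrtd.norm_def] at hz
    have h1 : ∀ x : ℤ, |x| ≤ x * x := by
      intro x
      rw [← abs_mul_abs_self]
      have h0 := abs_nonneg x
      rcases h0.eq_or_lt with h | h
      · rw [← h]; simp
      · nlinarith
    have h2 := h1 z.re
    have h3 := h1 z.im
    have h4 := mul_self_nonneg z.re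
    have h5 := mul_self_nonneg z.im
    simp only [Set.mem_prod, Set.mem_Icc, ← abs_le]
    constructor <;> linarith
  · intro x _ y _ h
    simp only [Prod.mk.injEq] at h
    exact Zsqrtd.ext h.1 h.2

theorem simSet_finite (n : ℕ) : (simSet n).Finite :=
  (finite_setOf_norm_le n).subset fun _ hz => hz.2.le

theorem primSet_finite (n : ℕ) : (primSet n).Finite :=
  (finite_setOf_norm_le n).subset fun _ hz => hz.2.2.le

/-- All Gaussian integers of norm `n`. -/
def normSet (n : ℕ) : Set GaussianInt := {z | z.norm = n}

theorem normSet_finite (n : ℕ) : (normSet n).Finite :=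
  (finite_setOf_norm_le n).subset fun _ hz => le_of_eq hz

theorem norm_eq_sq_add_sq (z : GaussianInt) : z.norm = z.re ^ 2 + z.im ^ 2 := by
  rw [Zsqrtd.norm_def]; ring

/-- The non-zero Gaussian integers are partitioned by the four rotated copies of the quadrant. -/
theorem ncard_normSet {n : ℕ} (hn : n ≠ 0) : (normSet n).ncard = 4 * (simSet n).ncard := by
  have hrot : ∀ A : Set GaussianInt, ((fun z : GaussianInt => (⟨-z.im, z.re⟩ : GaussianInt)) '' A).ncard
      = A.ncard := by
    intro A
    apply Set.ncard_image_of_injective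
    intro x y h
    simp only [Zsqrtd.mk.injEq, neg_inj] at h
    exact Zsqrtd.ext h.2 h.1
  set ρ := fun z : GaussianInt => (⟨-z.im, z.re⟩ : GaussianInt) with hρ
  have hfin : ∀ A ⊆ normSet n, A.Finite := fun A hA => (normSet_finite n).subset hA
  have hsub : ∀ A ⊆ normSet n, ρ '' A ⊆ normSet n := by
    rintro A hA _ ⟨z, hz, rfl⟩
    have := hA hz
    rw [normSet, Set.mem_ofPred_eq, norm_eq_sq_add_sq] at this ⊢
    simp only [hρ]
    rw [← this]; ring
  have h0 : simSet n ⊆ normSet n := fun z hz => hz.2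
  set A0 := simSet n with hA0
  have h1 := hsub _ h0
  have h2 := hsub _ h1
  have h3 := hsub _ h2
  have hmem : ∀ (A : Set GaussianInt) (z : GaussianInt), z ∈ ρ '' A ↔ (⟨z.im, -z.re⟩ : GaussianInt) ∈ A := by
    intro A z
    constructor
    · rintro ⟨y, hy, rfl⟩
      simpa [hρ] using hy
    · intro h
      exact ⟨_, h, by simp [hρ]⟩
  have hunion : normSet n = (A0 ∪ ρ '' A0) ∪ (ρ '' (ρ '' A0) ∪ ρ '' (ρ '' (ρ '' A0))) := by
    apply Set.Subset.antisymm
    · intro z hz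
      have hz' := hz
      rw [normSet, Set.mem_ofPred_eq, norm_eq_sq_add_sq] at hz'
      have hne : ¬ (z.re = 0 ∧ z.im = 0) := by
        rintro ⟨ha, hb⟩
        rw [ha, hb] at hz'
        simp at hz'
        exact hn (by exact_mod_cast hz'.symm)
      simp only [Set.mem_union, hmem, hA0, simSet, Set.mem_ofPred_eq, InQuadrant, norm_eq_sq_add_sq,
        even_two.neg_pow]
      have e : z.im ^ 2 + z.re ^ 2 = n := by rw [← hz']; ring
      simp only [hz', e, and_true]
      omega
    · exact Set.union_subset (Set.union_subset h0 h1) (Set.union_subset h2 h3)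
  have hd : Disjoint A0 (ρ '' A0) := by
    rw [Set.disjoint_left]
    intro z
    simp only [hmem, hA0, simSet, Set.mem_ofPred_eq, InQuadrant]
    omega
  have hd' : Disjoint (ρ '' (ρ '' A0)) (ρ '' (ρ '' (ρ '' A0))) := by
    rw [Set.disjoint_left]
    intro z
    simp only [hmem, hA0, simSet, Set.mem_ofPred_eq, InQuadrant]
    omega
  have hd'' : Disjoint (A0 ∪ ρ '' A0) (ρ '' (ρ '' A0) ∪ ρ '' (ρ '' (ρ '' A0))) := by
    rw [Set.disjoint_left]
    intro z
    simp only [Set.mem_union, hmem, hA0, simSet, Set.mem_ofPred_eq, InQuadrant]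
    omega
  rw [hunion, Set.ncard_union_eq hd'' ((hfin _ h0).union (hfin _ h1))
    ((hfin _ h2).union (hfin _ h3)), Set.ncard_union_eq hd (hfin _ h0) (hfin _ h1),
    Set.ncard_union_eq hd' (hfin _ h2) (hfin _ h3)]
  simp only [hrot]
  ring

theorem even_add_of_even_norm {z : GaussianInt} {n : ℤ} (h : z.norm = 2 * n) :
    2 ∣ z.re + z.im := by
  rw [norm_eq_sq_add_sq] at h
  have h1 : Even (z.re ^ 2 + z.im ^ 2) := h ▸ even_two_mul n
  rw [Int.even_add, Int.even_pow' two_ne_zero, Int.even_pow' two_ne_zero, ← Int.even_add] at h1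
  exact h1.two_dvd

/-- Multiplication by 1 + i is a bijection from norm n to norm 2n. It need not preserve the
quadrant, hence the detour through `normSet`. -/
theorem ncard_simSet_two_mul {n : ℕ} (hn : n ≠ 0) :
    (simSet (2 * n)).ncard = (simSet n).ncard := by
  have h1 := ncard_normSet hn
  have h2 := ncard_normSet (n := 2 * n) (by omega)
  have h3 : (normSet (2 * n)).ncard = (normSet n).ncard := by
    rw [← Set.ncard_image_of_injective (normSet n)
      (f := fun z : GaussianInt => (⟨z.re - z.im, z.re + z.im⟩ : GaussianInt))]
    · congr 1
      ext z
      constructor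
      · intro hz
        rw [normSet, Set.mem_ofPred_eq] at hz
        push_cast at hz
        obtain ⟨c, hc⟩ := even_add_of_even_norm hz
        refine ⟨⟨c, z.im - c⟩, ?_, ?_⟩
        · rw [norm_eq_sq_add_sq] at hz
          rw [normSet, Set.mem_ofPred_eq, norm_eq_sq_add_sq]
          have : z.re = 2 * c - z.im := by linarith
          rw [this] at hz
          simp only
          linarith
        · ext <;> simp only <;> linarith
      · rintro ⟨y, hy, rfl⟩
        rw [normSet, Set.mem_ofPred_eq, norm_eq_sq_add_sq] at hy ⊢
        push_cast
        rw [← hy]; ring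
    · intro x y h
      simp only [Zsqrtd.mk.injEq] at h
      exact Zsqrtd.ext (by omega) (by omega)
  omega

/-! ### Splitting the count by shape and parity. -/

/-- The number of factorizations `n = p q` with `p < q < √3 p` and both factors in `P`. -/
def ratioCount (P : ℕ → Prop) [DecidablePred P] (n : ℕ) : ℕ :=
  (n.divisorsAntidiagonal.filter
    fun x => x.1 < x.2 ∧ x.2 ^ 2 < 3 * x.1 ^ 2 ∧ P x.1 ∧ P x.2).card

theorem wrSet_finite (n : ℕ) : (wrSet n).Finite := by
  refine ((finite_setOf_norm_le (2 * n)).prod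
    ((Set.finite_Iic (2 * n)).prod (Set.finite_Iic (2 * n)))).subset ?_
  rintro ⟨z, a, b⟩ ⟨hQ, -, ha, hb, -, -, -, h⟩
  simp only at *
  have hz : (1 : ℤ) ≤ z.norm := GaussianInt.norm_pos.2 hQ.ne_zero
  have ha' : (1 : ℤ) ≤ a := by exact_mod_cast ha
  have hb' : (1 : ℤ) ≤ b := by exact_mod_cast hb
  have hzab : (1 : ℤ) ≤ z.norm * a := by nlinarith
  simp only [Set.mem_prod, Set.mem_ofPred_eq, Set.mem_Iic]
  refine ⟨by nlinarith, ?_, ?_⟩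
  · have : (a : ℤ) ≤ 2 * n := by nlinarith
    exact_mod_cast this
  · have : (b : ℤ) ≤ 2 * n := by nlinarith
    exact_mod_cast this

/-- For a = b the triple is the same as the Gaussian integer za of norm 2n with its content split
off; evenness of that norm is the parity condition. -/
theorem ncard_wrSet_diag {n : ℕ} (hn : n ≠ 0) :
    {t ∈ wrSet n | t.2.1 = t.2.2}.ncard = (simSet n).ncard := by
  rw [← ncard_simSet_two_mul hn]
  have hinj : Set.InjOn (fun t : GaussianInt × ℕ × ℕ => (⟨t.1.re * t.2.1, t.1.im * t.2.1⟩ : GaussianInt))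
      {t ∈ wrSet n | t.2.1 = t.2.2} := by
    rintro ⟨z, a, b⟩ ⟨⟨hQ, hc, ha, -⟩, hab⟩ ⟨z', a', b'⟩ ⟨⟨hQ', hc', ha', -⟩, hab'⟩ h
    simp only [Zsqrtd.mk.injEq] at *
    obtain ⟨rfl, rfl⟩ := eq_of_coprime_of_mul_eq hc' hc ha' h.1 h.2
    rw [← hab, ← hab']
  rw [← hinj.ncard_image]
  congr 1
  ext y
  constructor
  · rintro ⟨⟨z, a, b⟩, ⟨⟨hQ, hc, ha, -, -, -, -, hN⟩, hab⟩, rfl⟩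
    simp only at *
    have ha' : (0 : ℤ) < a := by exact_mod_cast ha
    refine ⟨⟨mul_pos hQ.1 ha', mul_nonneg hQ.2 ha'.le⟩, ?_⟩
    rw [norm_eq_sq_add_sq] at hN ⊢
    simp only
    push_cast
    rw [← hN, ← hab]; ring
  · rintro ⟨hQ, hN⟩
    have h0 : 0 < Int.gcd y.re y.im := by
      rw [Nat.pos_iff_ne_zero, Ne, Int.gcd_eq_zero_iff]
      exact fun h => hQ.1.ne' h.1
    obtain ⟨u, v, huv, hu, hv⟩ := Int.exists_gcd_one h0
    set g := Int.gcd y.re y.im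
    have hg : (0 : ℤ) < g := by exact_mod_cast h0
    push_cast at hN
    have h2 := even_add_of_even_norm hN
    rw [norm_eq_sq_add_sq] at hN
    refine ⟨(⟨u, v⟩, g, g), ⟨⟨⟨?_, ?_⟩, Int.isCoprime_iff_gcd_eq_one.2 huv, h0, h0, ?_, ?_, ⟨?_, ?_⟩, ?_⟩,
      rfl⟩, ?_⟩
    · have := hQ.1
      rw [hu] at this
      exact pos_of_mul_pos_left this hg.le
    · have := hQ.2
      rw [hv] at this
      exact nonneg_of_mul_nonneg_left this hg
    · simp only; nlinarith
    · simp only; nlinarith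
    · simp only; omega
    · simp only; omega
    · rw [norm_eq_sq_add_sq]
      simp only
      rw [hu, hv] at hN
      rw [← hN]; ring
    · exact Zsqrtd.ext hu.symm hv.symm

/-- The exchange of a and b is the quarter turn of the sublattice. -/
theorem ncard_wrSet_swap (n : ℕ) :
    {t ∈ wrSet n | t.2.2 < t.2.1}.ncard = {t ∈ wrSet n | t.2.1 < t.2.2}.ncard := by
  have hinj : Function.Injective (fun t : GaussianInt × ℕ × ℕ => (t.1, t.2.2, t.2.1)) := by
    rintro ⟨z, a, b⟩ ⟨z', a', b'⟩ h
    simp only [Prod.mk.injEq] at h ⊢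
    tauto
  rw [← Set.ncard_image_of_injective _ hinj]
  have hs : ∀ (z : GaussianInt) (a b : ℕ), (z, a, b) ∈ wrSet n → (z, b, a) ∈ wrSet n := by
    rintro z a b ⟨hQ, hc, ha, hb, hab, hba, ⟨h1, h2⟩, hN⟩
    refine ⟨hQ, hc, hb, ha, hba, hab, ⟨?_, ?_⟩, ?_⟩
    · simp only at *; omega
    · simp only at *; omega
    · simp only at *; rw [← hN]; ring
  congr 1
  ext ⟨z, a, b⟩
  constructor
  · rintro ⟨⟨z', a', b'⟩, ⟨h, hlt⟩, e⟩
    simp only [Prod.mk.injEq] at e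
    obtain ⟨rfl, rfl, rfl⟩ := e
    exact ⟨hs _ _ _ h, hlt⟩
  · rintro ⟨h, hlt⟩
    exact ⟨(z, b, a), ⟨hs _ _ _ h, hlt⟩, rfl⟩

/-- If a is even, then 2 divides xb and yb, hence b by Bézout; the converse is symmetric. -/
theorem even_iff_even_of_two_dvd {x y : ℤ} {a b : ℕ} (hc : IsCoprime x y)
    (h1 : 2 ∣ x * a - y * b) (h2 : 2 ∣ x * b + y * a) : Even a ↔ Even b := by
  obtain ⟨s, t, hst⟩ := hc
  obtain ⟨c, hc⟩ := h1
  obtain ⟨d, hd⟩ := h2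
  rw [← Int.even_coe_nat, ← Int.even_coe_nat]
  constructor
  · rintro ⟨e, he⟩
    refine even_iff_two_dvd.2 ⟨s * (d - y * e) + t * (x * e - c), ?_⟩
    linear_combination (-b : ℤ) * hst + s * hd - t * hc + (-s * y + t * x) * he
  · rintro ⟨e, he⟩
    refine even_iff_two_dvd.2 ⟨s * (c + y * e) + t * (d - x * e), ?_⟩
    linear_combination (-a : ℤ) * hst + s * hc + t * hd + (s * y - t * x) * he

/-- With a = 2p and b = 2q the parity condition is void and the index equation reads n = 2N(z)pq. -/
theorem ncard_wrSet_even {n : ℕ} (hn : n ≠ 0) :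
    {t ∈ wrSet n | t.2.1 < t.2.2 ∧ Even t.2.1}.ncard =
      if 2 ∣ n then ∑ x ∈ (n / 2).divisorsAntidiagonal,
        ratioCount (fun _ => True) x.1 * (primSet x.2).ncard else 0 := by
  have hev : ∀ t ∈ {t ∈ wrSet n | t.2.1 < t.2.2 ∧ Even t.2.1}, ∃ p q : ℕ, t.2.1 = 2 * p ∧
      t.2.2 = 2 * q ∧ (2 * (t.1.norm.natAbs * (p * q))) = n := by
    rintro ⟨z, a, b⟩ ⟨⟨hQ, hc, ha, hb, hab, hba, ⟨h1, h2⟩, hN⟩, hlt, hae⟩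
    have hbe := (even_iff_even_of_two_dvd hc h1 h2).1 hae
    obtain ⟨p, rfl⟩ := hae.two_dvd
    obtain ⟨q, rfl⟩ := hbe.two_dvd
    refine ⟨p, q, rfl, rfl, ?_⟩
    simp only at hN ⊢
    rw [← GaussianInt.abs_natCast_norm] at hN
    push_cast at hN
    have h4 : (2 : ℤ) * (2 * (|z.norm| * (p * q))) = 2 * n := by rw [← hN]; ring
    zify
    linarith
  split_ifs with h2n
  · obtain ⟨k, rfl⟩ := h2n
    have hk : k ≠ 0 := by omega
    rw [Nat.mul_div_cancel_left k two_pos]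
    have hfin : {t ∈ wrSet (2 * k) | t.2.1 < t.2.2 ∧ Even t.2.1}.Finite :=
      (wrSet_finite _).subset fun t ht => ht.1
    rw [Set.ncard_eq_toFinset_card _ hfin]
    have hR : ∀ x : ℕ × ℕ, ratioCount (fun _ => True) x.1 * (primSet x.2).ncard =
        ((x.1.divisorsAntidiagonal.filter fun y => y.1 < y.2 ∧ y.2 ^ 2 < 3 * y.1 ^ 2 ∧ True ∧ True)
          ×ˢ (primSet_finite x.2).toFinset).card := by
      intro x
      rw [Finset.card_product, Set.ncard_eq_toFinset_card _ (primSet_finite _)]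
      rfl
    rw [Finset.sum_congr rfl fun x _ => hR x, ← Finset.card_sigma]
    symm
    refine Finset.card_nbij' (fun s => (s.2.2, 2 * s.2.1.1, 2 * s.2.1.2))
      (fun t => ⟨((t.2.1 / 2) * (t.2.2 / 2), t.1.norm.natAbs), ((t.2.1 / 2, t.2.2 / 2), t.1)⟩)
      ?_ ?_ ?_ ?_
    · rintro ⟨⟨d, m⟩, ⟨p, q⟩, z⟩ h
      simp only [Finset.coe_sigma, Set.mem_sigma_iff, Finset.mem_coe, Finset.mem_product,
        Finset.mem_filter, Nat.mem_divisorsAntidiagonal, Set.Finite.mem_toFinset] at h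
      obtain ⟨⟨hdm, -⟩, ⟨⟨hpq, hd⟩, hlt, hlt3, -⟩, hQ, hc, hN⟩ := h
      have hp : 0 < p := by
        rcases Nat.eq_zero_or_pos p with rfl | h
        · simp at hpq; exact absurd hpq.symm hd
        · exact h
      rw [Finset.mem_coe, Set.Finite.mem_toFinset]
      refine ⟨⟨hQ, hc, ?_, ?_, ?_, ?_, ⟨?_, ?_⟩, ?_⟩, ?_, even_two_mul p⟩
      · simp only; omega
      · simp only; omega
      · simp only; nlinarith
      · simp only; nlinarith
      · simp only; push_cast
        exact ⟨z.re * p - z.im * q, by ring⟩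
      · simp only; push_cast
        exact ⟨z.re * q + z.im * p, by ring⟩
      · simp only
        rw [hN, ← hdm, ← hpq]
        push_cast; ring
      · simp only; omega
    · rintro t ht
      rw [Finset.mem_coe, Set.Finite.mem_toFinset] at ht
      obtain ⟨p, q, hp, hq, hnn⟩ := hev t ht
      obtain ⟨⟨hQ, hc, ha, hb, hab, hba, -, -⟩, hlt, -⟩ := ht
      have hne := sq_ne_three_mul_sq hb (b := t.2.1)
      have hba' := lt_of_le_of_ne hba hne
      have hk' : t.1.norm.natAbs * (p * q) = k := by
        apply Nat.eq_of_mul_eq_mul_left two_pos hnn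
      rw [hp, hq] at hba' hlt
      rw [hp] at ha
      simp only [Finset.coe_sigma, Set.mem_sigma_iff, Finset.mem_coe, Finset.mem_product,
        Finset.mem_filter, Nat.mem_divisorsAntidiagonal, Set.Finite.mem_toFinset, hp, hq,
        Nat.mul_div_cancel_left _ two_pos, and_true, true_and]
      refine ⟨⟨by rw [← hk']; ring, hk⟩, ⟨?_, ?_, ?_⟩, hQ, hc, ?_⟩
      · have : 0 < p := by omega
        have : 0 < q := by omega
        positivity
      · omega
      · nlinarith
      · exact (GaussianInt.abs_natCast_norm _).symm
    · rintro ⟨⟨d, m⟩, ⟨p, q⟩, z⟩ h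
      simp only [Finset.coe_sigma, Set.mem_sigma_iff, Finset.mem_coe, Finset.mem_product,
        Finset.mem_filter, Nat.mem_divisorsAntidiagonal, Set.Finite.mem_toFinset] at h
      obtain ⟨⟨hdm, -⟩, ⟨⟨hpq, hd⟩, hlt, hlt3, -⟩, hQ, hc, hN⟩ := h
      simp only [Nat.mul_div_cancel_left _ two_pos, hpq, hN, Int.natAbs_natCast]
    · rintro t ht
      rw [Finset.mem_coe, Set.Finite.mem_toFinset] at ht
      obtain ⟨p, q, hp, hq, -⟩ := hev t ht
      obtain ⟨z, a, b⟩ := t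
      simp only at hp hq
      simp only [hp, hq, Nat.mul_div_cancel_left _ two_pos]
  · rw [Set.ncard_eq_zero ((wrSet_finite _).subset fun t ht => ht.1), Set.eq_empty_iff_forall_notMem]
    intro t ht
    obtain ⟨p, q, -, -, h⟩ := hev t ht
    exact h2n ⟨_, h.symm⟩

/-- For odd a, b the equation N(z)ab = 2n forces N(z) = 2m with n = abm. Conversely an even norm
means that the coordinates of z have equal parity, which is the parity condition for odd a, b. -/
theorem ncard_wrSet_odd {n : ℕ} (hn : n ≠ 0) :
    {t ∈ wrSet n | t.2.1 < t.2.2 ∧ ¬ Even t.2.1}.ncard =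
      ∑ x ∈ n.divisorsAntidiagonal, ratioCount Odd x.1 * (primSet (2 * x.2)).ncard := by
  have hev : ∀ t ∈ {t ∈ wrSet n | t.2.1 < t.2.2 ∧ ¬ Even t.2.1}, Odd t.2.1 ∧ Odd t.2.2 ∧
      ∃ m : ℕ, t.1.norm = 2 * m ∧ t.2.1 * t.2.2 * m = n := by
    rintro ⟨z, a, b⟩ ⟨⟨hQ, hc, ha, hb, hab, hba, ⟨h1, h2⟩, hN⟩, hlt, hae⟩
    have hbe := (even_iff_even_of_two_dvd hc h1 h2).not.1 hae
    rw [Nat.not_even_iff_odd] at hae hbe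
    simp only at *
    have hdvd : (2 : ℤ) ∣ z.norm := by
      have h3 : Odd ((a : ℤ) * b) := by exact_mod_cast hae.mul hbe
      have h4 : Even (z.norm * (a * b)) := even_iff_two_dvd.2 ⟨n, by rw [← hN]; ring⟩
      rw [Int.even_mul] at h4
      rcases h4 with h4 | h4
      · exact h4.two_dvd
      · exact absurd h4 (Int.not_even_iff_odd.2 h3)
    obtain ⟨m, hm⟩ := hdvd
    have hm0 : 0 ≤ m := by
      have := GaussianInt.norm_nonneg z
      omega
    lift m to ℕ using hm0
    refine ⟨hae, hbe, m, hm, ?_⟩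
    rw [hm] at hN
    have : (2 : ℤ) * (a * b * m) = 2 * n := by rw [← hN]; ring
    zify
    linarith
  have hfin : {t ∈ wrSet n | t.2.1 < t.2.2 ∧ ¬ Even t.2.1}.Finite :=
    (wrSet_finite _).subset fun t ht => ht.1
  rw [Set.ncard_eq_toFinset_card _ hfin]
  have hR : ∀ x : ℕ × ℕ, ratioCount Odd x.1 * (primSet (2 * x.2)).ncard =
      ((x.1.divisorsAntidiagonal.filter fun y => y.1 < y.2 ∧ y.2 ^ 2 < 3 * y.1 ^ 2 ∧ Odd y.1 ∧ Odd y.2)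
        ×ˢ (primSet_finite (2 * x.2)).toFinset).card := by
    intro x
    rw [Finset.card_product, Set.ncard_eq_toFinset_card _ (primSet_finite _)]
    rfl
  rw [Finset.sum_congr rfl fun x _ => hR x, ← Finset.card_sigma]
  symm
  refine Finset.card_nbij' (fun s => (s.2.2, s.2.1.1, s.2.1.2))
    (fun t => ⟨(t.2.1 * t.2.2, t.1.norm.natAbs / 2), ((t.2.1, t.2.2), t.1)⟩) ?_ ?_ ?_ ?_
  · rintro ⟨⟨d, m⟩, ⟨p, q⟩, z⟩ h
    simp only [Finset.coe_sigma, Set.mem_sigma_iff, Finset.mem_coe, Finset.mem_product,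
      Finset.mem_filter, Nat.mem_divisorsAntidiagonal, Set.Finite.mem_toFinset] at h
    obtain ⟨⟨hdm, -⟩, ⟨⟨hpq, hd⟩, hlt, hlt3, hpo, hqo⟩, hQ, hc, hN⟩ := h
    have hp : 0 < p := hpo.pos
    push_cast at hN
    have h2 := even_add_of_even_norm hN
    obtain ⟨e, he⟩ := hpo
    obtain ⟨f, hf⟩ := hqo
    have hp' : (p : ℤ) = 2 * e + 1 := by exact_mod_cast he
    have hq' : (q : ℤ) = 2 * f + 1 := by exact_mod_cast hf
    rw [Finset.mem_coe, Set.Finite.mem_toFinset]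
    refine ⟨⟨hQ, hc, ?_, ?_, ?_, ?_, ⟨?_, ?_⟩, ?_⟩, ?_, ?_⟩
    · simp only; omega
    · simp only; omega
    · simp only; nlinarith
    · simp only; nlinarith
    · simp only
      have : z.re * p - z.im * q = (z.re + z.im) + 2 * (z.re * e - z.im * f - z.im) := by
        rw [hp', hq']; ring
      rw [this]
      exact dvd_add h2 (dvd_mul_right _ _)
    · simp only
      have : z.re * q + z.im * p = (z.re + z.im) + 2 * (z.re * f + z.im * e) := by
        rw [hp', hq']; ring
      rw [this]
      exact dvd_add h2 (dvd_mul_right _ _)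
    · simp only
      rw [hN, ← hdm, ← hpq]
      push_cast; ring
    · simp only; omega
    · simp only
      rw [Nat.not_even_iff_odd]
      exact ⟨e, he⟩
  · rintro t ht
    rw [Finset.mem_coe, Set.Finite.mem_toFinset] at ht
    obtain ⟨hao, hbo, m, hm, hnn⟩ := hev t ht
    obtain ⟨⟨hQ, hc, ha, hb, hab, hba, -, -⟩, hlt, -⟩ := ht
    have hba' := lt_of_le_of_ne hba (sq_ne_three_mul_sq hb (b := t.2.1))
    have hm' : t.1.norm.natAbs / 2 = m := by omega
    simp only [Finset.coe_sigma, Set.mem_sigma_iff, Finset.mem_coe, Finset.mem_product,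
      Finset.mem_filter, Nat.mem_divisorsAntidiagonal, Set.Finite.mem_toFinset, hm', true_and]
    refine ⟨⟨hnn, hn⟩, ⟨?_, hlt, hba', hao, hbo⟩, hQ, hc, ?_⟩
    · positivity
    · rw [hm]; push_cast; rfl
  · rintro ⟨⟨d, m⟩, ⟨p, q⟩, z⟩ h
    simp only [Finset.coe_sigma, Set.mem_sigma_iff, Finset.mem_coe, Finset.mem_product,
      Finset.mem_filter, Nat.mem_divisorsAntidiagonal, Set.Finite.mem_toFinset] at h
    obtain ⟨⟨hdm, -⟩, ⟨⟨hpq, hd⟩, hlt, hlt3, -⟩, hQ, hc, hN⟩ := h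
    simp only [hpq, hN, Int.natAbs_natCast, Nat.mul_div_cancel_left _ two_pos]
  · rintro t ht
    rfl

/-- The counting function of well-rounded sublattices in terms of primitive Gaussian integers. -/
theorem aSquare_eq {n : ℕ} (hn : n ≠ 0) :
    aSquare n = similarCount squareLattice n +
      2 * (if 2 ∣ n then ∑ x ∈ (n / 2).divisorsAntidiagonal,
        ratioCount (fun _ => True) x.1 * primitiveSimilarCount squareLattice x.2 else 0) +
      2 * ∑ x ∈ n.divisorsAntidiagonal,
        ratioCount Odd x.1 * primitiveSimilarCount squareLattice (2 * x.2) := by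
  have hfin : ∀ A ⊆ wrSet n, A.Finite := fun A hA => (wrSet_finite n).subset hA
  have hU : wrSet n = {t ∈ wrSet n | t.2.1 = t.2.2} ∪ ({t ∈ wrSet n | t.2.2 < t.2.1} ∪
      {t ∈ wrSet n | t.2.1 < t.2.2}) := by
    ext t
    have := lt_trichotomy t.2.1 t.2.2
    simp only [Set.mem_union, Set.mem_ofPred_eq]
    tauto
  have hV : {t ∈ wrSet n | t.2.1 < t.2.2} = {t ∈ wrSet n | t.2.1 < t.2.2 ∧ Even t.2.1} ∪
      {t ∈ wrSet n | t.2.1 < t.2.2 ∧ ¬ Even t.2.1} := by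
    ext t
    simp only [Set.mem_union, Set.mem_ofPred_eq]
    tauto
  have h0 := Set.ncard_union_eq (s := {t ∈ wrSet n | t.2.1 = t.2.2})
    (t := {t ∈ wrSet n | t.2.2 < t.2.1} ∪ {t ∈ wrSet n | t.2.1 < t.2.2})
    (by
      rw [Set.disjoint_left]
      rintro t ⟨-, h⟩ (⟨-, h'⟩ | ⟨-, h'⟩) <;> omega)
    (hfin _ fun t ht => ht.1) (hfin _ (by rintro t (ht | ht) <;> exact ht.1))
  have h1 := Set.ncard_union_eq (s := {t ∈ wrSet n | t.2.2 < t.2.1})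
    (t := {t ∈ wrSet n | t.2.1 < t.2.2})
    (by
      rw [Set.disjoint_left]
      rintro t ⟨-, h⟩ ⟨-, h'⟩; omega)
    (hfin _ fun t ht => ht.1) (hfin _ fun t ht => ht.1)
  have h2 := Set.ncard_union_eq (s := {t ∈ wrSet n | t.2.1 < t.2.2 ∧ Even t.2.1})
    (t := {t ∈ wrSet n | t.2.1 < t.2.2 ∧ ¬ Even t.2.1})
    (by
      rw [Set.disjoint_left]
      rintro t ⟨-, -, h⟩ ⟨-, -, h'⟩; exact h' h)
    (hfin _ fun t ht => ht.1) (hfin _ fun t ht => ht.1)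
  rw [← hU] at h0
  rw [← hV] at h2
  simp only [primitiveSimilarCount_eq_ncard]
  rw [aSquare_eq_ncard hn, similarCount_eq_ncard, h0, h1, ncard_wrSet_swap, h2,
    ncard_wrSet_diag hn, ncard_wrSet_even hn, ncard_wrSet_odd hn]
  ring

/-! ### Primitive Gaussian integers and square roots of −1. -/

/-- The number of square roots of `-1` modulo `n`. -/
noncomputable def rootCount (n : ℕ) : ℕ := {x : ZMod n | x * x = -1}.ncard

theorem isUnit_im_of_mem_primSet {n : ℕ} {z : GaussianInt} (hz : z ∈ primSet n) :
    IsUnit (z.im : ZMod n) := by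
  rw [ZMod.coe_int_isUnit_iff_isCoprime]
  have h := hz.2.2
  rw [Zsqrtd.norm_def] at h
  have h1 : (n : ℤ) = z.re ^ 2 + z.im * z.im := by rw [← h]; ring
  rw [h1, IsCoprime.add_mul_left_left_iff]
  exact hz.2.1.pow_left

theorem sq_add_sq_eq_zero_of_mem_primSet {n : ℕ} {z : GaussianInt} (hz : z ∈ primSet n) :
    (z.re : ZMod n) ^ 2 + (z.im : ZMod n) ^ 2 = 0 := by
  have h := hz.2.2
  rw [norm_eq_sq_add_sq] at h
  have := congrArg (Int.cast : ℤ → ZMod n) h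
  push_cast at this
  simpa using this

theorem eq_of_norm_eq_one {y : GaussianInt} (h : y.norm = 1) :
    (y : ℂ) = 1 ∨ (y : ℂ) = -1 ∨ (y : ℂ) = Complex.I ∨ (y : ℂ) = -Complex.I := by
  rw [norm_eq_sq_add_sq] at h
  have h1 : y.re ^ 2 ≤ 1 ^ 2 := by nlinarith [sq_nonneg y.im]
  have h2 : y.im ^ 2 ≤ 1 ^ 2 := by nlinarith [sq_nonneg y.re]
  have h3 := abs_le_of_sq_le_sq' h1 (by norm_num)
  have h4 := abs_le_of_sq_le_sq' h2 (by norm_num)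
  obtain ⟨a, b⟩ := y
  simp only at *
  obtain ⟨h5, h6⟩ := h3
  obtain ⟨h7, h8⟩ := h4
  rw [GaussianInt.toComplex_def']
  interval_cases a <;> interval_cases b <;> simp at h ⊢

/-- Equal roots make n divide z·conj(w); since w·conj(w) = n, the quotient z/w is a Gaussian integer
of norm 1, hence 1 in the quadrant. -/
theorem primSet_root_injOn {n : ℕ} (hn : n ≠ 0) :
    Set.InjOn (fun z : GaussianInt => -(z.re : ZMod n) * (z.im : ZMod n)⁻¹) (primSet n) := by
  intro z hz w hw h
  simp only at h
  have h1 := ZMod.mul_inv_of_unit _ (isUnit_im_of_mem_primSet hz)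
  have h2 := ZMod.mul_inv_of_unit _ (isUnit_im_of_mem_primSet hw)
  have h3 : (z.re : ZMod n) * w.im = w.re * z.im := by
    linear_combination (-(z.im : ZMod n) * w.im) * h - (z.re : ZMod n) * w.im * h1 +
      (w.re : ZMod n) * z.im * h2
  have h4 := sq_add_sq_eq_zero_of_mem_primSet hw
  have h5 : (z.re : ZMod n) * w.re + z.im * w.im = 0 := by
    have e : (w.im : ZMod n) * (z.re * w.re + z.im * w.im) = 0 := by
      linear_combination (w.re : ZMod n) * h3 + (z.im : ZMod n) * h4
    have := congrArg ((w.im : ZMod n)⁻¹ * ·) e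
    simp only [mul_zero] at this
    linear_combination this - (z.re * w.re + z.im * w.im) * h2
  obtain ⟨c, hc⟩ : (n : ℤ) ∣ z.re * w.im - w.re * z.im := by
    rw [← ZMod.intCast_zmod_eq_zero_iff_dvd]
    push_cast
    rw [h3, sub_self]
  obtain ⟨d, hd⟩ : (n : ℤ) ∣ z.re * w.re + z.im * w.im := by
    rw [← ZMod.intCast_zmod_eq_zero_iff_dvd]
    push_cast
    exact h5
  have hn' : (n : ℤ) ≠ 0 := by exact_mod_cast hn
  have hNz := hz.2.2
  have hNw := hw.2.2
  rw [norm_eq_sq_add_sq] at hNz hNw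
  have hzw : z = ⟨d, -c⟩ * w := by
    ext
    · simp only [Zsqrtd.re_mul]
      apply mul_left_cancel₀ hn'
      linear_combination (-z.re) * hNw + w.re * hd + w.im * hc
    · simp only [Zsqrtd.im_mul]
      apply mul_left_cancel₀ hn'
      linear_combination (-z.im) * hNw + w.im * hd - w.re * hc
  have hy : (⟨d, -c⟩ : GaussianInt).norm = 1 := by
    have h6 := congrArg Zsqrtd.norm hzw
    rw [Zsqrtd.norm_mul, hz.2.2, hw.2.2] at h6
    apply mul_right_cancel₀ hn'
    rw [← h6, one_mul]
  have h7 := congrArg GaussianInt.toComplex hzw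
  rw [GaussianInt.toComplex_mul] at h7
  have := InQuadrant.eq_of_mul_eq hw.1 hz.1 (a := 1) (a' := 1) one_pos one_pos
    (eq_of_norm_eq_one hy) (by simpa using h7)
  exact Zsqrtd.ext (by simpa using this.2.1) (by simpa using this.2.2)

/-- The kernel of the ring map i ↦ x from ℤ[i] to ℤ/n is principal. Its generator z divides −X + i,
so it is primitive; it divides n, so N(z) ∣ n by primitivity; and x² = −1 gives n ∣ N(z). -/
theorem primSet_root_surj {n : ℕ} (hn : n ≠ 0) {x : ZMod n} (hx : x * x = -1) :
    ∃ z ∈ primSet n, -(z.re : ZMod n) * (z.im : ZMod n)⁻¹ = x := by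
  let φ : GaussianInt →+* ZMod n := Zsqrtd.lift ⟨x, by simpa using hx⟩
  have hφ : ∀ z : GaussianInt, φ z = z.re + z.im * x := fun z => rfl
  obtain ⟨g, hg⟩ := (IsPrincipalIdealRing.principal (RingHom.ker φ)).principal
  have hmem : ∀ y : GaussianInt, φ y = 0 ↔ g ∣ y := by
    intro y
    rw [← RingHom.mem_ker, hg]
    exact Ideal.mem_span_singleton
  have hgn : g ∣ (n : GaussianInt) := by
    rw [← hmem, map_natCast, ZMod.natCast_self]
  have hg0 : g ≠ 0 := by
    rintro rfl
    rw [zero_dvd_iff] at hgn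
    exact hn (by exact_mod_cast hgn)
  obtain ⟨z, hzQ, -, hz⟩ := exists_inQuadrant_rotation hg0
  have hI : ((⟨0, 1⟩ : GaussianInt) : ℂ) = Complex.I := by simp [GaussianInt.toComplex_def]
  have hassoc : ∀ e f : GaussianInt, e * f = 1 → (g : ℂ) = e * z → ∀ y, φ y = 0 ↔ z ∣ y := by
    intro e f hef h y
    rw [hmem]
    have h' : g = e * z := GaussianInt.toComplex_inj.1 (by rw [h, GaussianInt.toComplex_mul])
    rw [h']
    exact IsUnit.mul_left_dvd (IsUnit.of_mul_eq_one f hef)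
  have hz' : ∀ y, φ y = 0 ↔ z ∣ y := by
    rcases hz with h | h | h | h
    · exact hassoc 1 1 (by simp) (by rw [h]; simp)
    · exact hassoc (-1) (-1) (by simp) (by rw [h]; simp)
    · exact hassoc ⟨0, 1⟩ ⟨0, -1⟩ (by ext <;> simp) (by rw [h, hI])
    · exact hassoc (-⟨0, 1⟩) ⟨0, 1⟩ (by ext <;> simp)
        (by rw [h, GaussianInt.toComplex_neg, hI]; ring)
  obtain ⟨X, rfl⟩ := ZMod.intCast_surjective x
  have hc : IsCoprime z.re z.im := by
    obtain ⟨y, hy⟩ : z ∣ ⟨-X, 1⟩ := by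
      rw [← hz', hφ]
      simp
    have := congrArg Zsqrtd.im hy
    simp only [Zsqrtd.im_mul] at this
    exact ⟨y.im, y.re, by linear_combination -this⟩
  have hzz : (z.re : ZMod n) + z.im * X = 0 := by rw [← hφ, hz']
  have hd1 : (n : ℤ) ∣ z.norm := by
    rw [← ZMod.intCast_zmod_eq_zero_iff_dvd, norm_eq_sq_add_sq]
    push_cast
    linear_combination ((z.re : ZMod n) - z.im * X) * hzz + (z.im : ZMod n) ^ 2 * hx
  have hd2 : z.norm ∣ n := by
    obtain ⟨y, hy⟩ : z ∣ (n : GaussianInt) := by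
      rw [← hz', map_natCast, ZMod.natCast_self]
    have h1 := congrArg Zsqrtd.re hy
    have h2 := congrArg Zsqrtd.im hy
    simp only [Zsqrtd.im_mul, Zsqrtd.re_mul, Zsqrtd.re_natCast, Zsqrtd.im_natCast] at h1 h2
    obtain ⟨s, t, hst⟩ := hc
    refine ⟨s * y.re - t * y.im, ?_⟩
    rw [norm_eq_sq_add_sq]
    linear_combination (-(n : ℤ)) * hst + (s * z.re + t * z.im) * h1 + (s * z.im - t * z.re) * h2
  have hN : z.norm = n :=
    Int.dvd_antisymm (GaussianInt.norm_nonneg z) (Int.natCast_nonneg n) hd2 hd1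
  have hzp : z ∈ primSet n := ⟨hzQ, hc, hN⟩
  refine ⟨z, hzp, ?_⟩
  have h1 := ZMod.mul_inv_of_unit _ (isUnit_im_of_mem_primSet hzp)
  linear_combination (-(z.im : ZMod n)⁻¹) * hzz + (X : ZMod n) * h1

theorem ncard_primSet {n : ℕ} (hn : n ≠ 0) : (primSet n).ncard = rootCount n := by
  rw [← (primSet_root_injOn hn).ncard_image, rootCount]
  congr 1
  ext x
  constructor
  · rintro ⟨z, hz, rfl⟩
    have h1 := ZMod.mul_inv_of_unit _ (isUnit_im_of_mem_primSet hz)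
    have h4 := sq_add_sq_eq_zero_of_mem_primSet hz
    rw [Set.mem_ofPred_eq]
    linear_combination ((z.im : ZMod n)⁻¹ ^ 2) * h4 -
      ((z.im : ZMod n) * (z.im : ZMod n)⁻¹ + 1) * h1
  · intro hx
    exact primSet_root_surj hn hx

theorem rootCount_mul {m n : ℕ} (h : m.Coprime n) :
    rootCount (m * n) = rootCount m * rootCount n := by
  rw [rootCount, rootCount, rootCount, ← Set.ncard_prod,
    ← Set.ncard_image_of_injective _ (ZMod.chineseRemainder h).injective]
  congr 1
  ext x
  simp only [Set.mem_image, Set.mem_ofPred_eq, Set.mem_prod]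
  constructor
  · rintro ⟨y, hy, rfl⟩
    have := congrArg (ZMod.chineseRemainder h) hy
    rw [map_mul, map_neg, map_one] at this
    exact ⟨congrArg Prod.fst this, congrArg Prod.snd this⟩
  · rintro ⟨h1, h2⟩
    refine ⟨(ZMod.chineseRemainder h).symm x, ?_, by simp⟩
    apply (ZMod.chineseRemainder h).injective
    rw [map_mul, map_neg, map_one, RingEquiv.apply_symm_apply]
    exact Prod.ext h1 h2

theorem rootCount_one : rootCount 1 = 1 := by
  rw [rootCount, Set.ncard_eq_one]
  exact ⟨0, by ext x; simp only [Set.mem_ofPred_eq, Set.mem_singleton_iff]; revert x; decide⟩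

theorem rootCount_two : rootCount 2 = 1 := by
  rw [rootCount, Set.ncard_eq_one]
  refine ⟨1, ?_⟩
  ext x
  simp only [Set.mem_ofPred_eq, Set.mem_singleton_iff]
  revert x
  decide

theorem rootCount_eq_zero_of_dvd {m n : ℕ} (h : m ∣ n) (h0 : ∀ x : ZMod m, x * x ≠ -1) :
    rootCount n = 0 := by
  rw [rootCount]
  convert Set.ncard_empty (ZMod n)
  rw [Set.eq_empty_iff_forall_notMem]
  intro x hx
  apply h0 (ZMod.castHom h (ZMod m) x)
  rw [← map_mul, hx, map_neg, map_one]

theorem rootCount_of_four_dvd {n : ℕ} (h : 4 ∣ n) : rootCount n = 0 :=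
  rootCount_eq_zero_of_dvd h (by decide)

theorem rootCount_prime_pow_of_mod_four_eq_three {p : ℕ} (hp : p.Prime) (h : p % 4 = 3) (k : ℕ) :
    rootCount (p ^ (k + 1)) = 0 := by
  have := Fact.mk hp
  refine rootCount_eq_zero_of_dvd (dvd_pow_self p k.succ_ne_zero) fun x hx => ?_
  exact ZMod.exists_sq_eq_neg_one_iff.1 ⟨x, hx.symm⟩ h

theorem rootCount_prime_pow_of_mod_four_eq_one {p : ℕ} (hp : p.Prime) (h : p % 4 = 1) (k : ℕ) :
    rootCount (p ^ (k + 1)) = 2 := by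
  have := Fact.mk hp
  obtain ⟨y, hy⟩ := ZMod.exists_sq_eq_neg_one_iff.2 (by omega : p % 4 ≠ 3)
  obtain ⟨Y, rfl⟩ := ZMod.intCast_surjective y
  have hY : (p : ℤ) ∣ Y ^ 2 - (-1) := by
    rw [← ZMod.intCast_zmod_eq_zero_iff_dvd]
    push_cast
    rw [hy]; ring
  -- Raising Y² ≡ −1 mod p to the odd power pᵏ lifts the congruence to modulus pᵏ⁺¹, so Y to the
  -- power pᵏ is a root there.
  have h1 := dvd_sub_pow_of_dvd_sub hY k
  have hodd : Odd (p ^ k) := (Nat.odd_iff.2 (by omega)).pow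
  rw [hodd.neg_one_pow, ← pow_mul, mul_comm 2, pow_mul] at h1
  set X := Y ^ p ^ k
  have hp2 : ¬ (p : ℤ) ∣ 2 := by
    intro hd
    have := Int.natCast_dvd_natCast.1 (by exact_mod_cast hd : (p : ℤ) ∣ ((2 : ℕ) : ℤ))
    have := Nat.le_of_dvd two_pos this
    have := hp.two_le
    have : p = 2 := by omega
    omega
  have hpp : Prime (p : ℤ) := Nat.prime_iff_prime_int.1 hp
  have hpX : ∀ X : ℤ, (p : ℤ) ^ (k + 1) ∣ X ^ 2 - (-1) → ¬ (p : ℤ) ∣ X := by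
    intro X h1 hd
    have h2 : (p : ℤ) ∣ X ^ 2 - (-1) := (dvd_pow_self _ k.succ_ne_zero).trans h1
    have h3 : (p : ℤ) ∣ 1 := by
      have := dvd_sub h2 (hd.trans (dvd_pow_self X two_ne_zero))
      simpa using this
    exact hpp.not_isUnit (isUnit_of_dvd_one h3)
  have hroot : ∀ X : ℤ, (X : ZMod (p ^ (k + 1))) * X = -1 ↔ (p : ℤ) ^ (k + 1) ∣ X ^ 2 - (-1) := by
    intro X
    rw [← Nat.cast_pow, ← ZMod.intCast_zmod_eq_zero_iff_dvd, ← sub_eq_zero]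
    push_cast
    rw [sq]
  rw [rootCount, Set.ncard_eq_two]
  refine ⟨(X : ZMod (p ^ (k + 1))), -(X : ZMod (p ^ (k + 1))), ?_, ?_⟩
  · intro he
    have : (p : ℤ) ^ (k + 1) ∣ 2 * X := by
      rw [← Nat.cast_pow, ← ZMod.intCast_zmod_eq_zero_iff_dvd]
      push_cast
      linear_combination he
    have := (dvd_pow_self _ k.succ_ne_zero).trans this
    rcases hpp.dvd_or_dvd this with h' | h'
    · exact hp2 h'
    · exact hpX X h1 h'
  · ext x
    obtain ⟨Z, rfl⟩ := ZMod.intCast_surjective x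
    simp only [Set.mem_ofPred_eq, Set.mem_insert_iff, Set.mem_singleton_iff]
    constructor
    · intro hZ
      rw [hroot] at hZ
      have hd : (p : ℤ) ^ (k + 1) ∣ (Z - X) * (Z + X) := by
        rw [show (Z - X) * (Z + X) = Z ^ 2 - (-1) - (X ^ 2 - (-1)) by ring]
        exact dvd_sub hZ h1
      -- As p does not divide 2X, it divides at most one of Z − X and Z + X, and the other factor
      -- can be cancelled.
      by_cases hpd : (p : ℤ) ∣ Z - X
      · have hpn : ¬ (p : ℤ) ∣ Z + X := by
          intro hpd'
          have : (p : ℤ) ∣ 2 * X := by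
            rw [show 2 * X = Z + X - (Z - X) by ring]
            exact dvd_sub hpd' hpd
          rcases hpp.dvd_or_dvd this with h' | h'
          · exact hp2 h'
          · exact hpX X h1 h'
        left
        have hcop : IsCoprime ((p : ℤ) ^ (k + 1)) (Z + X) :=
          ((Prime.coprime_iff_not_dvd hpp).2 hpn).pow_left
        have := hcop.dvd_of_dvd_mul_right hd
        rw [← Nat.cast_pow, ← ZMod.intCast_zmod_eq_zero_iff_dvd] at this
        push_cast at this
        exact sub_eq_zero.1 this
      · right
        have hcop : IsCoprime ((p : ℤ) ^ (k + 1)) (Z - X) :=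
          ((Prime.coprime_iff_not_dvd hpp).2 hpd).pow_left
        have := hcop.dvd_of_dvd_mul_left hd
        rw [← Nat.cast_pow, ← ZMod.intCast_zmod_eq_zero_iff_dvd] at this
        push_cast at this
        exact eq_neg_of_add_eq_zero_left this
    · have hX := (hroot X).2 h1
      rintro (h' | h') <;> rw [h']
      · exact hX
      · rw [neg_mul_neg]; exact hX

/-- The number of roots modulo prime powers in terms of the quadratic character. -/
theorem rootCount_prime_pow {p : ℕ} (hp : p.Prime) (k : ℕ) :
    (rootCount (p ^ (k + 1)) : ℤ) = ZMod.χ₄ p ^ k + ZMod.χ₄ p ^ (k + 1) := by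
  rcases hp.eq_two_or_odd' with rfl | hodd
  · have h2 : ZMod.χ₄ ((2 : ℕ) : ZMod 4) = 0 := by decide
    rw [h2]
    rcases k with _ | k
    · simp [rootCount_two]
    · rw [rootCount_of_four_dvd ⟨2 ^ k, by ring⟩]
      simp
  · have h2 : p % 4 = 1 ∨ p % 4 = 3 := Nat.odd_mod_four_iff.1 (Nat.odd_iff.1 hodd)
    rcases h2 with h | h
    · rw [rootCount_prime_pow_of_mod_four_eq_one hp h, ZMod.χ₄_nat_one_mod_four h]
      norm_num
    · rw [rootCount_prime_pow_of_mod_four_eq_three hp h, ZMod.χ₄_nat_three_mod_four h]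
      rw [pow_succ]
      simp

theorem rootCount_two_mul_of_odd {m : ℕ} (h : Odd m) : rootCount (2 * m) = rootCount m := by
  rw [rootCount_mul ((Nat.coprime_two_left).2 h), rootCount_two, one_mul]

theorem rootCount_two_mul_of_even {m : ℕ} (h : Even m) : rootCount (2 * m) = 0 := by
  obtain ⟨c, rfl⟩ := h.two_dvd
  exact rootCount_of_four_dvd ⟨c, by ring⟩

/-! ### Multiplicativity and the convolution identity. -/

open scoped LSeries.notation in
theorem convolution_isMultiplicative {f g : ℕ → ℂ}
    (hf : (toArithmeticFunction f).IsMultiplicative)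
    (hg : (toArithmeticFunction g).IsMultiplicative) {f' g' : ℕ → ℂ}
    (hf' : (toArithmeticFunction f').IsMultiplicative)
    (hg' : (toArithmeticFunction g').IsMultiplicative)
    (h : ∀ p k : ℕ, p.Prime → (f ⍟ g) (p ^ k) = (f' ⍟ g') (p ^ k)) : f ⍟ g = f' ⍟ g' := by
  have := (ArithmeticFunction.IsMultiplicative.eq_iff_eq_on_prime_powers _ (hf.mul hg) _
    (hf'.mul hg')).2 (fun p i hp => h p i hp)
  exact congrArg _ this

theorem isSquare_mul_of_coprime {m n : ℕ} (h : m.Coprime n) :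
    IsSquare (m * n) ↔ IsSquare m ∧ IsSquare n := by
  constructor
  · rintro ⟨c, hc⟩
    have h1 : IsUnit (gcd m n) := by
      rw [gcd_eq_nat_gcd, h.gcd_eq_one]
      exact isUnit_one
    have h2 : IsUnit (gcd n m) := by
      rw [gcd_eq_nat_gcd, h.symm.gcd_eq_one]
      exact isUnit_one
    obtain ⟨d, hd⟩ := exists_eq_pow_of_mul_eq_pow h1 (c := c) (k := 2) (by rw [hc, sq])
    obtain ⟨e, he⟩ := exists_eq_pow_of_mul_eq_pow h2 (c := c) (k := 2) (by rw [mul_comm, hc, sq])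
    exact ⟨⟨d, by rw [hd, sq]⟩, ⟨e, by rw [he, sq]⟩⟩
  · rintro ⟨h1, h2⟩
    exact h1.mul h2

theorem isSquare_prime_pow {p : ℕ} (hp : p.Prime) (k : ℕ) : IsSquare (p ^ k) ↔ Even k := by
  constructor
  · rintro ⟨c, hc⟩
    have hc0 : c ≠ 0 := by
      rintro rfl
      exact (pow_pos hp.pos k).ne' (by simpa using hc)
    have := congrArg (fun x => x.factorization p) hc
    simp only [Nat.factorization_mul hc0 hc0, hp.factorization_pow] at this
    simp at this
    exact ⟨_, this⟩
  · rintro ⟨c, rfl⟩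
    exact ⟨p ^ c, by rw [pow_add]⟩

/-- The indicator function of the squares. -/
noncomputable def squareIndicator (n : ℕ) : ℂ := by
  classical exact if IsSquare n then 1 else 0

theorem squareIndicator_isMultiplicative :
    (toArithmeticFunction squareIndicator).IsMultiplicative := by
  refine ArithmeticFunction.IsMultiplicative.iff_ne_zero.mpr ⟨?_, fun {m} {n} hm hn h ↦ ?_⟩
  · simp [toArithmeticFunction, squareIndicator]
  · simp only [toArithmeticFunction, ArithmeticFunction.coe_mk, hm, hn, squareIndicator,
      isSquare_mul_of_coprime h, mul_eq_zero, or_self, if_false]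
    split_ifs <;> simp_all

theorem rootCount_isMultiplicative :
    (toArithmeticFunction fun n => (rootCount n : ℂ)).IsMultiplicative := by
  refine ArithmeticFunction.IsMultiplicative.iff_ne_zero.mpr ⟨?_, fun {m} {n} hm hn h ↦ ?_⟩
  · simp [toArithmeticFunction, rootCount_one]
  · simp [toArithmeticFunction, hm, hn, rootCount_mul h]

/-- The count at pʲ is χʲ⁻¹ + χʲ for j ≥ 1, so the exponents of the same parity as k fill up the
geometric sum; hence the induction in steps of two. -/
theorem sum_rootCount_prime_pow {p : ℕ} (hp : p.Prime) (k : ℕ) :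
    ∑ i ∈ Finset.range (k + 1), (rootCount (p ^ i) : ℂ) * (if Even (k - i) then 1 else 0) =
      ∑ i ∈ Finset.range (k + 1), (ZMod.χ₄ p : ℂ) ^ i := by
  have hr : ∀ j, (rootCount (p ^ (j + 1)) : ℂ) = (ZMod.χ₄ p : ℂ) ^ j + (ZMod.χ₄ p : ℂ) ^ (j + 1) := by
    intro j
    have := rootCount_prime_pow hp j
    exact_mod_cast congrArg (Int.cast : ℤ → ℂ) this
  induction k using Nat.twoStepInduction with
  | zero => simp [rootCount_one]
  | one =>
    rw [Finset.sum_range_succ, Finset.sum_range_one, Finset.sum_range_succ, Finset.sum_range_one]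
    have := hr 0
    simp at this
    simp [this]
  | more k ih _ =>
    rw [Finset.sum_range_succ, Finset.sum_range_succ, Finset.sum_range_succ _ (k + 2),
      Finset.sum_range_succ _ (k + 1), ← ih]
    have h1 : ∀ i ∈ Finset.range (k + 1),
        (rootCount (p ^ i) : ℂ) * (if Even (k + 2 - i) then 1 else 0) =
        (rootCount (p ^ i) : ℂ) * (if Even (k - i) then 1 else 0) := by
      intro i hi
      rw [Finset.mem_range] at hi
      have : k + 2 - i = k - i + 2 := by omega
      rw [this]
      simp [Nat.even_add]
    rw [Finset.sum_congr rfl h1, hr (k + 1)]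
    have h2 : k + 2 - (k + 1) = 1 := by omega
    rw [h2]
    simp
    ring

theorem chiNegFour_natCast (n : ℕ) : chiNegFour n = (ZMod.χ₄ n : ℂ) := by
  simp [chiNegFour]

-- This is Φᵖʳ(s)ζ(2s) = ζ(s)L(s, χ₋₄) at the level of coefficients; both sides are multiplicative,
-- so prime powers suffice.
open scoped LSeries.notation in
theorem rootCount_convolution :
    (fun n => (rootCount n : ℂ)) ⍟ squareIndicator = (fun n => chiNegFour n) ⍟ 1 := by
  apply convolution_isMultiplicative rootCount_isMultiplicative squareIndicator_isMultiplicative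
  · exact DirichletCharacter.isMultiplicative_toArithmeticFunction chiNegFour
  · refine ArithmeticFunction.IsMultiplicative.iff_ne_zero.mpr ⟨?_, fun {m} {n} hm hn h ↦ ?_⟩
    · simp [toArithmeticFunction]
    · simp [toArithmeticFunction, hm, hn]
  · intro p k hp
    simp only [LSeries.convolution_def, Pi.one_apply, mul_one]
    rw [Nat.sum_divisorsAntidiagonal (fun i j => (rootCount i : ℂ) * squareIndicator j),
      Nat.sum_divisorsAntidiagonal (fun i j => chiNegFour i), Nat.sum_divisors_prime_pow hp,
      Nat.sum_divisors_prime_pow hp]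
    have h1 := sum_rootCount_prime_pow hp k
    simp only [chiNegFour_natCast]
    push_cast at h1 ⊢
    simp only [map_pow]
    push_cast
    rw [← h1]
    refine Finset.sum_congr rfl fun i hi => ?_
    rw [Finset.mem_range] at hi
    rw [Nat.pow_div (by omega) hp.pos, squareIndicator]
    simp only [isSquare_prime_pow hp]

theorem norm_eq_of_dvd {y : GaussianInt} {u v g : ℤ} (hu : y.re = u * g) (hv : y.im = v * g) :
    y.norm = (⟨u, v⟩ : GaussianInt).norm * (g * g) := by
  rw [norm_eq_sq_add_sq, norm_eq_sq_add_sq, hu, hv]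
  ring

/-- A non-zero Gaussian integer is uniquely a positive integer times a primitive one, and the
integer factor enters the norm by its square. -/
theorem ncard_simSet {n : ℕ} (hn : n ≠ 0) :
    ((simSet n).ncard : ℂ) =
      ∑ x ∈ n.divisorsAntidiagonal, ((primSet x.1).ncard : ℂ) * squareIndicator x.2 := by
  classical
  have hR : ∀ x : ℕ × ℕ, ((primSet x.1).ncard : ℂ) * squareIndicator x.2 =
      if IsSquare x.2 then ((primSet_finite x.1).toFinset.card : ℂ) else 0 := by
    intro x
    rw [Set.ncard_eq_toFinset_card _ (primSet_finite _), squareIndicator]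
    split_ifs <;> simp
  rw [Finset.sum_congr rfl fun x _ => hR x, ← Finset.sum_filter, ← Nat.cast_sum,
    ← Finset.card_sigma, Set.ncard_eq_toFinset_card _ (simSet_finite _)]
  congr 1
  symm
  refine Finset.card_bij (fun s _ => (⟨s.2.re * Nat.sqrt s.1.2, s.2.im * Nat.sqrt s.1.2⟩ : GaussianInt))
    ?_ ?_ ?_
  · rintro ⟨⟨m, d⟩, z⟩ h
    simp only [Finset.mem_sigma, Finset.mem_filter, Nat.mem_divisorsAntidiagonal,
      Set.Finite.mem_toFinset] at h ⊢
    obtain ⟨⟨⟨hmd, -⟩, ⟨c, rfl⟩⟩, hQ, hc, hN⟩ := h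
    have hc0 : 0 < c := by
      rcases Nat.eq_zero_or_pos c with rfl | h
      · simp at hmd; exact absurd hmd.symm hn
      · exact h
    have hc' : (0 : ℤ) < c := by exact_mod_cast hc0
    rw [Nat.sqrt_eq]
    refine ⟨⟨mul_pos hQ.1 hc', mul_nonneg hQ.2 hc'.le⟩, ?_⟩
    rw [norm_eq_of_dvd rfl rfl, hN, ← hmd]
    push_cast; ring
  · rintro ⟨⟨m, d⟩, z⟩ h ⟨⟨m', d'⟩, z'⟩ h' e
    simp only [Finset.mem_sigma, Finset.mem_filter, Nat.mem_divisorsAntidiagonal,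
      Set.Finite.mem_toFinset] at h h'
    obtain ⟨⟨⟨hmd, -⟩, ⟨c, rfl⟩⟩, hQ, hc, hN⟩ := h
    obtain ⟨⟨⟨hmd', -⟩, ⟨c', rfl⟩⟩, hQ', hc', hN'⟩ := h'
    have hc0 : 0 < c' := by
      rcases Nat.eq_zero_or_pos c' with rfl | h
      · simp at hmd'; exact absurd hmd'.symm hn
      · exact h
    simp only [Nat.sqrt_eq, Zsqrtd.mk.injEq] at e
    obtain ⟨rfl, rfl⟩ := eq_of_coprime_of_mul_eq hc' hc hc0 e.1 e.2
    have : (m : ℤ) = m' := by rw [← hN, ← hN']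
    rw [Int.natCast_inj.1 this]
  · intro y hy
    rw [Set.Finite.mem_toFinset] at hy
    obtain ⟨hQ, hN⟩ := hy
    have h0 : 0 < Int.gcd y.re y.im := by
      rw [Nat.pos_iff_ne_zero, Ne, Int.gcd_eq_zero_iff]
      exact fun h => hQ.1.ne' h.1
    obtain ⟨u, v, huv, hu, hv⟩ := Int.exists_gcd_one h0
    set g := Int.gcd y.re y.im
    have hg : (0 : ℤ) < g := by exact_mod_cast h0
    refine ⟨⟨((⟨u, v⟩ : GaussianInt).norm.natAbs, g * g), ⟨u, v⟩⟩, ?_, ?_⟩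
    · simp only [Finset.mem_sigma, Finset.mem_filter, Nat.mem_divisorsAntidiagonal,
        Set.Finite.mem_toFinset]
      refine ⟨⟨⟨?_, hn⟩, ⟨g, rfl⟩⟩, ⟨?_, ?_⟩, Int.isCoprime_iff_gcd_eq_one.2 huv,
        (GaussianInt.abs_natCast_norm _).symm⟩
      · rw [norm_eq_of_dvd hu hv, ← GaussianInt.abs_natCast_norm] at hN
        exact_mod_cast hN
      · have := hQ.1
        rw [hu] at this
        exact pos_of_mul_pos_left this hg.le
      · have := hQ.2
        rw [hv] at this
        exact nonneg_of_mul_nonneg_left this hg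
    · simp only [Nat.sqrt_eq]
      exact Zsqrtd.ext hu.symm hv.symm

/-! ### Dirichlet series of the similar and primitive similar sublattices. -/

theorem hasSum_squareIndicator {s : ℂ} (hs : 1 / 2 < s.re) :
    LSeriesHasSum squareIndicator s (riemannZeta (2 * s)) := by
  have h2s : 1 < (2 * s).re := by simp; linarith
  have h := LSeriesHasSum_one h2s
  rw [LSeriesHasSum] at h ⊢
  have hinj : Function.Injective (fun n : ℕ => n * n) := fun a b h => Nat.mul_self_inj.1 h
  rw [← hinj.hasSum_iff]
  · convert h using 1
    ext n
    rcases Nat.eq_zero_or_pos n with rfl | hn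
    · simp
    · have hn0 : n ≠ 0 := hn.ne'
      rw [Function.comp_apply, LSeries.term_of_ne_zero (mul_ne_zero hn0 hn0),
        LSeries.term_of_ne_zero hn0, squareIndicator, if_pos ⟨n, rfl⟩, Pi.one_apply, Nat.cast_mul,
        Complex.natCast_mul_natCast_cpow, two_mul, Complex.cpow_add _ _ (by exact_mod_cast hn0)]
  · intro x hx
    rcases Nat.eq_zero_or_pos x with rfl | hx0
    · simp
    · rw [LSeries.term_of_ne_zero hx0.ne', squareIndicator, if_neg, zero_div]
      rintro ⟨c, rfl⟩
      exact hx ⟨c, rfl⟩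

-- Jacobi's two-square formula, up to the factor 4 for the units.
open scoped LSeries.notation in
theorem similarCount_eq_convolution :
    ∀ {n : ℕ}, n ≠ 0 → (similarCount squareLattice n : ℂ) = ((fun n => chiNegFour n) ⍟ 1) n := by
  intro n hn
  rw [similarCount_eq_ncard, ncard_simSet hn, ← rootCount_convolution, LSeries.convolution_def]
  refine Finset.sum_congr rfl fun x hx => ?_
  rw [ncard_primSet (Nat.ne_zero_of_mem_divisorsAntidiagonal hx).1]

theorem hasSum_similarCount {s : ℂ} (hs : 1 < s.re) :
    LSeriesHasSum (fun n => (similarCount squareLattice n : ℂ)) s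
      (riemannZeta s * chiNegFour.LFunction s) := by
  rw [LSeriesHasSum_congr s _ similarCount_eq_convolution, mul_comm,
    DirichletCharacter.LFunction_eq_LSeries _ hs]
  exact (DirichletCharacter.LSeriesSummable_of_one_lt_re chiNegFour hs).LSeriesHasSum.convolution
    (LSeriesHasSum_one hs)

theorem primitiveSimilarCount_eq_rootCount {n : ℕ} (hn : n ≠ 0) :
    primitiveSimilarCount squareLattice n = rootCount n := by
  rw [primitiveSimilarCount_eq_ncard, ncard_primSet hn]

theorem primitiveSimilarCount_le (n : ℕ) :
    primitiveSimilarCount squareLattice n ≤ similarCount squareLattice n := by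
  rw [primitiveSimilarCount_eq_ncard, similarCount_eq_ncard]
  exact Set.ncard_le_ncard (fun z hz => ⟨hz.1, hz.2.2⟩) (simSet_finite n)

theorem summable_of_natCast_le {f g : ℕ → ℕ} (h : ∀ n, f n ≤ g n) {s : ℂ}
    (hg : LSeriesSummable (fun n => (g n : ℂ)) s) : LSeriesSummable (fun n => (f n : ℂ)) s := by
  refine hg.norm.of_norm_bounded_eventually_nat (.of_forall fun n => ?_)
  apply LSeries.norm_term_le
  simpa using h n

theorem hasSum_primitiveSimilarCount {s : ℂ} (hs : 1 < s.re) :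
    LSeriesHasSum (fun n => (primitiveSimilarCount squareLattice n : ℂ)) s
      (riemannZeta s * chiNegFour.LFunction s / riemannZeta (2 * s)) := by
  have h2s : 1 < (2 * s).re := by simp; linarith
  have hsum := summable_of_natCast_le primitiveSimilarCount_le (hasSum_similarCount hs).LSeriesSummable
  have h1 := hsum.LSeriesHasSum.convolution (hasSum_squareIndicator (by linarith))
  have h2 : LSeriesHasSum (fun n => (similarCount squareLattice n : ℂ)) s
      (LSeries (fun n => (primitiveSimilarCount squareLattice n : ℂ)) s * riemannZeta (2 * s)) := by
    rw [LSeriesHasSum_congr s _ similarCount_eq_convolution, ← rootCount_convolution]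
    rw [LSeries.convolution_congr (f' := fun n => (rootCount n : ℂ)) (g' := squareIndicator)] at h1
    · exact h1
    · intro n hn
      rw [primitiveSimilarCount_eq_rootCount hn]
    · intro n hn; rfl
  have h3 := h2.unique (hasSum_similarCount hs)
  rw [← h3, mul_div_cancel_right₀ _ (riemannZeta_ne_zero_of_one_lt_re h2s)]
  exact hsum.LSeriesHasSum

theorem PhiSquare_eq {s : ℂ} (hs : 1 < s.re) :
    PhiSquare s = riemannZeta s * chiNegFour.LFunction s := (hasSum_similarCount hs).LSeries_eq

theorem PhiSquarePr_eq {s : ℂ} (hs : 1 < s.re) :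
    PhiSquarePr s = riemannZeta s * chiNegFour.LFunction s / riemannZeta (2 * s) :=
  (hasSum_primitiveSimilarCount hs).LSeries_eq

/-- The Dirichlet series of a sequence spread over the even numbers. -/
theorem LSeriesHasSum.spread_two {f : ℕ → ℂ} {s S : ℂ} (h : LSeriesHasSum f s S) :
    LSeriesHasSum (fun n => if 2 ∣ n then f (n / 2) else 0) s (2 ^ (-s) * S) := by
  rw [LSeriesHasSum] at h ⊢
  have hinj : Function.Injective (fun n : ℕ => 2 * n) := fun a b h => by simpa using h
  rw [← hinj.hasSum_iff]
  · refine (h.mul_left ((2 : ℂ) ^ (-s))).congr_fun fun n => ?_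
    rcases Nat.eq_zero_or_pos n with rfl | hn
    · simp
    · have hn0 : n ≠ 0 := hn.ne'
      rw [Function.comp_apply, LSeries.term_of_ne_zero (mul_ne_zero two_ne_zero hn0),
        LSeries.term_of_ne_zero hn0, if_pos (dvd_mul_right _ _), Nat.mul_div_cancel_left _ two_pos,
        Nat.cast_mul, Complex.natCast_mul_natCast_cpow, Complex.cpow_neg, Nat.cast_ofNat]
      field_simp
  · intro x hx
    rcases Nat.eq_zero_or_pos x with rfl | hx0
    · simp
    · rw [LSeries.term_of_ne_zero hx0.ne', if_neg, zero_div]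
      rintro ⟨c, rfl⟩
      exact hx ⟨c, rfl⟩

theorem primitiveSimilarCount_zero : primitiveSimilarCount squareLattice 0 = 0 := by
  rw [primitiveSimilarCount_eq_ncard]
  convert Set.ncard_empty GaussianInt
  rw [Set.eq_empty_iff_forall_notMem]
  intro z hz
  exact hz.1.ne_zero (GaussianInt.norm_eq_zero.1 (by simpa using hz.2.2))

theorem primitiveSimilarCount_two_mul (n : ℕ) :
    primitiveSimilarCount squareLattice (2 * n) =
      if Odd n then primitiveSimilarCount squareLattice n else 0 := by
  rcases eq_or_ne n 0 with rfl | hn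
  · simp [primitiveSimilarCount_zero]
  rw [primitiveSimilarCount_eq_rootCount hn, primitiveSimilarCount_eq_rootCount (by omega)]
  split_ifs with h
  · exact rootCount_two_mul_of_odd h
  · exact rootCount_two_mul_of_even (Nat.not_odd_iff_even.1 h)

/-- Primitive norms are not divisible by 4, and an odd n has as many primitive representations as
2n; so exactly one summand can be non-zero. In terms of series, Φᵖʳ is 1 + 2⁻ˢ times the series of n
↦ b(2n). -/
theorem primitiveSimilarCount_eq_add (n : ℕ) :
    primitiveSimilarCount squareLattice n = primitiveSimilarCount squareLattice (2 * n) +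
      if 2 ∣ n then primitiveSimilarCount squareLattice (2 * (n / 2)) else 0 := by
  rw [primitiveSimilarCount_two_mul]
  split_ifs with h1 h2 h2
  · exact absurd (even_iff_two_dvd.2 h2) (Nat.not_even_iff_odd.2 h1)
  · simp
  · rw [Nat.mul_div_cancel' h2]; simp
  · exact absurd (Nat.not_odd_iff_even.1 h1).two_dvd h2

theorem one_add_two_cpow_neg_ne_zero {s : ℂ} (hs : 0 < s.re) : (1 : ℂ) + 2 ^ (-s) ≠ 0 := by
  intro h
  have h1 : ‖(2 : ℂ) ^ (-s)‖ = 1 := by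
    rw [eq_neg_of_add_eq_zero_right h]; simp
  have h2 : ‖(2 : ℂ) ^ (-s)‖ < 1 := by
    rw [← Nat.cast_ofNat, Complex.norm_natCast_cpow_of_pos two_pos]
    exact Real.rpow_lt_one_of_one_lt_of_neg (by norm_num) (by simpa using hs)
  linarith

/-- The Dirichlet series of `n ↦ b(2n)`, `b` counting the primitive similar sublattices. -/
theorem hasSum_primitiveSimilarCount_two_mul {s : ℂ} (hs : 1 < s.re) :
    LSeriesHasSum (fun n => (primitiveSimilarCount squareLattice (2 * n) : ℂ)) s
      (PhiSquarePr s / (1 + 2 ^ (-s))) := by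
  have hle : ∀ n, primitiveSimilarCount squareLattice (2 * n) ≤
      primitiveSimilarCount squareLattice n := by
    intro n
    rw [primitiveSimilarCount_two_mul]
    split_ifs <;> simp
  have hsum := summable_of_natCast_le hle (hasSum_primitiveSimilarCount hs).LSeriesSummable
  set S := LSeries (fun n => (primitiveSimilarCount squareLattice (2 * n) : ℂ)) s with hS
  have h1 := hsum.LSeriesHasSum.add hsum.LSeriesHasSum.spread_two
  have h2 : LSeriesHasSum (fun n => (primitiveSimilarCount squareLattice n : ℂ)) s
      (S + 2 ^ (-s) * S) := by
    convert h1 using 1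
    ext n
    rw [primitiveSimilarCount_eq_add n]
    push_cast
    rfl
  rw [PhiSquarePr, h2.LSeries_eq,
    show S + 2 ^ (-s) * S = S * (1 + 2 ^ (-s)) by ring,
    mul_div_cancel_right₀ _ (one_add_two_cpow_neg_ne_zero (by linarith))]
  exact hsum.LSeriesHasSum

/-! ### Comparison of sums with integrals. -/

/-- The range runs over 1 ≤ j < Y with strict upper bound, since j < ⌈Y⌉ means j < Y; each F(j) is
at most the integral over [j − 1, j]. -/
theorem sum_Ico_ceil_le_integral {F : ℝ → ℝ} (hF : AntitoneOn F (Set.Ici 0))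
    (h0 : ∀ t, 0 ≤ t → 0 ≤ F t) {Y : ℝ} (hY : 0 < Y) :
    ∑ j ∈ Finset.Ico 1 ⌈Y⌉₊, F j ≤ ∫ t in (0 : ℝ)..Y, F t := by
  obtain ⟨N, hN⟩ : ∃ N, ⌈Y⌉₊ = N + 1 := Nat.exists_eq_succ_of_ne_zero (Nat.ceil_pos.2 hY).ne'
  have hNY : (N : ℝ) ≤ Y := (Nat.lt_ceil.1 (by omega)).le
  have hint : ∀ a b : ℝ, 0 ≤ a → 0 ≤ b → IntervalIntegrable F MeasureTheory.volume a b := by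
    intro a b ha hb
    apply AntitoneOn.intervalIntegrable
    exact hF.mono fun x hx => (le_min ha hb).trans hx.1
  have h1 := AntitoneOn.sum_le_integral (f := F) (x₀ := 0) (a := N)
    (hF.mono fun x hx => hx.1)
  rw [hN, Finset.sum_Ico_eq_sum_range]
  simp only [zero_add, Nat.add_sub_cancel] at h1 ⊢
  simp only [add_comm 1]
  refine h1.trans ?_
  rw [← intervalIntegral.integral_add_adjacent_intervals (hint 0 N le_rfl (by positivity))
    (hint N Y (by positivity) hY.le)]
  have : 0 ≤ ∫ t in (N : ℝ)..Y, F t :=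
    intervalIntegral.integral_nonneg hNY fun t ht => h0 t ((Nat.cast_nonneg N).trans ht.1)
  linarith

theorem integral_le_sum_Ico_ceil {F : ℝ → ℝ} (hF : AntitoneOn F (Set.Ici 0))
    (h0 : ∀ t, 0 ≤ t → 0 ≤ F t) {Y : ℝ} (hY : 0 < Y) :
    (∫ t in (0 : ℝ)..Y, F t) - F 0 ≤ ∑ j ∈ Finset.Ico 1 ⌈Y⌉₊, F j := by
  have hNY : Y ≤ (⌈Y⌉₊ : ℝ) := Nat.le_ceil Y
  have hint : ∀ a b : ℝ, 0 ≤ a → 0 ≤ b → IntervalIntegrable F MeasureTheory.volume a b := by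
    intro a b ha hb
    apply AntitoneOn.intervalIntegrable
    exact hF.mono fun x hx => (le_min ha hb).trans hx.1
  have h1 := AntitoneOn.integral_le_sum (f := F) (x₀ := 0) (a := ⌈Y⌉₊)
    (hF.mono fun x hx => hx.1)
  have h2 := intervalIntegral.integral_add_adjacent_intervals (hint 0 Y le_rfl hY.le)
    (hint Y ⌈Y⌉₊ hY.le (by positivity))
  have : 0 ≤ ∫ t in Y..(⌈Y⌉₊ : ℝ), F t :=
    intervalIntegral.integral_nonneg hNY fun t ht => h0 t (hY.le.trans ht.1)
  rw [Finset.range_eq_Ico, Finset.sum_eq_sum_Ico_succ_bot (Nat.ceil_pos.2 hY)] at h1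
  simp only [zero_add, Nat.cast_zero] at h1
  linarith

/-- On each full unit block the Lipschitz constant K bounds the difference; the last, incomplete
block has length at most 1 and costs at most M. -/
theorem norm_sum_Ico_ceil_sub_integral_le {F F' : ℝ → ℂ} {K M : ℝ}
    (hF : ∀ t, 0 ≤ t → HasDerivAt F (F' t) t) (hK : ∀ t, 0 ≤ t → ‖F' t‖ ≤ K)
    (hM : ∀ t, 0 ≤ t → ‖F t‖ ≤ M) {Y : ℝ} (hY : 0 < Y) :
    ‖∑ j ∈ Finset.Ico 1 ⌈Y⌉₊, F j - ∫ t in (0 : ℝ)..Y, F t‖ ≤ K * Y + M := by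
  obtain ⟨N, hN⟩ : ∃ N, ⌈Y⌉₊ = N + 1 := Nat.exists_eq_succ_of_ne_zero (Nat.ceil_pos.2 hY).ne'
  have hNY : (N : ℝ) ≤ Y := (Nat.lt_ceil.1 (by omega)).le
  have hYN : Y ≤ N + 1 := by
    have := Nat.le_ceil Y
    rw [hN] at this
    exact_mod_cast this
  have hK0 : 0 ≤ K := (norm_nonneg _).trans (hK 0 le_rfl)
  have hM0 : 0 ≤ M := (norm_nonneg _).trans (hM 0 le_rfl)
  have hcont : ContinuousOn F (Set.Ici 0) := fun t ht => (hF t ht).continuousAt.continuousWithinAt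
  have hint : ∀ a b : ℝ, 0 ≤ a → 0 ≤ b → IntervalIntegrable F MeasureTheory.volume a b := by
    intro a b ha hb
    exact (hcont.mono fun x hx => (le_min ha hb).trans hx.1).intervalIntegrable
  have hlip : ∀ x y : ℝ, 0 ≤ x → x ≤ y → ‖F y - F x‖ ≤ K * (y - x) := by
    intro x y hx hxy
    have := (convex_Ici (0 : ℝ)).norm_image_sub_le_of_norm_hasDerivWithin_le (f := F) (f' := F')
      (C := K) (fun t ht => (hF t ht).hasDerivWithinAt) (fun t ht => hK t ht) hx
      (hx.trans hxy : (0 : ℝ) ≤ y)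
    rwa [Real.norm_of_nonneg (by linarith)] at this
  have hblock : ∀ j ∈ Finset.range N, ‖F ((j + 1 : ℕ) : ℝ) - ∫ t in (j : ℝ)..((j + 1 : ℕ) : ℝ), F t‖ ≤ K := by
    intro j _
    have e : F ((j + 1 : ℕ) : ℝ) - ∫ t in (j : ℝ)..((j + 1 : ℕ) : ℝ), F t =
        ∫ t in (j : ℝ)..((j + 1 : ℕ) : ℝ), (F ((j + 1 : ℕ) : ℝ) - F t) := by
      rw [intervalIntegral.integral_sub (by simp) (hint _ _ (by positivity) (by positivity))]
      simp
    rw [e]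
    have := intervalIntegral.norm_integral_le_of_norm_le_const (a := (j : ℝ)) (b := ((j + 1 : ℕ) : ℝ))
      (C := K) (f := fun t => F ((j + 1 : ℕ) : ℝ) - F t) (by
        intro t ht
        rw [Set.uIoc_of_le (by simp)] at ht
        have ht0 : 0 ≤ t := (Nat.cast_nonneg j).trans ht.1.le
        refine (hlip t _ ht0 ht.2).trans ?_
        have h1 := ht.1
        push_cast
        nlinarith)
    simpa using this
  have hsplit : ∑ j ∈ Finset.Ico 1 ⌈Y⌉₊, F j - ∫ t in (0 : ℝ)..Y, F t =
      ∑ j ∈ Finset.range N, (F ((j + 1 : ℕ) : ℝ) - ∫ t in (j : ℝ)..((j + 1 : ℕ) : ℝ), F t) -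
        ∫ t in (N : ℝ)..Y, F t := by
    have h2 := intervalIntegral.sum_integral_adjacent_intervals (f := F)
      (μ := MeasureTheory.volume) (a := fun k : ℕ => (k : ℝ)) (n := N)
      (fun k _ => hint _ _ (by positivity) (by positivity))
    have h3 := intervalIntegral.integral_add_adjacent_intervals
      (hint 0 N le_rfl (by positivity)) (hint N Y (by positivity) hY.le)
    rw [Finset.sum_sub_distrib, h2, ← h3, hN, Finset.sum_Ico_eq_sum_range]
    simp only [Nat.add_sub_cancel, add_comm 1, Nat.cast_zero]
    ring
  have hlast : ‖∫ t in (N : ℝ)..Y, F t‖ ≤ M := by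
    have := intervalIntegral.norm_integral_le_of_norm_le_const (a := (N : ℝ)) (b := Y)
      (C := M) (f := F) (by
        intro t ht
        rw [Set.uIoc_of_le hNY] at ht
        exact hM t ((Nat.cast_nonneg N).trans ht.1.le))
    rw [abs_of_nonneg (by linarith)] at this
    nlinarith
  rw [hsplit]
  calc _ ≤ ‖∑ j ∈ Finset.range N, (F ((j + 1 : ℕ) : ℝ) - ∫ t in (j : ℝ)..((j + 1 : ℕ) : ℝ), F t)‖ +
        ‖∫ t in (N : ℝ)..Y, F t‖ := norm_sub_le _ _
    _ ≤ N * K + M := by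
        refine add_le_add ((norm_sum_le_of_le _ hblock).trans ?_) hlast
        simp
    _ ≤ K * Y + M := by nlinarith

/-! ### The integral over [1, √3] and the inner sums it approximates. -/

/-- The entire function `∫₁^{√3} x⁻ˢ dx`. -/
noncomputable def sqrtThreeIntegral (s : ℂ) : ℂ :=
  dslope (fun w : ℂ => Complex.exp (w * Real.log √3)) 0 (1 - s)

theorem sqrtThreeIntegral_differentiable : Differentiable ℂ sqrtThreeIntegral := by
  have h : Differentiable ℂ (dslope (fun w : ℂ => Complex.exp (w * Real.log √3)) 0) := by
    rw [← differentiableOn_univ, Complex.differentiableOn_dslope univ_mem]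
    fun_prop
  exact h.comp (by fun_prop)

theorem sqrtThreeIntegral_one : sqrtThreeIntegral 1 = Real.log √3 := by
  rw [sqrtThreeIntegral, sub_self, dslope_same]
  have : HasDerivAt (fun w : ℂ => Complex.exp (w * Real.log √3))
      (Complex.exp (0 * Real.log √3) * (1 * Real.log √3)) 0 :=
    ((hasDerivAt_id (0 : ℂ)).mul_const _).cexp
  rw [this.deriv]
  simp

theorem sqrtThreeIntegral_of_ne {s : ℂ} (hs : s ≠ 1) :
    sqrtThreeIntegral s = (1 - ((√3 : ℝ) : ℂ) ^ (1 - s)) / (s - 1) := by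
  have h1 : (1 : ℂ) - s ≠ 0 := sub_ne_zero.2 hs.symm
  have h2 : s - 1 ≠ 0 := sub_ne_zero.2 hs
  have h3 : (√3 : ℝ) ≠ 0 := by positivity
  rw [sqrtThreeIntegral, dslope_of_ne _ h1, slope_def_field, Complex.cpow_def_of_ne_zero
    (by exact_mod_cast h3), Complex.ofReal_log (by positivity)]
  simp only [zero_mul, Complex.exp_zero, sub_zero]
  rw [div_eq_div_iff h1 h2, mul_comm (Complex.log _)]
  ring

theorem one_lt_sqrt_three : (1 : ℝ) < √3 := by
  rw [Real.lt_sqrt (by norm_num)]; norm_num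

theorem sqrt_three_lt_two : √3 < 2 := by
  rw [Real.sqrt_lt' (by norm_num)]; norm_num

theorem integral_one_sqrt_three (s : ℂ) :
    ∫ x in (1 : ℝ)..√3, (x : ℂ) ^ (-s) = sqrtThreeIntegral s := by
  have h0 : (0 : ℝ) ∉ Set.uIcc 1 √3 := by
    rw [Set.uIcc_of_le one_lt_sqrt_three.le]
    rintro ⟨h, -⟩
    linarith
  by_cases hs : s = 1
  · subst hs
    rw [sqrtThreeIntegral_one]
    have : ∀ x : ℝ, (x : ℂ) ^ (-1 : ℂ) = ((x⁻¹ : ℝ) : ℂ) := by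
      intro x
      rw [Complex.cpow_neg_one, Complex.ofReal_inv]
    simp only [this]
    rw [intervalIntegral.integral_ofReal, integral_inv h0, div_one]
  · rw [sqrtThreeIntegral_of_ne hs, integral_cpow (Or.inr ⟨fun h => hs (by linear_combination -h), h0⟩)]
    have h2 : s - 1 ≠ 0 := sub_ne_zero.2 hs
    have h3 : -s + 1 ≠ 0 := fun h => hs (by linear_combination -h)
    rw [Complex.ofReal_one, Complex.one_cpow, div_eq_div_iff h3 h2, show -s + 1 = 1 - s by ring]
    ring

/-- The real version of `sqrtThreeIntegral`. -/
noncomputable def sqrtThreeIntegralReal (s : ℝ) : ℝ := ∫ x in (1 : ℝ)..√3, x ^ (-s)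

theorem sqrtThreeIntegral_ofReal (s : ℝ) :
    sqrtThreeIntegral s = (sqrtThreeIntegralReal s : ℂ) := by
  rw [← integral_one_sqrt_three, sqrtThreeIntegralReal, ← intervalIntegral.integral_ofReal]
  apply intervalIntegral.integral_congr
  intro x hx
  rw [Set.uIcc_of_le one_lt_sqrt_three.le] at hx
  simp only
  rw [Complex.ofReal_cpow (by linarith [hx.1]), Complex.ofReal_neg]

theorem sqrtThreeIntegralReal_one : sqrtThreeIntegralReal 1 = Real.log √3 := by
  have := sqrtThreeIntegral_ofReal 1
  rw [Complex.ofReal_one, sqrtThreeIntegral_one] at this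
  exact_mod_cast this.symm

theorem continuousOn_rpow_neg (s : ℝ) : ContinuousOn (fun x : ℝ => x ^ (-s)) (Set.Icc 1 √3) :=
  fun x hx => (Real.continuousAt_rpow_const _ _
    (Or.inl (by linarith [hx.1] : (0 : ℝ) < x).ne')).continuousWithinAt

theorem sqrtThreeIntegralReal_pos (s : ℝ) : 0 < sqrtThreeIntegralReal s :=
  intervalIntegral.intervalIntegral_pos_of_pos_on
    ((continuousOn_rpow_neg s).intervalIntegrable_of_Icc one_lt_sqrt_three.le)
    (fun x hx => Real.rpow_pos_of_pos (by linarith [hx.1]) _) one_lt_sqrt_three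

theorem sqrtThreeIntegralReal_lt_one {s : ℝ} (hs : 0 ≤ s) : sqrtThreeIntegralReal s < 1 := by
  have h : sqrtThreeIntegralReal s ≤ ∫ _ in (1 : ℝ)..√3, (1 : ℝ) :=
    intervalIntegral.integral_mono_on one_lt_sqrt_three.le
      ((continuousOn_rpow_neg s).intervalIntegrable_of_Icc one_lt_sqrt_three.le) (by simp)
      fun x hx => Real.rpow_le_one_of_one_le_of_nonpos hx.1 (by linarith)
  simp at h
  linarith [sqrt_three_lt_two]

/-- The sum of `(m + δ j)⁻ˢ` over `j ≥ 1` with `m + δ j < √3 m`. -/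
noncomputable def stepSum (δ m : ℕ) (s : ℂ) : ℂ :=
  ∑ j ∈ Finset.Ico 1 ⌈(√3 - 1) * m / δ⌉₊, ((m + δ * j : ℕ) : ℂ) ^ (-s)

/-- The real version of `stepSum`. -/
noncomputable def stepSumReal (δ m : ℕ) (s : ℝ) : ℝ :=
  ∑ j ∈ Finset.Ico 1 ⌈(√3 - 1) * m / δ⌉₊, ((m + δ * j : ℕ) : ℝ) ^ (-s)

theorem stepSum_ofReal (δ m : ℕ) (s : ℝ) : stepSum δ m s = (stepSumReal δ m s : ℂ) := by
  rw [stepSum, stepSumReal, Complex.ofReal_sum]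
  refine Finset.sum_congr rfl fun j _ => ?_
  rw [Complex.ofReal_cpow (by positivity)]
  simp

/-- Substituting x = 1 + δt/m scales the range to [1, √3], independently of m and δ. -/
theorem integral_step {δ m : ℕ} (hδ : 0 < δ) (hm : 0 < m) (s : ℂ) :
    δ * ∫ t in (0 : ℝ)..(√3 - 1) * m / δ, ((m + δ * t : ℝ) : ℂ) ^ (-s) =
      (m : ℂ) ^ (-s) * m * sqrtThreeIntegral s := by
  have hδ' : (0 : ℝ) < δ := by exact_mod_cast hδ
  have hm' : (0 : ℝ) < m := by exact_mod_cast hm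
  have hδc : (δ : ℂ) ≠ 0 := by exact_mod_cast hδ.ne'
  have h3 := one_lt_sqrt_three
  have hc : (δ / m : ℝ) ≠ 0 := by positivity
  have e : ∀ t ∈ Set.uIcc 0 ((√3 - 1) * m / δ), ((m + δ * t : ℝ) : ℂ) ^ (-s) =
      (m : ℂ) ^ (-s) * (((1 + δ / m * t : ℝ) : ℂ) ^ (-s)) := by
    intro t ht
    rw [Set.uIcc_of_le (div_nonneg (mul_nonneg (by linarith) hm'.le) hδ'.le)] at ht
    have ht0 := ht.1
    rw [← Complex.ofReal_natCast, ← Complex.mul_cpow_ofReal_nonneg hm'.le (by positivity),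
      ← Complex.ofReal_mul]
    congr 2
    field_simp
  rw [intervalIntegral.integral_congr e, intervalIntegral.integral_const_mul,
    intervalIntegral.integral_comp_add_mul (fun x : ℝ => (x : ℂ) ^ (-s)) hc]
  have e1 : 1 + (δ / m : ℝ) * 0 = 1 := by ring
  have e2 : 1 + (δ / m : ℝ) * ((√3 - 1) * m / δ) = √3 := by field_simp; ring
  rw [e1, e2, integral_one_sqrt_three, Complex.real_smul]
  push_cast
  field_simp

theorem integral_step_real {δ m : ℕ} (hδ : 0 < δ) (hm : 0 < m) (s : ℝ) :
    δ * ∫ t in (0 : ℝ)..(√3 - 1) * m / δ, (m + δ * t : ℝ) ^ (-s) =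
      (m : ℝ) ^ (-s) * m * sqrtThreeIntegralReal s := by
  have h3 := one_lt_sqrt_three
  have hY : 0 ≤ (√3 - 1) * m / δ :=
    div_nonneg (mul_nonneg (by linarith) (Nat.cast_nonneg _)) (Nat.cast_nonneg _)
  have h := integral_step hδ hm (s : ℂ)
  have e : ∫ t in (0 : ℝ)..(√3 - 1) * m / δ, ((m + δ * t : ℝ) : ℂ) ^ (-(s : ℂ)) =
      ((∫ t in (0 : ℝ)..(√3 - 1) * m / δ, (m + δ * t : ℝ) ^ (-s) : ℝ) : ℂ) := by
    rw [← intervalIntegral.integral_ofReal]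
    apply intervalIntegral.integral_congr
    intro x hx
    rw [Set.uIcc_of_le hY] at hx
    have := hx.1
    simp only
    rw [Complex.ofReal_cpow (by positivity), Complex.ofReal_neg]
  have e2 : (m : ℂ) ^ (-(s : ℂ)) = (((m : ℝ) ^ (-s) : ℝ) : ℂ) := by
    rw [Complex.ofReal_cpow (by positivity)]; simp
  rw [e, e2, sqrtThreeIntegral_ofReal] at h
  exact_mod_cast h

theorem antitoneOn_step {δ m : ℕ} (hm : 0 < m) {s : ℝ} (hs : 0 ≤ s) :
    AntitoneOn (fun t : ℝ => (m + δ * t : ℝ) ^ (-s)) (Set.Ici 0) := by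
  have hm' : (0 : ℝ) < m := by exact_mod_cast hm
  intro x hx y hy hxy
  have hx' : (0 : ℝ) ≤ x := hx
  apply Real.rpow_le_rpow_of_nonpos (by positivity) _ (by linarith)
  gcongr

theorem stepSumReal_le {δ m : ℕ} (hδ : 0 < δ) (hm : 0 < m) {s : ℝ} (hs : 0 ≤ s) :
    δ * stepSumReal δ m s ≤ (m : ℝ) ^ (-s) * m * sqrtThreeIntegralReal s := by
  have hδ' : (0 : ℝ) < δ := by exact_mod_cast hδ
  have hm' : (0 : ℝ) < m := by exact_mod_cast hm
  have h3 := one_lt_sqrt_three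
  have h := sum_Ico_ceil_le_integral (antitoneOn_step (δ := δ) hm hs) (fun t ht => by positivity)
    (Y := (√3 - 1) * m / δ) (div_pos (mul_pos (by linarith) hm') hδ')
  rw [← integral_step_real hδ hm, stepSumReal]
  push_cast
  exact mul_le_mul_of_nonneg_left h hδ'.le

theorem le_stepSumReal {δ m : ℕ} (hδ : 0 < δ) (hm : 0 < m) {s : ℝ} (hs : 0 ≤ s) :
    (m : ℝ) ^ (-s) * m * sqrtThreeIntegralReal s - δ * (m : ℝ) ^ (-s) ≤ δ * stepSumReal δ m s := by
  have hδ' : (0 : ℝ) < δ := by exact_mod_cast hδ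
  have hm' : (0 : ℝ) < m := by exact_mod_cast hm
  have h3 := one_lt_sqrt_three
  have h := integral_le_sum_Ico_ceil (antitoneOn_step (δ := δ) hm hs) (fun t ht => by positivity)
    (Y := (√3 - 1) * m / δ) (div_pos (mul_pos (by linarith) hm') hδ')
  rw [← integral_step_real hδ hm, stepSumReal, ← mul_sub]
  push_cast
  refine mul_le_mul_of_nonneg_left ?_ hδ'.le
  simpa using h

/-- The derivative is at most δ|s|m^(−Re s − 1) over a range of length (√3 − 1)m/δ. The error is
thus smaller than the main term by a factor of order m, which is what moves convergence to Re s >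
1/2. -/
theorem norm_stepSum_sub_le {δ m : ℕ} (hδ : 0 < δ) (hm : 0 < m) {s : ℂ} (hs : 0 ≤ s.re) :
    ‖δ * stepSum δ m s - (m : ℂ) ^ (-s) * m * sqrtThreeIntegral s‖ ≤
      δ * (‖s‖ + 1) * (m : ℝ) ^ (-s.re) := by
  have hδ' : (0 : ℝ) < δ := by exact_mod_cast hδ
  have hm' : (0 : ℝ) < m := by exact_mod_cast hm
  have h3 := one_lt_sqrt_three
  have hY : 0 < (√3 - 1) * m / δ := div_pos (mul_pos (by linarith) hm') hδ'
  have hmt : ∀ t : ℝ, 0 ≤ t → (m : ℝ) ≤ m + δ * t := fun t ht => by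
    have := mul_nonneg hδ'.le ht
    linarith
  have h := norm_sum_Ico_ceil_sub_integral_le
    (F := fun t : ℝ => ((m + δ * t : ℝ) : ℂ) ^ (-s))
    (F' := fun t : ℝ => (-s * ((m + δ * t : ℝ) : ℂ) ^ (-s - 1)) * δ)
    (K := ‖s‖ * (m : ℝ) ^ (-s.re - 1) * δ) (M := (m : ℝ) ^ (-s.re)) ?_ ?_ ?_ hY
  · have e : ∑ j ∈ Finset.Ico 1 ⌈(√3 - 1) * m / δ⌉₊, ((m + δ * (j : ℝ) : ℝ) : ℂ) ^ (-s) =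
        stepSum δ m s := by
      rw [stepSum]
      refine Finset.sum_congr rfl fun j _ => ?_
      push_cast; rfl
    rw [e] at h
    rw [← integral_step hδ hm, ← mul_sub, norm_mul, Complex.norm_natCast, mul_assoc]
    refine mul_le_mul_of_nonneg_left (h.trans ?_) hδ'.le
    have e2 : (m : ℝ) ^ (-s.re - 1) * m = (m : ℝ) ^ (-s.re) := by
      rw [Real.rpow_sub_one hm'.ne']
      field_simp
    have e3 : ‖s‖ * (m : ℝ) ^ (-s.re - 1) * δ * ((√3 - 1) * m / δ) =
        ‖s‖ * (m : ℝ) ^ (-s.re) * (√3 - 1) := by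
      rw [← e2]; field_simp
    rw [e3]
    have h4 : 0 ≤ ‖s‖ * (m : ℝ) ^ (-s.re) := by positivity
    nlinarith [sqrt_three_lt_two]
  · intro t ht
    have hpos := hm'.trans_le (hmt t ht)
    have h1 : HasDerivAt (fun z : ℂ => (m + δ * z : ℂ)) (δ : ℂ) (t : ℂ) := by
      simpa using ((hasDerivAt_id (t : ℂ)).const_mul (δ : ℂ)).const_add (m : ℂ)
    have h2 := (h1.cpow_const (c := -s) (Or.inl (by simpa using hpos))).comp_ofReal
    simpa using h2
  · intro t ht
    have hpos := hm'.trans_le (hmt t ht)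
    rw [norm_mul, norm_mul, norm_neg, Complex.norm_natCast,
      Complex.norm_cpow_eq_rpow_re_of_pos hpos]
    gcongr
    simp only [Complex.sub_re, Complex.neg_re, Complex.one_re]
    exact Real.rpow_le_rpow_of_nonpos hm' (hmt t ht) (by linarith)
  · intro t ht
    have hpos := hm'.trans_le (hmt t ht)
    rw [Complex.norm_cpow_eq_rpow_re_of_pos hpos, Complex.neg_re]
    exact Real.rpow_le_rpow_of_nonpos hm' (hmt t ht) (by linarith)

theorem evenTerm_eq (s : ℂ) (p : ℕ) : evenTerm s p = (p : ℂ) ^ (-s) * stepSum 1 p s := by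
  rw [evenTerm, stepSum, Finset.mul_sum]
  refine Finset.sum_nbij' (fun q => q - p) (fun j => p + j) ?_ ?_ ?_ ?_ ?_
  · intro q hq
    rw [Finset.mem_Ioo, Nat.lt_ceil] at hq
    rw [Finset.mem_Ico, Nat.lt_ceil, Nat.cast_sub hq.1.le]
    exact ⟨by omega, by push_cast; linarith [hq.2]⟩
  · intro j hj
    rw [Finset.mem_Ico, Nat.lt_ceil] at hj
    rw [Finset.mem_Ioo, Nat.lt_ceil]
    have := hj.2
    push_cast at this ⊢
    exact ⟨by omega, by linarith⟩
  · intro q hq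
    rw [Finset.mem_Ioo] at hq
    omega
  · intro j hj
    omega
  · intro q hq
    rw [Finset.mem_Ioo] at hq
    rw [one_mul, Nat.add_sub_cancel' hq.1.le, Complex.cpow_neg, Complex.cpow_neg, one_div, mul_inv]

/-- With ℓ = k + j one has 2ℓ + 1 = m + 2j for m = 2k + 1, and the odd-looking upper bound for ℓ is
just 2ℓ + 1 < √3 m. -/
theorem oddTerm_eq (s : ℂ) (k : ℕ) :
    oddTerm s k = ((2 * k + 1 : ℕ) : ℂ) ^ (-s) * stepSum 2 (2 * k + 1) s := by
  rw [oddTerm, stepSum, Finset.mul_sum]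
  refine Finset.sum_nbij' (fun q => q - k) (fun j => k + j) ?_ ?_ ?_ ?_ ?_
  · intro q hq
    rw [Finset.mem_Ioo, Nat.lt_ceil] at hq
    rw [Finset.mem_Ico, Nat.lt_ceil, Nat.cast_sub hq.1.le]
    exact ⟨by omega, by push_cast; linarith [hq.2]⟩
  · intro j hj
    rw [Finset.mem_Ico, Nat.lt_ceil] at hj
    rw [Finset.mem_Ioo, Nat.lt_ceil]
    have := hj.2
    push_cast at this ⊢
    exact ⟨by omega, by linarith⟩
  · intro q hq
    rw [Finset.mem_Ioo] at hq
    omega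
  · intro j hj
    omega
  · intro q hq
    rw [Finset.mem_Ioo] at hq
    rw [show 2 * k + 1 + 2 * (q - k) = 2 * q + 1 by omega, Complex.cpow_neg, Complex.cpow_neg,
      one_div, mul_inv]
    push_cast
    rfl

/-! ### The double Dirichlet series of the ratio counts. -/

/-- Grouping an absolutely convergent sum over pairs by their product. -/
theorem LSeriesHasSum_of_hasSum_pairs {c : ℕ × ℕ → ℂ} {s S : ℂ}
    (h : HasSum (fun x : ℕ × ℕ => if x.1 * x.2 = 0 then 0 else c x / ((x.1 * x.2 : ℕ) : ℂ) ^ s) S) :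
    LSeriesHasSum (fun n => ∑ x ∈ n.divisorsAntidiagonal, c x) s S := by
  have h1 := h.tsum_fiberwise (fun x : ℕ × ℕ => x.1 * x.2)
  rw [LSeriesHasSum]
  refine h1.congr_fun fun n => ?_
  rcases eq_or_ne n 0 with rfl | hn
  · rw [LSeries.term_zero]
    symm
    convert tsum_zero using 2 with b
    ext b
    exact if_pos b.2
  · have hset : (fun x : ℕ × ℕ => x.1 * x.2) ⁻¹' {n} = (n.divisorsAntidiagonal : Set (ℕ × ℕ)) := by
      ext x
      simp [hn]
    rw [LSeries.term_of_ne_zero hn, hset,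
      Finset.tsum_subtype' n.divisorsAntidiagonal
        (fun x : ℕ × ℕ => if x.1 * x.2 = 0 then 0 else c x / ((x.1 * x.2 : ℕ) : ℂ) ^ s),
      Finset.sum_div]
    refine Finset.sum_congr rfl fun x hx => ?_
    rw [Nat.mem_divisorsAntidiagonal] at hx
    rw [if_neg (by rw [hx.1]; exact hn), hx.1]

/-- The weight of a pair in `ratioCount`. -/
noncomputable def ratioWeight (P : ℕ → Prop) (x : ℕ × ℕ) : ℂ := by
  classical exact if x.1 < x.2 ∧ x.2 ^ 2 < 3 * x.1 ^ 2 ∧ P x.1 ∧ P x.2 then 1 else 0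

/-- The term of a pair in the double Dirichlet series of `ratioCount`. -/
noncomputable def ratioTerm (P : ℕ → Prop) (s : ℂ) (x : ℕ × ℕ) : ℂ :=
  if x.1 * x.2 = 0 then 0 else ratioWeight P x / ((x.1 * x.2 : ℕ) : ℂ) ^ s

theorem mem_Ioo_ceil_sqrt_three {p q : ℕ} :
    q ∈ Finset.Ioo p ⌈√3 * (p : ℝ)⌉₊ ↔ p < q ∧ q ^ 2 < 3 * p ^ 2 := by
  rw [Finset.mem_Ioo, Nat.lt_ceil]
  refine and_congr_right fun _ => ?_
  have h1 : (√3 * (p : ℝ)) ^ 2 = 3 * p ^ 2 := by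
    rw [mul_pow, Real.sq_sqrt (by norm_num)]
  rw [← sq_lt_sq₀ (by positivity) (by positivity), h1]
  exact_mod_cast Iff.rfl

theorem ratioTerm_eq_zero {P : ℕ → Prop} {s : ℂ} {p q : ℕ}
    (h : q ∉ Finset.Ioo p ⌈√3 * (p : ℝ)⌉₊) : ratioTerm P s (p, q) = 0 := by
  rw [mem_Ioo_ceil_sqrt_three] at h
  rw [ratioTerm, ratioWeight, if_neg (c := _ ∧ _), zero_div, ite_self]
  exact fun h' => h ⟨h'.1, h'.2.1⟩

theorem tsum_ratioTerm_row (P : ℕ → Prop) (s : ℂ) (p : ℕ) :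
    ∑' q, ratioTerm P s (p, q) = ∑ q ∈ Finset.Ioo p ⌈√3 * (p : ℝ)⌉₊, ratioTerm P s (p, q) :=
  tsum_eq_sum fun _ hq => ratioTerm_eq_zero hq

theorem ratioTerm_of_mem {P : ℕ → Prop} {s : ℂ} {p q : ℕ}
    (h : q ∈ Finset.Ioo p ⌈√3 * (p : ℝ)⌉₊) (hp : P p) (hq : P q) :
    ratioTerm P s (p, q) = 1 / ((p : ℂ) ^ s * (q : ℂ) ^ s) := by
  rw [mem_Ioo_ceil_sqrt_three] at h
  have hp0 : p ≠ 0 := by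
    rintro rfl
    simp at h
  rw [ratioTerm, ratioWeight, if_neg (mul_ne_zero hp0 (by simp only; omega)),
    if_pos ⟨h.1, h.2, hp, hq⟩, Nat.cast_mul, Complex.natCast_mul_natCast_cpow]

theorem ratioTerm_of_not {P : ℕ → Prop} {s : ℂ} {p q : ℕ} (h : ¬ (P p ∧ P q)) :
    ratioTerm P s (p, q) = 0 := by
  rw [ratioTerm, ratioWeight, if_neg (c := _ ∧ _), zero_div, ite_self]
  exact fun h' => h h'.2.2

theorem norm_ratioTerm_le (P : ℕ → Prop) {s : ℂ} (hs : 0 ≤ s.re) (p q : ℕ) :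
    ‖ratioTerm P s (p, q)‖ ≤ (p : ℝ) ^ (-2 * s.re) := by
  by_cases h : q ∈ Finset.Ioo p ⌈√3 * (p : ℝ)⌉₊
  · by_cases hP : P p ∧ P q
    · rw [ratioTerm_of_mem h hP.1 hP.2]
      have h' := mem_Ioo_ceil_sqrt_three.1 h
      have hp0 : 0 < p := by
        rcases Nat.eq_zero_or_pos p with rfl | h0
        · simp at h'
        · exact h0
      have hp0' : (0 : ℝ) < p := by exact_mod_cast hp0
      rw [norm_div, norm_mul, Complex.norm_natCast_cpow_of_pos hp0,
        Complex.norm_natCast_cpow_of_pos (hp0.trans h'.1), norm_one,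
        show -2 * s.re = -(s.re + s.re) by ring, Real.rpow_neg hp0'.le, Real.rpow_add hp0', one_div]
      apply inv_anti₀ (by positivity)
      gcongr
      exact h'.1.le
    · rw [ratioTerm_of_not hP, norm_zero]
      positivity
  · rw [ratioTerm_eq_zero h, norm_zero]
    positivity

theorem card_Ioo_ceil_sqrt_three_le (p : ℕ) : (Finset.Ioo p ⌈√3 * (p : ℝ)⌉₊).card ≤ p := by
  have h : ⌈√3 * (p : ℝ)⌉₊ ≤ 2 * p := by
    apply Nat.ceil_le.2
    push_cast
    exact mul_le_mul_of_nonneg_right sqrt_three_lt_two.le (Nat.cast_nonneg _)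
  rw [Nat.card_Ioo]
  omega

/-- Row p has at most p non-zero terms, as √3 < 2, each bounded by p^(−2 Re s). -/
theorem summable_ratioTerm (P : ℕ → Prop) {s : ℂ} (hs : 1 < s.re) :
    Summable (ratioTerm P s) := by
  rw [← summable_norm_iff, summable_prod_of_nonneg (fun _ => norm_nonneg _)]
  have hrow : ∀ p, ∑' q, ‖ratioTerm P s (p, q)‖ =
      ∑ q ∈ Finset.Ioo p ⌈√3 * (p : ℝ)⌉₊, ‖ratioTerm P s (p, q)‖ := fun p =>
    tsum_eq_sum fun _ hq => by rw [ratioTerm_eq_zero hq, norm_zero]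
  constructor
  · intro p
    exact summable_of_ne_finset_zero (s := Finset.Ioo p ⌈√3 * (p : ℝ)⌉₊)
      fun q hq => by rw [ratioTerm_eq_zero hq, norm_zero]
  · have hsum : Summable fun p : ℕ => (p : ℝ) ^ (1 - 2 * s.re) :=
      Real.summable_nat_rpow.2 (by linarith)
    refine hsum.of_nonneg_of_le (fun p => tsum_nonneg fun _ => norm_nonneg _) fun p => ?_
    rw [hrow]
    rcases Nat.eq_zero_or_pos p with rfl | hp
    · simp
      positivity
    have hp' : (0 : ℝ) < p := by exact_mod_cast hp
    calc _ ≤ ∑ q ∈ Finset.Ioo p ⌈√3 * (p : ℝ)⌉₊, (p : ℝ) ^ (-2 * s.re) :=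
          Finset.sum_le_sum fun q _ => norm_ratioTerm_le P (by linarith) p q
      _ ≤ p * (p : ℝ) ^ (-2 * s.re) := by
          rw [Finset.sum_const, nsmul_eq_mul]
          gcongr
          exact card_Ioo_ceil_sqrt_three_le p
      _ = (p : ℝ) ^ (1 - 2 * s.re) := by
          rw [show 1 - 2 * s.re = 1 + -2 * s.re by ring, Real.rpow_add hp', Real.rpow_one]

theorem ratioCount_eq_sum (P : ℕ → Prop) [DecidablePred P] (n : ℕ) :
    (ratioCount P n : ℂ) = ∑ x ∈ n.divisorsAntidiagonal, ratioWeight P x := by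
  rw [ratioCount, Finset.card_filter]
  push_cast
  refine Finset.sum_congr rfl fun x _ => ?_
  rw [ratioWeight]
  congr

theorem hasSum_ratioCount (P : ℕ → Prop) [DecidablePred P] {s : ℂ} (hs : 1 < s.re) :
    LSeriesHasSum (fun n => (ratioCount P n : ℂ)) s
      (∑' p, ∑ q ∈ Finset.Ioo p ⌈√3 * (p : ℝ)⌉₊, ratioTerm P s (p, q)) := by
  have h := (summable_ratioTerm P hs).hasSum
  rw [(summable_ratioTerm P hs).tsum_prod] at h
  simp only [tsum_ratioTerm_row] at h
  have h1 := LSeriesHasSum_of_hasSum_pairs h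
  simpa only [ratioCount_eq_sum] using h1

theorem summable_ratioTerm_row (P : ℕ → Prop) {s : ℂ} (hs : 1 < s.re) :
    Summable fun p => ∑ q ∈ Finset.Ioo p ⌈√3 * (p : ℝ)⌉₊, ratioTerm P s (p, q) := by
  simpa only [tsum_ratioTerm_row] using (summable_ratioTerm P hs).prod

theorem evenTerm_eq_row (s : ℂ) (p : ℕ) :
    evenTerm s p = ∑ q ∈ Finset.Ioo p ⌈√3 * (p : ℝ)⌉₊, ratioTerm (fun _ => True) s (p, q) :=
  Finset.sum_congr rfl fun _ hq => (ratioTerm_of_mem hq trivial trivial).symm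

theorem oddTerm_eq_row (s : ℂ) (k : ℕ) :
    oddTerm s k = ∑ q ∈ Finset.Ioo (2 * k + 1) ⌈√3 * ((2 * k + 1 : ℕ) : ℝ)⌉₊,
      ratioTerm Odd s (2 * k + 1, q) := by
  rw [oddTerm]
  refine Finset.sum_bij_ne_zero (fun l _ _ => 2 * l + 1) ?_ ?_ ?_ ?_
  · intro l hl _
    rw [Finset.mem_Ioo, Nat.lt_ceil] at hl ⊢
    have := hl.2
    push_cast
    exact ⟨by omega, by linarith⟩
  · intro a _ _ b _ _ h
    omega
  · intro q hq h0
    have hodd : Odd q := by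
      by_contra hq'
      exact h0 (ratioTerm_of_not fun h => hq' h.2)
    obtain ⟨l, rfl⟩ := hodd
    have hl : l ∈ Finset.Ioo k ⌈√3 * (k : ℝ) + (√3 - 1) / 2⌉₊ := by
      rw [Finset.mem_Ioo, Nat.lt_ceil] at hq ⊢
      have := hq.2
      push_cast at this
      exact ⟨by omega, by linarith⟩
    refine ⟨l, hl, ?_, rfl⟩
    rw [ratioTerm_of_mem hq ⟨k, rfl⟩ ⟨l, rfl⟩] at h0
    push_cast at h0
    exact h0
  · intro l hl _
    have hq : 2 * l + 1 ∈ Finset.Ioo (2 * k + 1) ⌈√3 * ((2 * k + 1 : ℕ) : ℝ)⌉₊ := by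
      rw [Finset.mem_Ioo, Nat.lt_ceil] at hl ⊢
      have := hl.2
      push_cast
      exact ⟨by omega, by linarith⟩
    rw [ratioTerm_of_mem hq ⟨k, rfl⟩ ⟨l, rfl⟩]
    push_cast
    rfl

theorem summable_evenTerm {s : ℂ} (hs : 1 < s.re) : Summable (evenTerm s) := by
  simpa only [← evenTerm_eq_row] using summable_ratioTerm_row (fun _ => True) hs

theorem two_mul_add_one_injective : Function.Injective fun k : ℕ => 2 * k + 1 :=
  fun a b h => by simpa using h

theorem summable_oddTerm {s : ℂ} (hs : 1 < s.re) : Summable (oddTerm s) := by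
  have := (summable_ratioTerm_row Odd hs).comp_injective two_mul_add_one_injective
  refine this.congr fun k => ?_
  rw [oddTerm_eq_row]
  rfl

theorem hasSum_ratioCount_true {s : ℂ} (hs : 1 < s.re) :
    LSeriesHasSum (fun n => (ratioCount (fun _ => True) n : ℂ)) s (∑' p, evenTerm s p) := by
  simpa only [← evenTerm_eq_row] using hasSum_ratioCount (fun _ => True) hs

theorem hasSum_ratioCount_odd {s : ℂ} (hs : 1 < s.re) :
    LSeriesHasSum (fun n => (ratioCount Odd n : ℂ)) s (∑' k, oddTerm s k) := by
  have h := hasSum_ratioCount Odd hs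
  -- Rows with even first entry vanish, so the sum over p may be taken over p = 2k + 1.
  rw [← two_mul_add_one_injective.tsum_eq] at h
  · simpa only [← oddTerm_eq_row] using h
  · intro p hp
    by_contra hodd
    apply hp
    refine Finset.sum_eq_zero fun q _ => ratioTerm_of_not fun h' => hodd ?_
    obtain ⟨k, hk⟩ := h'.1
    exact ⟨k, hk.symm⟩

-- The counting identity `aSquare_eq` read as an identity of series: convolutions become products,
-- and passing from n to n/2 becomes the factor 2⁻ˢ.
open scoped LSeries.notation in
theorem hasSum_aSquare {s : ℂ} (hs : 1 < s.re) :
    LSeriesHasSum (fun n => (aSquare n : ℂ)) s (PhiSquare s + PhiWrEven s + PhiWrOdd s) := by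
  have hE := ((hasSum_ratioCount_true hs).convolution
    (hasSum_primitiveSimilarCount hs).LSeriesSummable.LSeriesHasSum).spread_two
  have hO := (hasSum_ratioCount_odd hs).convolution (hasSum_primitiveSimilarCount_two_mul hs)
  have hS := (hasSum_similarCount hs).LSeriesSummable.LSeriesHasSum
  have h := (hS.add (hE.smul 2)).add (hO.smul 2)
  have e : PhiSquare s + PhiWrEven s + PhiWrOdd s = PhiSquare s +
      2 * (2 ^ (-s) * ((∑' p, evenTerm s p) * PhiSquarePr s)) +
      2 * ((∑' k, oddTerm s k) * (PhiSquarePr s / (1 + 2 ^ (-s)))) := by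
    rw [PhiWrEven, PhiWrOdd, Complex.cpow_neg]
    ring
  rw [e, LSeriesHasSum_congr s _ (g := _) ?_]
  · exact h
  · intro n hn
    rw [aSquare_eq hn]
    simp only [Pi.add_apply, Pi.smul_apply, LSeries.convolution_def, smul_eq_mul]
    push_cast
    rfl

/-! ### Main terms and holomorphic error series. -/

/-- The deviation of a block of the double Dirichlet series from the corresponding integral. -/
noncomputable def stepError (δ m : ℕ) (s : ℂ) : ℂ :=
  (m : ℂ) ^ (-s) * (δ * stepSum δ m s - (m : ℂ) ^ (-s) * m * sqrtThreeIntegral s)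

theorem norm_stepError_le {δ : ℕ} (hδ : 0 < δ) (m : ℕ) {s : ℂ} (hs : 0 < s.re) :
    ‖stepError δ m s‖ ≤ δ * (‖s‖ + 1) * (m : ℝ) ^ (-2 * s.re) := by
  rcases Nat.eq_zero_or_pos m with rfl | hm
  -- The index m = 0 is harmless: a non-zero power of 0 is 0.
  · have : -s ≠ 0 := neg_ne_zero.2 fun h => by simp [h] at hs
    simp only [stepError, Nat.cast_zero, Complex.zero_cpow this, zero_mul, norm_zero]
    positivity
  · have hm' : (0 : ℝ) < m := by exact_mod_cast hm
    have h := norm_stepSum_sub_le hδ hm hs.le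
    rw [stepError, norm_mul, Complex.norm_natCast_cpow_of_pos hm, Complex.neg_re,
      show -2 * s.re = -s.re + -s.re by ring, Real.rpow_add hm']
    calc _ ≤ (m : ℝ) ^ (-s.re) * (δ * (‖s‖ + 1) * (m : ℝ) ^ (-s.re)) := by gcongr
      _ = _ := by ring

theorem stepError_differentiableAt {δ : ℕ} (m : ℕ) {s : ℂ} (hs : s ≠ 0) :
    DifferentiableAt ℂ (stepError δ m) s := by
  have hc : ∀ n : ℕ, DifferentiableAt ℂ (fun s : ℂ => (n : ℂ) ^ (-s)) s := fun n =>
    differentiableAt_id.neg.const_cpow (Or.inr (neg_ne_zero.2 hs))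
  have hS : DifferentiableAt ℂ (stepSum δ m) s := by
    unfold stepSum
    exact DifferentiableAt.fun_sum fun j _ => hc _
  exact (hc m).mul ((hS.const_mul _).sub
    (((hc m).mul_const _).mul (sqrtThreeIntegral_differentiable s)))

theorem summable_rpow_of_injective {m : ℕ → ℕ} (hm : Function.Injective m) {σ : ℝ}
    (hσ : 1 / 2 < σ) : Summable fun i => (m i : ℝ) ^ (-2 * σ) :=
  (Real.summable_nat_rpow.2 (by linarith : -2 * σ < -1)).comp_injective hm

theorem summable_stepError {δ : ℕ} (hδ : 0 < δ) {m : ℕ → ℕ} (hm : Function.Injective m) {s : ℂ}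
    (hs : 1 / 2 < s.re) : Summable fun i => stepError δ (m i) s :=
  ((summable_rpow_of_injective hm hs).mul_left (δ * (‖s‖ + 1))).of_norm_bounded
    fun i => norm_stepError_le hδ (m i) (by linarith)

/-- Weierstrass' test on a bounded neighbourhood where Re s exceeds a fixed σ > 1/2; boundedness
controls the factor |s| + 1. -/
theorem tsum_stepError_differentiableAt {δ : ℕ} (hδ : 0 < δ) {m : ℕ → ℕ}
    (hm : Function.Injective m) {s : ℂ} (hs : 1 / 2 < s.re) :
    DifferentiableAt ℂ (fun s => ∑' i, stepError δ (m i) s) s := by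
  obtain ⟨σ, hσ1, hσ2⟩ := exists_between hs
  set U : Set ℂ := {z | σ < z.re} ∩ Metric.ball 0 (‖s‖ + 1) with hU
  have hUo : IsOpen U := (isOpen_lt continuous_const Complex.continuous_re).inter Metric.isOpen_ball
  have hsU : s ∈ U := ⟨hσ2, by simp⟩
  have h := Complex.differentiableOn_tsum_of_summable_norm
    (u := fun i => δ * (‖s‖ + 1 + 1) * (m i : ℝ) ^ (-2 * σ)) (F := fun i s => stepError δ (m i) s)
    ((summable_rpow_of_injective hm hσ1).mul_left _) (U := U) ?_ hUo ?_
  · exact h.differentiableAt (hUo.mem_nhds hsU)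
  · intro i z hz
    have hz0 : z ≠ 0 := by
      rintro rfl
      have := hz.1
      simp at this
      linarith
    exact (stepError_differentiableAt (m i) hz0).differentiableWithinAt
  · intro i z hz
    have h1 : σ < z.re := hz.1
    have h2 : ‖z‖ < ‖s‖ + 1 := by simpa using hz.2
    refine (norm_stepError_le hδ (m i) (by linarith)).trans ?_
    rcases Nat.eq_zero_or_pos (m i) with h0 | h0
    · rw [h0, Nat.cast_zero, Real.zero_rpow (by linarith), Real.zero_rpow (by linarith)]
      simp
    · have h0' : (1 : ℝ) ≤ m i := by exact_mod_cast h0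
      have he : -2 * z.re ≤ -2 * σ := by linarith
      gcongr ?_ * ?_
      · gcongr
      · exact Real.rpow_le_rpow_of_exponent_le h0' he

theorem natCast_cpow_neg_mul_self (m : ℕ) {s : ℂ} (hs : 1 < s.re) :
    (m : ℂ) ^ (-s) * ((m : ℂ) ^ (-s) * m) = 1 / (m : ℂ) ^ (2 * s - 1) := by
  rcases eq_or_ne m 0 with rfl | hm
  · have h1 : 2 * s - 1 ≠ 0 := fun h => by
      have := congrArg Complex.re h
      simp at this
      linarith
    simp [Complex.zero_cpow h1]
  · have hm' : (m : ℂ) ≠ 0 := by exact_mod_cast hm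
    rw [Complex.cpow_sub _ _ hm', Complex.cpow_neg, two_mul, Complex.cpow_add _ _ hm',
      Complex.cpow_one]
    have := (Complex.cpow_ne_zero_iff_of_exponent_ne_zero (y := s) (x := (m : ℂ))
      (fun h => by simp [h] at hs; linarith)).2 hm'
    field_simp

theorem one_lt_re_two_mul_sub_one {s : ℂ} (hs : 1 < s.re) : 1 < (2 * s - 1).re := by
  simp
  linarith

/-- The main term of row p is c(s)p¹⁻²ˢ, so the whole singular behaviour at 1 is isolated in ζ(2s −
1). -/
theorem tsum_evenTerm {s : ℂ} (hs : 1 < s.re) :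
    ∑' p, evenTerm s p = sqrtThreeIntegral s * riemannZeta (2 * s - 1) +
      ∑' p, stepError 1 p s := by
  have hz := Complex.summable_one_div_nat_cpow.2 (one_lt_re_two_mul_sub_one hs)
  have hE : Summable fun p => stepError 1 p s :=
    summable_stepError one_pos Function.injective_id (by linarith)
  rw [zeta_eq_tsum_one_div_nat_cpow (one_lt_re_two_mul_sub_one hs), ← tsum_mul_left,
    ← (hz.mul_left _).tsum_add hE]
  refine tsum_congr fun p => ?_
  rw [evenTerm_eq, stepError, ← natCast_cpow_neg_mul_self p hs]
  push_cast
  ring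

theorem tsum_odd_cpow {w : ℂ} (hw : 1 < w.re) :
    ∑' k : ℕ, 1 / ((2 * k + 1 : ℕ) : ℂ) ^ w = (1 - 2 ^ (-w)) * riemannZeta w := by
  have hz := Complex.summable_one_div_nat_cpow.2 hw
  have h1 : Function.Injective fun k : ℕ => 2 * k := fun a b h => by simpa using h
  have h := tsum_even_add_odd (f := fun n : ℕ => 1 / (n : ℂ) ^ w) (hz.comp_injective h1)
    (hz.comp_injective two_mul_add_one_injective)
  have he : ∑' k : ℕ, 1 / ((2 * k : ℕ) : ℂ) ^ w = 2 ^ (-w) * riemannZeta w := by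
    rw [zeta_eq_tsum_one_div_nat_cpow hw, ← tsum_mul_left]
    refine tsum_congr fun k => ?_
    rw [Nat.cast_mul, Complex.natCast_mul_natCast_cpow, Complex.cpow_neg, Nat.cast_ofNat, one_div,
      mul_inv, one_div]
  rw [he, ← zeta_eq_tsum_one_div_nat_cpow hw] at h
  linear_combination h

/-- The factor 2 on the left is the spacing of odd numbers; restricting to odd m removes the Euler
factor of ζ(2s − 1) at 2. -/
theorem tsum_oddTerm {s : ℂ} (hs : 1 < s.re) :
    2 * ∑' k, oddTerm s k =
      sqrtThreeIntegral s * ((1 - 2 ^ (1 - 2 * s)) * riemannZeta (2 * s - 1)) +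
      ∑' k, stepError 2 (2 * k + 1) s := by
  have hz : Summable fun k : ℕ => 1 / ((2 * k + 1 : ℕ) : ℂ) ^ (2 * s - 1) :=
    (Complex.summable_one_div_nat_cpow.2 (one_lt_re_two_mul_sub_one hs)).comp_injective
      two_mul_add_one_injective
  have h1 := tsum_odd_cpow (one_lt_re_two_mul_sub_one hs)
  rw [neg_sub] at h1
  rw [← h1, ← tsum_mul_left, ← tsum_mul_left, ← (hz.mul_left _).tsum_add
    (summable_stepError two_pos two_mul_add_one_injective (by linarith))]
  refine tsum_congr fun k => ?_
  rw [oddTerm_eq, stepError, ← natCast_cpow_neg_mul_self (2 * k + 1) hs]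
  push_cast
  ring

/-! ### Meromorphic continuation and the double pole. -/

/-- The entire function `(s - 1) ζ(s)`. -/
noncomputable def zetaRegular : ℂ → ℂ := Function.update (fun s => (s - 1) * riemannZeta s) 1 1

theorem zetaRegular_one : zetaRegular 1 = 1 := Function.update_self ..

theorem zetaRegular_of_ne {s : ℂ} (hs : s ≠ 1) : zetaRegular s = (s - 1) * riemannZeta s :=
  Function.update_of_ne hs ..

theorem zetaRegular_differentiable : Differentiable ℂ zetaRegular := by
  rw [← differentiableOn_univ,
    ← Complex.differentiableOn_compl_singleton_and_continuousAt_iff (univ_mem : _ ∈ nhds (1 : ℂ))]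
  constructor
  · intro s hs
    have hs1 : s ≠ 1 := fun h => hs.2 h
    have h1 : DifferentiableAt ℂ (fun s => (s - 1) * riemannZeta s) s :=
      (differentiableAt_id.sub_const 1).mul (differentiableAt_riemannZeta hs1)
    refine (h1.congr_of_eventuallyEq ?_).differentiableWithinAt
    filter_upwards [isOpen_ne.mem_nhds hs1] with z hz
    exact zetaRegular_of_ne hz
  · exact continuousAt_update_same.2 riemannZeta_residue_one

theorem chiNegFour_ne_one : chiNegFour ≠ 1 := by
  intro h
  have h1 := congrArg (fun χ : DirichletCharacter ℂ 4 => χ ((3 : ℕ) : ZMod 4)) h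
  simp only [chiNegFour_natCast] at h1
  rw [show ZMod.χ₄ ((3 : ℕ) : ZMod 4) = -1 by decide, MulChar.one_apply (by decide)] at h1
  norm_num at h1

/-- The numerator of the continuation of the Dirichlet series of the well-rounded sublattices:
the continuation multiplied by `(s - 1) ^ 2`. -/
noncomputable def wrNumerator (s : ℂ) : ℂ :=
  (s - 1) * zetaRegular s * chiNegFour.LFunction s +
    -- Since 2s − 1 − 1 = 2(s − 1), half of `zetaRegular (2 * s - 1)` is (s − 1)ζ(2s − 1) away from
    -- s = 1.
    (2 / 2 ^ s * (sqrtThreeIntegral s * (zetaRegular (2 * s - 1) / 2) +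
        (s - 1) * ∑' p, stepError 1 p s) +
      1 / (1 + 2 ^ (-s)) * (sqrtThreeIntegral s * ((1 - 2 ^ (1 - 2 * s)) *
        (zetaRegular (2 * s - 1) / 2)) + (s - 1) * ∑' k, stepError 2 (2 * k + 1) s)) *
    (zetaRegular s * chiNegFour.LFunction s / riemannZeta (2 * s))

theorem wrNumerator_div {s : ℂ} (hs : 1 < s.re) :
    wrNumerator s / (s - 1) ^ 2 = PhiSquareWr s := by
  have h1 : s ≠ 1 := fun h => by simp [h] at hs
  have h2 : 2 * s - 1 ≠ 1 := fun h => h1 (by linear_combination h / 2)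
  have h3 : s - 1 ≠ 0 := sub_ne_zero.2 h1
  rw [PhiSquareWr, (hasSum_aSquare hs).LSeries_eq, PhiWrEven, PhiWrOdd, tsum_evenTerm hs,
    PhiSquarePr_eq hs, PhiSquare_eq hs, wrNumerator, zetaRegular_of_ne h1, zetaRegular_of_ne h2]
  have h4 := tsum_oddTerm hs
  set A := ∑' p, stepError 1 p s
  set B := ∑' k, stepError 2 (2 * k + 1) s
  set O := ∑' k, oddTerm s k
  have h5 : B = 2 * O - sqrtThreeIntegral s * ((1 - 2 ^ (1 - 2 * s)) * riemannZeta (2 * s - 1)) := by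
    rw [h4]; ring
  rw [h5, div_eq_iff (pow_ne_zero 2 h3)]
  ring

/-- Re s > 1/2 serves twice: the error series converge there, and ζ(2s) in the denominator has no
zero. The denominator 1 + 2⁻ˢ vanishes only on Re s = 0. -/
theorem wrNumerator_differentiableAt {s : ℂ} (hs : 1 / 2 < s.re) :
    DifferentiableAt ℂ wrNumerator s := by
  have h2s : 1 < (2 * s).re := by simp; linarith
  have hne : 2 * s ≠ 1 := fun h => by rw [h] at h2s; simp at h2s
  have hz1 : DifferentiableAt ℂ zetaRegular s := zetaRegular_differentiable s
  have hz2 : DifferentiableAt ℂ (fun s => zetaRegular (2 * s - 1)) s :=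
    (zetaRegular_differentiable (2 * s - 1)).comp s (by fun_prop)
  have hz3 : DifferentiableAt ℂ (fun s => riemannZeta (2 * s)) s :=
    (differentiableAt_riemannZeta hne).comp s (by fun_prop : DifferentiableAt ℂ (fun s => 2 * s) s)
  have hL : DifferentiableAt ℂ chiNegFour.LFunction s :=
    DirichletCharacter.differentiable_LFunction chiNegFour_ne_one s
  have hc : DifferentiableAt ℂ sqrtThreeIntegral s := sqrtThreeIntegral_differentiable s
  have hA : DifferentiableAt ℂ (fun s => ∑' p, stepError 1 p s) s :=
    tsum_stepError_differentiableAt one_pos Function.injective_id hs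
  have hB : DifferentiableAt ℂ (fun s => ∑' k, stepError 2 (2 * k + 1) s) s :=
    tsum_stepError_differentiableAt two_pos two_mul_add_one_injective hs
  have hp1 : DifferentiableAt ℂ (fun s : ℂ => (2 : ℂ) ^ s) s :=
    differentiableAt_id.const_cpow (Or.inl two_ne_zero)
  have hp2 : DifferentiableAt ℂ (fun s : ℂ => (2 : ℂ) ^ (-s)) s :=
    differentiableAt_id.neg.const_cpow (Or.inl two_ne_zero)
  have hp3 : DifferentiableAt ℂ (fun s : ℂ => (2 : ℂ) ^ (1 - 2 * s)) s :=
    DifferentiableAt.const_cpow (by fun_prop) (Or.inl two_ne_zero)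
  have hd1 : (2 : ℂ) ^ s ≠ 0 := by simp [Complex.cpow_eq_zero_iff]
  have hd2 : (1 : ℂ) + 2 ^ (-s) ≠ 0 := one_add_two_cpow_neg_ne_zero (by linarith)
  have hd3 : riemannZeta (2 * s) ≠ 0 := riemannZeta_ne_zero_of_one_lt_re h2s
  have hs1 : DifferentiableAt ℂ (fun s : ℂ => s - 1) s := by fun_prop
  unfold wrNumerator
  exact ((hs1.mul hz1).mul hL).add
    (((((differentiableAt_const _).div hp1 hd1).mul ((hc.mul (hz2.div_const 2)).add (hs1.mul hA))).add
      (((differentiableAt_const _).div ((differentiableAt_const _).add hp2) hd2).mul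
        ((hc.mul (((differentiableAt_const _).sub hp3).mul (hz2.div_const 2))).add (hs1.mul hB)))).mul
      ((hz1.mul hL).div hz3 hd3))

theorem wrNumerator_analyticAt {s : ℂ} (hs : 1 / 2 < s.re) : AnalyticAt ℂ wrNumerator s := by
  have hU : IsOpen {s : ℂ | 1 / 2 < s.re} := isOpen_lt continuous_const Complex.continuous_re
  exact DifferentiableOn.analyticAt
    (fun z hz => (wrNumerator_differentiableAt hz).differentiableWithinAt) (hU.mem_nhds hs)

theorem wrNumerator_one_ne_zero : wrNumerator 1 ≠ 0 := by
  have h1 : (2 : ℂ) * 1 - 1 = 1 := by norm_num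
  have h2 : (1 : ℂ) - 2 * 1 = -1 := by norm_num
  have hL : chiNegFour.LFunction 1 ≠ 0 :=
    DirichletCharacter.LFunction_apply_one_ne_zero chiNegFour_ne_one
  have hz : riemannZeta (2 * 1) ≠ 0 := riemannZeta_ne_zero_of_one_lt_re (by norm_num)
  have hlog : Real.log √3 ≠ 0 := (Real.log_pos one_lt_sqrt_three).ne'
  have hlog' : ((Real.log √3 : ℝ) : ℂ) ≠ 0 := by exact_mod_cast hlog
  -- The coefficient 2/3 is 1/2 from the even part plus (2/3)·(1/2)·(1/2) from the odd part.
  have e : wrNumerator 1 = 2 / 3 * (Real.log √3 : ℝ) *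
      (chiNegFour.LFunction 1 / riemannZeta (2 * 1)) := by
    rw [wrNumerator, h1, h2, zetaRegular_one, sqrtThreeIntegral_one, Complex.cpow_neg_one,
      Complex.cpow_one]
    ring
  rw [e]
  exact mul_ne_zero (mul_ne_zero (by norm_num) hlog') (div_ne_zero hL hz)

theorem exists_continuation : ∃ F : ℂ → ℂ,
    (∀ s : ℂ, 1 < s.re → F s = PhiSquareWr s) ∧
    MeromorphicOn F {s : ℂ | 1 / 2 < s.re} ∧
    meromorphicOrderAt F 1 = -2 ∧
    ∀ s : ℂ, 1 ≤ s.re → s ≠ 1 → AnalyticAt ℂ F s := by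
  have hlin : ∀ s : ℂ, AnalyticAt ℂ (fun s : ℂ => (s - 1) ^ 2) s := fun s => by fun_prop
  have hmero : ∀ s : ℂ, 1 / 2 < s.re → MeromorphicAt (fun s => wrNumerator s / (s - 1) ^ 2) s :=
    fun s hs => (wrNumerator_analyticAt hs).meromorphicAt.div (hlin s).meromorphicAt
  refine ⟨fun s => wrNumerator s / (s - 1) ^ 2, fun s hs => wrNumerator_div hs,
    fun s hs => hmero s hs, ?_, fun s hs hs1 => ?_⟩
  · have h := (meromorphicOrderAt_eq_int_iff (n := -2) (hmero 1 (by norm_num))).2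
      ⟨wrNumerator, wrNumerator_analyticAt (by norm_num), wrNumerator_one_ne_zero,
        .of_forall fun z => by
          rw [zpow_neg, smul_eq_mul, div_eq_inv_mul]
          rfl⟩
    simpa using h
  · exact (wrNumerator_analyticAt (by linarith)).div (hlin s)
      (pow_ne_zero 2 (sub_ne_zero.2 hs1))

/-! ### Explicit bounds on the real half-axis. -/

/-- No integer lies strictly between 1 and √3. This empty row is what makes the final inequalities
strict. -/
theorem stepSumReal_one {δ : ℕ} (hδ : 0 < δ) (s : ℝ) : stepSumReal δ 1 s = 0 := by
  have hδ' : (1 : ℝ) ≤ δ := by exact_mod_cast hδ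
  have h : ⌈(√3 - 1) * (1 : ℕ) / (δ : ℝ)⌉₊ ≤ 1 := by
    apply Nat.ceil_le.2
    rw [Nat.cast_one, div_le_one (by linarith)]
    linarith [sqrt_three_lt_two]
  rw [stepSumReal, Finset.Ico_eq_empty (by omega), Finset.sum_empty]

theorem rpow_neg_mul_rpow_neg_mul_self (m : ℕ) {s : ℝ} (hs : 1 < s) :
    (m : ℝ) ^ (-s) * ((m : ℝ) ^ (-s) * m) = (m : ℝ) ^ (1 - 2 * s) := by
  rcases Nat.eq_zero_or_pos m with rfl | hm
  · rw [Nat.cast_zero, Real.zero_rpow (by linarith), Real.zero_rpow (by linarith), zero_mul]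
  · have hm' : (0 : ℝ) < m := by exact_mod_cast hm
    rw [show 1 - 2 * s = -s + (-s + 1) by ring, Real.rpow_add hm', Real.rpow_add hm', Real.rpow_one]

theorem rpow_neg_mul_rpow_neg (m : ℕ) {s : ℝ} (hs : 1 < s) :
    (m : ℝ) ^ (-s) * (m : ℝ) ^ (-s) = (m : ℝ) ^ (-(2 * s)) := by
  rcases Nat.eq_zero_or_pos m with rfl | hm
  · rw [Nat.cast_zero, Real.zero_rpow (by linarith), Real.zero_rpow (by linarith), zero_mul]
  · have hm' : (0 : ℝ) < m := by exact_mod_cast hm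
    rw [show -(2 * s) = -s + -s by ring, Real.rpow_add hm']

/-- Termwise the sum lies below the integral by at most the first value δm⁻ˢ. At m = 1 the sum is 0
while 0 < c(s) < 1 ≤ δ, so both comparisons are strict there. -/
theorem tsum_stepSumReal_bounds {δ : ℕ} (hδ : 0 < δ) {m : ℕ → ℕ} (hm : Function.Injective m)
    {i : ℕ} (hi : m i = 1) {s : ℝ} (hs : 1 < s) :
    sqrtThreeIntegralReal s * (∑' i, (m i : ℝ) ^ (1 - 2 * s)) -
        δ * ∑' i, (m i : ℝ) ^ (-(2 * s)) <
      δ * ∑' i, (m i : ℝ) ^ (-s) * stepSumReal δ (m i) s ∧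
    δ * ∑' i, (m i : ℝ) ^ (-s) * stepSumReal δ (m i) s <
      sqrtThreeIntegralReal s * ∑' i, (m i : ℝ) ^ (1 - 2 * s) := by
  have hδ' : (1 : ℝ) ≤ δ := by exact_mod_cast hδ
  have hs0 : 0 ≤ s := by linarith
  have hZ : Summable fun i => (m i : ℝ) ^ (1 - 2 * s) :=
    (Real.summable_nat_rpow.2 (by linarith)).comp_injective hm
  have hW : Summable fun i => (m i : ℝ) ^ (-(2 * s)) :=
    (Real.summable_nat_rpow.2 (by linarith)).comp_injective hm
  have hle : ∀ i, δ * ((m i : ℝ) ^ (-s) * stepSumReal δ (m i) s) ≤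
      sqrtThreeIntegralReal s * (m i : ℝ) ^ (1 - 2 * s) := by
    intro i
    rcases Nat.eq_zero_or_pos (m i) with h0 | h0
    · rw [h0, Nat.cast_zero, Real.zero_rpow (by linarith), Real.zero_rpow (by linarith)]
      simp
    · have h := mul_le_mul_of_nonneg_left (stepSumReal_le hδ h0 hs0)
        (Real.rpow_nonneg (Nat.cast_nonneg (m i)) (-s))
      rw [← rpow_neg_mul_rpow_neg_mul_self _ hs]
      linarith
  have hge : ∀ i, sqrtThreeIntegralReal s * (m i : ℝ) ^ (1 - 2 * s) -
      δ * (m i : ℝ) ^ (-(2 * s)) ≤ δ * ((m i : ℝ) ^ (-s) * stepSumReal δ (m i) s) := by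
    intro i
    rcases Nat.eq_zero_or_pos (m i) with h0 | h0
    · rw [h0, Nat.cast_zero, Real.zero_rpow (by linarith), Real.zero_rpow (by linarith),
        Real.zero_rpow (by linarith)]
      simp
    · have h := mul_le_mul_of_nonneg_left (le_stepSumReal hδ h0 hs0)
        (Real.rpow_nonneg (Nat.cast_nonneg (m i)) (-s))
      rw [← rpow_neg_mul_rpow_neg_mul_self _ hs, ← rpow_neg_mul_rpow_neg _ hs]
      linarith
  have hE : Summable fun i => δ * ((m i : ℝ) ^ (-s) * stepSumReal δ (m i) s) :=
    (hZ.mul_left _).of_nonneg_of_le (fun i => by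
      have : 0 ≤ stepSumReal δ (m i) s := Finset.sum_nonneg fun _ _ => by positivity
      positivity) hle
  have hpos := sqrtThreeIntegralReal_pos s
  have hlt := sqrtThreeIntegralReal_lt_one hs0
  rw [← tsum_mul_left, ← tsum_mul_left, ← tsum_mul_left,
    ← (hZ.mul_left _).tsum_sub (hW.mul_left _)]
  constructor
  · refine Summable.tsum_lt_tsum (i := i) hge ?_ ((hZ.mul_left _).sub (hW.mul_left _)) hE
    simp only [hi, stepSumReal_one hδ, Nat.cast_one, Real.one_rpow]
    linarith
  · refine Summable.tsum_lt_tsum (i := i) hle ?_ hE (hZ.mul_left _)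
    simp only [hi, stepSumReal_one hδ, Nat.cast_one, Real.one_rpow]
    linarith

theorem natCast_cpow_ofReal (m : ℕ) (s : ℝ) : (m : ℂ) ^ (s : ℂ) = (((m : ℝ) ^ s : ℝ) : ℂ) := by
  rw [Complex.ofReal_cpow (Nat.cast_nonneg _), Complex.ofReal_natCast]

theorem one_div_natCast_cpow_ofReal (m : ℕ) (s : ℝ) :
    1 / (m : ℂ) ^ (s : ℂ) = (((m : ℝ) ^ (-s) : ℝ) : ℂ) := by
  rw [natCast_cpow_ofReal, Real.rpow_neg (Nat.cast_nonneg _)]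
  push_cast
  rw [one_div]

theorem PhiSquarePr_ofReal {s : ℝ} (hs : 1 < s) : ∃ P : ℝ, 0 < P ∧ PhiSquarePr s = P := by
  have hs' : 1 < (s : ℂ).re := by simpa using hs
  refine ⟨∑' n, (primitiveSimilarCount squareLattice n : ℝ) * (n : ℝ) ^ (-s), ?_, ?_⟩
  all_goals
    have h : PhiSquarePr s =
        ((∑' n, (primitiveSimilarCount squareLattice n : ℝ) * (n : ℝ) ^ (-s) : ℝ) : ℂ) := by
      rw [PhiSquarePr, LSeries, Complex.ofReal_tsum]
      refine tsum_congr fun n => ?_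
      rcases eq_or_ne n 0 with rfl | hn
      · simp [primitiveSimilarCount_zero]
      · rw [LSeries.term_of_ne_zero hn, div_eq_mul_one_div, one_div_natCast_cpow_ofReal]
        push_cast
        rfl
  -- Positivity follows from non-negative coefficients together with the non-vanishing of ζ and L in
  -- the product formula.
  · refine lt_of_le_of_ne (tsum_nonneg fun n => by positivity) fun h0 => ?_
    rw [← h0, PhiSquarePr_eq hs'] at h
    have h1 : riemannZeta s ≠ 0 := riemannZeta_ne_zero_of_one_lt_re hs'
    have h2 : chiNegFour.LFunction s ≠ 0 :=
      DirichletCharacter.LFunction_ne_zero_of_one_le_re _ (Or.inl chiNegFour_ne_one) hs'.le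
    have h3 : riemannZeta (2 * s) ≠ 0 :=
      riemannZeta_ne_zero_of_one_lt_re (by simp; linarith)
    exact div_ne_zero (mul_ne_zero h1 h2) h3 (by simpa using h)
  · exact h

/-- With a = 2⁻ˢ, P = Φᵖʳ(s), W = ζ(2s) and Z = ζ(2s − 1), everything is real: Φ = PW, and the even
and odd contributions are 2aPE and 2PO/(1 + a), with E and 2O enclosed by `tsum_stepSumReal_bounds`.
-/
theorem bounds_of_one_lt {s : ℝ} (hs : 1 < s) :
    (PhiSquareWr s).im = 0 ∧ (PhiSquare s).im = 0 ∧ (DSquare s).im = 0 ∧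
      DSquare s - PhiSquare s < PhiSquareWr s ∧ PhiSquareWr s < DSquare s + PhiSquare s := by
  have hs' : 1 < (s : ℂ).re := by simpa using hs
  have hs2 : 1 < (2 * s : ℂ).re := by simp; linarith
  have hs1 : (s : ℂ) ≠ 1 := fun h => by simp [h] at hs'
  obtain ⟨P, hP, hPe⟩ := PhiSquarePr_ofReal hs
  obtain ⟨hE1, hE2⟩ := tsum_stepSumReal_bounds one_pos Function.injective_id (i := 1) rfl hs
  obtain ⟨hO1, hO2⟩ := tsum_stepSumReal_bounds two_pos two_mul_add_one_injective (i := 0) rfl hs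
  set a : ℝ := 2 ^ (-s) with ha
  have ha0 : 0 < a := by positivity
  set c := sqrtThreeIntegralReal s
  set E := ∑' i, ((id i : ℕ) : ℝ) ^ (-s) * stepSumReal 1 (id i) s
  set O := ∑' k : ℕ, ((2 * k + 1 : ℕ) : ℝ) ^ (-s) * stepSumReal 2 (2 * k + 1) s
  set Z := ∑' i, ((id i : ℕ) : ℝ) ^ (1 - 2 * s) with hZ
  set W := ∑' i, ((id i : ℕ) : ℝ) ^ (-(2 * s)) with hW
  have eE : ∑' p, evenTerm s p = (E : ℂ) := by
    rw [Complex.ofReal_tsum]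
    refine tsum_congr fun p => ?_
    rw [evenTerm_eq, stepSum_ofReal, ← Complex.ofReal_neg, natCast_cpow_ofReal]
    push_cast
    rfl
  have eO : ∑' k, oddTerm s k = (O : ℂ) := by
    rw [Complex.ofReal_tsum]
    refine tsum_congr fun p => ?_
    rw [oddTerm_eq, stepSum_ofReal, ← Complex.ofReal_neg, natCast_cpow_ofReal]
    push_cast
    rfl
  have eZ : riemannZeta (2 * s - 1) = (Z : ℂ) := by
    rw [zeta_eq_tsum_one_div_nat_cpow (one_lt_re_two_mul_sub_one hs'), Complex.ofReal_tsum]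
    refine tsum_congr fun p => ?_
    rw [show (2 * s - 1 : ℂ) = ((2 * s - 1 : ℝ) : ℂ) by push_cast; ring,
      one_div_natCast_cpow_ofReal, neg_sub]
    rfl
  have eW : riemannZeta (2 * s) = (W : ℂ) := by
    rw [zeta_eq_tsum_one_div_nat_cpow hs2, Complex.ofReal_tsum]
    refine tsum_congr fun p => ?_
    rw [show (2 * s : ℂ) = ((2 * s : ℝ) : ℂ) by push_cast; ring, one_div_natCast_cpow_ofReal]
    rfl
  have ea : (2 : ℂ) ^ (-s : ℂ) = (a : ℂ) := by
    have := natCast_cpow_ofReal 2 (-s)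
    push_cast at this
    exact_mod_cast this
  have ea2 : (2 : ℂ) ^ (-(2 * s) : ℂ) = (a : ℂ) ^ 2 := by
    rw [← ea, ← Complex.cpow_nat_mul]
    congr 1
    push_cast
    ring
  have eZo : ∑' k : ℕ, ((2 * k + 1 : ℕ) : ℝ) ^ (1 - 2 * s) = (1 - 2 * a ^ 2) * Z := by
    have h := tsum_odd_cpow (one_lt_re_two_mul_sub_one hs')
    rw [eZ, neg_sub, show (1 - 2 * s : ℂ) = 1 + -(2 * s) by ring, Complex.cpow_add _ _ two_ne_zero,
      Complex.cpow_one, ea2] at h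
    have h2 : ∑' k : ℕ, 1 / ((2 * k + 1 : ℕ) : ℂ) ^ (2 * s - 1 : ℂ) =
        ((∑' k : ℕ, ((2 * k + 1 : ℕ) : ℝ) ^ (1 - 2 * s) : ℝ) : ℂ) := by
      rw [Complex.ofReal_tsum]
      refine tsum_congr fun p => ?_
      rw [show (2 * s - 1 : ℂ) = ((2 * s - 1 : ℝ) : ℂ) by push_cast; ring,
        one_div_natCast_cpow_ofReal, neg_sub]
    rw [h2] at h
    exact_mod_cast h
  have eWo : ∑' k : ℕ, ((2 * k + 1 : ℕ) : ℝ) ^ (-(2 * s)) = (1 - a ^ 2) * W := by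
    have h := tsum_odd_cpow hs2
    rw [eW, ea2] at h
    have h2 : ∑' k : ℕ, 1 / ((2 * k + 1 : ℕ) : ℂ) ^ (2 * s : ℂ) =
        ((∑' k : ℕ, ((2 * k + 1 : ℕ) : ℝ) ^ (-(2 * s)) : ℝ) : ℂ) := by
      rw [Complex.ofReal_tsum]
      refine tsum_congr fun p => ?_
      rw [show (2 * s : ℂ) = ((2 * s : ℝ) : ℂ) by push_cast; ring, one_div_natCast_cpow_ofReal]
    rw [h2] at h
    exact_mod_cast h
  have hW0 : (W : ℂ) ≠ 0 := eW ▸ riemannZeta_ne_zero_of_one_lt_re hs2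
  have e1 : PhiSquare s = ((P * W : ℝ) : ℂ) := by
    have h := hPe
    rw [PhiSquarePr_eq hs', ← PhiSquare_eq hs', eW, div_eq_iff hW0] at h
    rw [h]
    push_cast
    rfl
  have h2s : (2 : ℂ) ^ (s : ℂ) = (a : ℂ)⁻¹ := by
    rw [← ea, Complex.cpow_neg, inv_inv]
  have ha1 : (a : ℂ) ≠ 0 := by exact_mod_cast ha0.ne'
  have ha2 : (1 + a : ℂ) ≠ 0 := by
    have : (1 + a : ℝ) ≠ 0 := by positivity
    exact_mod_cast this
  have e2 : DSquare s = (((1 + 2 * a) / (1 + a) * c * P * Z : ℝ) : ℂ) := by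
    have h := hPe
    rw [PhiSquarePr_eq hs'] at h
    rw [DSquare, ← sqrtThreeIntegral_of_ne hs1, sqrtThreeIntegral_ofReal, eZ, h2s]
    have h3 : (2 + (a : ℂ)⁻¹) / (1 + (a : ℂ)⁻¹) = (1 + 2 * a) / (1 + a) := by
      have h4 : (1 + (a : ℂ)⁻¹) = (1 + a) / a := by field_simp; ring
      have h5 : (2 + (a : ℂ)⁻¹) = (1 + 2 * a) / a := by field_simp; ring
      rw [h4, h5, div_div_div_cancel_right₀ ha1]
    rw [h3]
    push_cast
    rw [← h]
    ring
  have e3 : PhiSquareWr s = ((P * W + 2 * a * E * P + 2 / (1 + a) * P * O : ℝ) : ℂ) := by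
    rw [PhiSquareWr, (hasSum_aSquare hs').LSeries_eq, PhiWrEven, PhiWrOdd, e1, hPe, eE, eO, ea, h2s]
    push_cast
    rw [div_inv_eq_mul]
  rw [eZo, eWo] at hO1
  rw [eZo] at hO2
  rw [e1, e2, e3]
  refine ⟨Complex.ofReal_im _, Complex.ofReal_im _, Complex.ofReal_im _, ?_, ?_⟩
  · rw [← Complex.ofReal_sub, Complex.real_lt_real]
    -- The possible losses add up to 2aPW + 2(1 − a²)PW/(1 + a) = 2PW, which the square sublattices
    -- reduce to PW = Φ.
    have key : (1 + 2 * a) / (1 + a) * c * P * Z - P * W =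
        P * W + 2 * a * (c * Z - W) * P +
          1 / (1 + a) * P * (c * ((1 - 2 * a ^ 2) * Z) - 2 * ((1 - a ^ 2) * W)) := by
      field_simp
      ring
    have h1 : 2 * a * (c * Z - W) * P < 2 * a * E * P := by
      push_cast at hE1
      gcongr
      linarith
    have h2 : 1 / (1 + a) * P * (c * ((1 - 2 * a ^ 2) * Z) - 2 * ((1 - a ^ 2) * W)) <
        1 / (1 + a) * P * (2 * O) := by
      push_cast at hO1
      exact mul_lt_mul_of_pos_left hO1 (by positivity)
    have h3 : 2 / (1 + a) * P * O = 1 / (1 + a) * P * (2 * O) := by ring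
    rw [key, h3]
    linarith
  · rw [← Complex.ofReal_add, Complex.real_lt_real]
    -- The main terms combine by 2a + (1 − 2a²)/(1 + a) = (1 + 2a)/(1 + a), the first factor of D.
    have key : (1 + 2 * a) / (1 + a) * c * P * Z + P * W =
        P * W + 2 * a * (c * Z) * P + 1 / (1 + a) * P * (c * ((1 - 2 * a ^ 2) * Z)) := by
      field_simp
      ring
    have h1 : 2 * a * E * P < 2 * a * (c * Z) * P := by
      push_cast at hE2
      gcongr
      linarith
    have h2 : 1 / (1 + a) * P * (2 * O) < 1 / (1 + a) * P * (c * ((1 - 2 * a ^ 2) * Z)) := by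
      push_cast at hO2
      exact mul_lt_mul_of_pos_left hO2 (by positivity)
    have h3 : 2 / (1 + a) * P * O = 1 / (1 + a) * P * (2 * O) := by ring
    rw [key, h3]
    linarith

/-! ### Lattice points in discs and the mean of the similar count. -/

/-- The unit disc in the coordinate plane. -/
def unitDisc : Set (Fin 2 → ℝ) := {x | x 0 ^ 2 + x 1 ^ 2 ≤ 1}

theorem preimage_unitDisc :
    Complex.measurableEquivPi ⁻¹' unitDisc = Metric.closedBall (0 : ℂ) 1 := by
  ext z
  rw [Set.mem_preimage, unitDisc, Set.mem_ofPred_eq, mem_closedBall_zero_iff,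
    ← sq_le_one_iff₀ (norm_nonneg _), Complex.sq_norm, Complex.normSq_apply]
  simp [Complex.measurableEquivPi, sq]

theorem isClosed_unitDisc : IsClosed unitDisc :=
  isClosed_le (by fun_prop) continuous_const

theorem volume_unitDisc : MeasureTheory.volume.real unitDisc = Real.pi := by
  rw [MeasureTheory.measureReal_def,
    ← Complex.volume_preserving_equiv_pi.measure_preimage
      isClosed_unitDisc.measurableSet.nullMeasurableSet, preimage_unitDisc,
    Complex.volume_closedBall]
  simp

theorem convex_unitDisc : Convex ℝ unitDisc := by
  intro x hx y hy a b ha hb hab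
  simp only [unitDisc, Set.mem_ofPred_eq, Pi.add_apply, Pi.smul_apply, smul_eq_mul] at *
  have h1 : 0 ≤ a * b * ((x 0 - y 0) ^ 2 + (x 1 - y 1) ^ 2) := by positivity
  obtain rfl : b = 1 - a := by linarith
  nlinarith

theorem isBounded_unitDisc : Bornology.IsBounded unitDisc := by
  refine (Metric.isBounded_closedBall (x := (0 : Fin 2 → ℝ)) (r := 1)).subset fun x hx => ?_
  rw [unitDisc, Set.mem_ofPred_eq] at hx
  rw [mem_closedBall_zero_iff, pi_norm_le_iff_of_nonneg zero_le_one]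
  intro i
  rw [Real.norm_eq_abs, ← sq_le_one_iff_abs_le_one]
  fin_cases i
  · simp only [Fin.zero_eta]
    nlinarith [sq_nonneg (x 1)]
  · simp only [Fin.mk_one]
    nlinarith [sq_nonneg (x 0)]

open scoped Pointwise in
theorem card_unitDisc_inter {x : ℝ} (hx : 0 < x) :
    Nat.card ↑(unitDisc ∩ x⁻¹ • (Submodule.span ℤ (Set.range (Pi.basisFun ℝ (Fin 2))) :
      Set (Fin 2 → ℝ))) = {z : GaussianInt | (z.norm : ℝ) ≤ x ^ 2}.ncard := by
  set f : GaussianInt → Fin 2 → ℝ := fun z => x⁻¹ • ![(z.re : ℝ), (z.im : ℝ)] with hf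
  have hinj : Function.Injective f := by
    intro z w h
    have h' := smul_right_injective _ (inv_ne_zero hx.ne') h
    have h0 := congrFun h' 0
    have h1 := congrFun h' 1
    simp [-GaussianInt.intCast_re, -GaussianInt.intCast_im] at h0 h1
    exact Zsqrtd.ext h0 h1
  have hdisc : ∀ z : GaussianInt, f z ∈ unitDisc ↔ (z.norm : ℝ) ≤ x ^ 2 := by
    intro z
    simp only [f, unitDisc, Set.mem_ofPred_eq, Pi.smul_apply, smul_eq_mul, Matrix.cons_val_zero,
      Matrix.cons_val_one, mul_pow, norm_eq_sq_add_sq]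
    rw [← mul_add, inv_pow, inv_mul_le_iff₀ (by positivity), mul_one]
    push_cast
    rfl
  rw [← Set.ncard_image_of_injective _ hinj, ← Nat.card_coe_set_eq]
  congr 2
  ext y
  constructor
  · rintro ⟨hy, v, hv, rfl⟩
    rw [SetLike.mem_coe, Module.Basis.mem_span_iff_repr_mem] at hv
    obtain ⟨a, ha⟩ := hv 0
    obtain ⟨b, hb⟩ := hv 1
    simp at ha hb
    have hv' : v = ![(a : ℝ), (b : ℝ)] := by
      ext i
      fin_cases i
      · simp [ha]
      · simp [hb]
    subst hv'
    exact ⟨⟨a, b⟩, (hdisc ⟨a, b⟩).1 hy, rfl⟩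
  · rintro ⟨z, hz, rfl⟩
    refine ⟨(hdisc z).2 hz, _, ?_, rfl⟩
    rw [SetLike.mem_coe, Module.Basis.mem_span_iff_repr_mem]
    intro i
    fin_cases i
    · exact ⟨z.re, by simp⟩
    · exact ⟨z.im, by simp⟩

-- The main term of Gauss's circle problem: lattice points in dilates of a bounded convex set, whose
-- boundary is null, are counted by its area; the dilation factor is √x.
open scoped Pointwise in
theorem tendsto_card_norm_le_div :
    Tendsto (fun x : ℝ => ({z : GaussianInt | (z.norm : ℝ) ≤ x}.ncard : ℝ) / x) atTop
      (nhds Real.pi) := by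
  have h := tendsto_card_div_pow_atTop_volume' unitDisc isBounded_unitDisc
    isClosed_unitDisc.measurableSet (convex_unitDisc.addHaar_frontier _) ?_
  · rw [volume_unitDisc] at h
    refine (h.comp Real.tendsto_sqrt_atTop).congr' ?_
    filter_upwards [eventually_gt_atTop 0] with x hx
    rw [Function.comp_apply, card_unitDisc_inter (Real.sqrt_pos.2 hx), Fintype.card_fin,
      Real.sq_sqrt hx.le]
  · rintro x y hx hxy _ ⟨v, hv, rfl⟩
    have hy : 0 < y := hx.trans_le hxy
    rw [Set.mem_smul_set_iff_inv_smul_mem₀ hy.ne', smul_smul]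
    have h0 : (0 : Fin 2 → ℝ) ∈ unitDisc := by simp [unitDisc]
    refine convex_unitDisc.smul_mem_of_zero_mem h0 hv ⟨by positivity, ?_⟩
    rw [inv_mul_le_iff₀ hy, mul_one]
    exact hxy

/-- The 1 is the origin, the 4 the number of units. -/
theorem ncard_norm_le_natCast (N : ℕ) :
    {z : GaussianInt | z.norm ≤ N}.ncard = 1 + 4 * ∑ n ∈ Finset.Icc 1 N, (simSet n).ncard := by
  induction N with
  | zero =>
    have h : {z : GaussianInt | z.norm ≤ (0 : ℕ)} = {0} := by
      ext z
      have := GaussianInt.norm_nonneg z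
      rw [Set.mem_ofPred_eq, Set.mem_singleton_iff, ← GaussianInt.norm_eq_zero]
      push_cast
      omega
    rw [h, Set.ncard_singleton, Finset.Icc_eq_empty (by omega), Finset.sum_empty, mul_zero, add_zero]
  | succ N ih =>
    have h : {z : GaussianInt | z.norm ≤ (N + 1 : ℕ)} =
        {z : GaussianInt | z.norm ≤ N} ∪ normSet (N + 1) := by
      ext z
      simp only [normSet, Set.mem_ofPred_eq, Set.mem_union]
      push_cast
      omega
    rw [h, Set.ncard_union_eq ?_ (finite_setOf_norm_le N) (normSet_finite _), ih,
      ncard_normSet (Nat.succ_ne_zero N), Finset.sum_Icc_succ_top (by omega)]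
    · ring
    · rw [Set.disjoint_left]
      intro z hz hz'
      rw [Set.mem_ofPred_eq] at hz
      rw [normSet, Set.mem_ofPred_eq] at hz'
      push_cast at hz'
      omega

/-! ### Summatory functions and the inversion of convolutions on means. -/

/-- The summatory function of a sequence. -/
noncomputable def summatory (f : ℕ → ℝ) (x : ℝ) : ℝ := ∑ n ∈ Finset.Icc 1 ⌊x⌋₊, f n

theorem tendsto_summatory_similarCount :
    Tendsto (fun x => summatory (fun n => similarCount squareLattice n) x / x) atTop
      (nhds (Real.pi / 4)) := by
  have h1 : Tendsto (fun x : ℝ => ({z : GaussianInt | (z.norm : ℝ) ≤ x}.ncard : ℝ) / x - x⁻¹) atTop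
      (nhds (Real.pi - 0)) := tendsto_card_norm_le_div.sub tendsto_inv_atTop_zero
  have h2 := h1.div_const 4
  rw [sub_zero] at h2
  refine h2.congr' ?_
  filter_upwards [eventually_gt_atTop 0] with x hx
  have hset : {z : GaussianInt | (z.norm : ℝ) ≤ x} = {z : GaussianInt | z.norm ≤ ⌊x⌋₊} := by
    ext z
    obtain ⟨k, hk⟩ := Int.eq_ofNat_of_zero_le (GaussianInt.norm_nonneg z)
    rw [Set.mem_ofPred_eq, Set.mem_ofPred_eq, hk, Int.cast_natCast, Int.ofNat_le,
      Nat.le_floor_iff hx.le]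
  rw [hset, ncard_norm_le_natCast, summatory]
  simp only [similarCount_eq_ncard]
  push_cast
  field_simp
  ring

/-- The deviation ψ = β − ρ/(1 + q) satisfies ψ(x) = o(1) − Σ cᵢψ(x/dᵢ), so limsup |ψ| ≤ q limsup
|ψ|; as ψ is bounded and q < 1, it tends to 0. In the proof eventual bounds shrink by the factor (1
+ q)/2. -/
theorem tendsto_of_tendsto_add_tsum {β : ℝ → ℝ} {K : ℝ} (hβ : ∀ x, |β x| ≤ K) {c d : ℕ → ℝ}
    (hc : ∀ i, 0 ≤ c i) {q : ℝ} (hq : HasSum c q) (hq1 : q < 1) (hd : ∀ i, 0 < d i) {ρ : ℝ}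
    (h : Tendsto (fun x => β x + ∑' i, c i * β (x / d i)) atTop (nhds ρ)) :
    Tendsto β atTop (nhds (ρ / (1 + q))) := by
  have hq0 : 0 ≤ q := hq.nonneg hc
  set L := ρ / (1 + q) with hL
  set ψ : ℝ → ℝ := fun x => β x - L with hψ
  have hψK : ∀ x, |ψ x| ≤ K + |L| := fun x => (abs_sub _ _).trans (add_le_add_left (hβ x) _)
  have hK : 0 ≤ K + |L| := (abs_nonneg _).trans (hψK 0)
  have hsummable : ∀ φ : ℝ → ℝ, ∀ C : ℝ, (∀ x, |φ x| ≤ C) → ∀ x,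
      Summable fun i => c i * φ (x / d i) := by
    intro φ C hφ x
    refine (hq.summable.mul_right C).of_norm_bounded fun i => ?_
    rw [norm_mul, Real.norm_of_nonneg (hc i)]
    exact mul_le_mul_of_nonneg_left (hφ _) (hc i)
  have hG : Tendsto (fun x => β x + ∑' i, c i * β (x / d i) - ρ) atTop (nhds 0) := by
    simpa using h.sub_const ρ
  have hGψ : ∀ x, ψ x = (β x + ∑' i, c i * β (x / d i) - ρ) - ∑' i, c i * ψ (x / d i) := by
    intro x
    have h1 : ∑' i, c i * ψ (x / d i) = ∑' i, c i * β (x / d i) - q * L := by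
      simp only [hψ, mul_sub]
      rw [(hsummable β K hβ x).tsum_sub (hq.summable.mul_right L), tsum_mul_right, hq.tsum_eq]
    have h2 : L * (1 + q) = ρ := div_mul_cancel₀ _ (by linarith)
    rw [h1, hψ]
    linarith
  have step : ∀ M : ℝ, 0 < M → (∀ᶠ x in atTop, |ψ x| ≤ M) →
      ∀ᶠ x in atTop, |ψ x| ≤ (1 + q) / 2 * M := by
    intro M hM hev
    -- The excess of |ψ| over M is eventually 0 at each x/dᵢ, though not uniformly in i; dominated
    -- convergence makes its weighted sum tend to 0.
    set φ : ℝ → ℝ := fun x => max (|ψ x| - M) 0 with hφ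
    have hφK : ∀ x, |φ x| ≤ K + |L| := fun x => by
      rw [abs_of_nonneg (le_max_right _ _)]
      exact max_le (by linarith [hψK x]) hK
    have hT : Tendsto (fun x => ∑' i, c i * φ (x / d i)) atTop (nhds (∑' _ : ℕ, (0 : ℝ))) := by
      refine tendsto_tsum_of_dominated_convergence (hq.summable.mul_right (K + |L|)) ?_ ?_
      · intro i
        refine tendsto_const_nhds.congr' ?_
        filter_upwards [(tendsto_id.atTop_div_const (hd i)).eventually hev] with x hx
        simp only [hφ, id] at hx ⊢
        rw [max_eq_right (by linarith), mul_zero]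
      · refine .of_forall fun x i => ?_
        rw [norm_mul, Real.norm_of_nonneg (hc i)]
        exact mul_le_mul_of_nonneg_left (hφK _) (hc i)
    rw [tsum_zero] at hT
    -- Two errors of this size on top of qM make (1 + q)M/2.
    have hε : 0 < (1 - q) / 4 * M := by
      have : 0 < 1 - q := by linarith
      positivity
    filter_upwards [hG.eventually (Metric.ball_mem_nhds 0 hε),
      hT.eventually (Metric.ball_mem_nhds 0 hε)] with x h1 h2
    rw [Real.dist_eq, sub_zero] at h1 h2
    have h3 : |∑' i, c i * ψ (x / d i)| ≤ q * M + ∑' i, c i * φ (x / d i) := by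
      have e : q * M + ∑' i, c i * φ (x / d i) = ∑' i, (c i * M + c i * φ (x / d i)) := by
        rw [(hq.summable.mul_right M).tsum_add (hsummable φ _ hφK x), tsum_mul_right, hq.tsum_eq]
      rw [e, ← Real.norm_eq_abs]
      refine tsum_of_norm_bounded
        (((hq.summable.mul_right M).add (hsummable φ _ hφK x)).hasSum) fun i => ?_
      rw [norm_mul, Real.norm_of_nonneg (hc i), ← mul_add]
      refine mul_le_mul_of_nonneg_left ?_ (hc i)
      have := le_max_left (|ψ (x / d i)| - M) 0
      rw [Real.norm_eq_abs]
      linarith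
    rw [hGψ x]
    refine (abs_sub _ _).trans ?_
    linarith [(abs_lt.1 h2).2]
  have iter : ∀ n : ℕ, ∀ᶠ x in atTop, |ψ x| ≤ ((1 + q) / 2) ^ n * (K + |L| + 1) := by
    intro n
    induction n with
    | zero => exact .of_forall fun x => by linarith [hψK x]
    | succ n ih =>
      refine (step _ (by positivity) ih).mono fun x hx => hx.trans_eq (by ring)
  have hlim : Tendsto (fun n : ℕ => ((1 + q) / 2) ^ n * (K + |L| + 1)) atTop (nhds 0) := by
    have := (tendsto_pow_atTop_nhds_zero_of_lt_one (r := (1 + q) / 2) (by positivity)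
      (by linarith)).mul_const (K + |L| + 1)
    rwa [zero_mul] at this
  rw [Metric.tendsto_nhds]
  intro ε hε
  obtain ⟨n, hn⟩ := (hlim.eventually (gt_mem_nhds hε)).exists
  filter_upwards [iter n] with x hx
  rw [Real.dist_eq]
  exact lt_of_le_of_lt hx hn

theorem summatory_of_lt_one (f : ℕ → ℝ) {x : ℝ} (hx : x < 1) : summatory f x = 0 := by
  rw [summatory, Nat.floor_eq_zero.2 hx, Finset.Icc_eq_empty (by omega), Finset.sum_empty]

theorem summatory_nonneg {f : ℕ → ℝ} (hf : ∀ n, 0 ≤ f n) (x : ℝ) : 0 ≤ summatory f x :=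
  Finset.sum_nonneg fun n _ => hf n

theorem summatory_mono {f : ℕ → ℝ} (hf : ∀ n, 0 ≤ f n) {x y : ℝ} (hxy : x ≤ y) :
    summatory f x ≤ summatory f y :=
  Finset.sum_le_sum_of_subset_of_nonneg (Finset.Icc_subset_Icc_right (Nat.floor_mono hxy))
    fun n _ _ => hf n

theorem summatory_div_nonneg {f : ℕ → ℝ} (hf : ∀ n, 0 ≤ f n) (x : ℝ) : 0 ≤ summatory f x / x := by
  rcases lt_or_ge x 1 with hx | hx
  · rw [summatory_of_lt_one f hx, zero_div]
  · exact div_nonneg (summatory_nonneg hf x) (by linarith)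

theorem exists_summatory_div_le {f : ℕ → ℝ} (hf : ∀ n, 0 ≤ f n) {C : ℝ}
    (h : ∀ᶠ x in atTop, summatory f x / x ≤ C) : ∃ K, ∀ x, summatory f x / x ≤ K := by
  obtain ⟨X, hX⟩ := eventually_atTop.1 h
  refine ⟨max C (summatory f X), fun x => ?_⟩
  rcases le_total X x with hx | hx
  · exact (hX x hx).trans (le_max_left _ _)
  · refine le_trans ?_ (le_max_right _ _)
    rcases lt_or_ge x 1 with hx1 | hx1
    · rw [summatory_of_lt_one f hx1, zero_div]
      exact summatory_nonneg hf X
    · exact (div_le_self (summatory_nonneg hf x) hx1).trans (summatory_mono hf hx)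

theorem summatory_convolution {f g r : ℕ → ℝ}
    (hr : ∀ n ≠ 0, r n = ∑ x ∈ n.divisorsAntidiagonal, g x.1 * f x.2) (x : ℝ) :
    summatory r x = ∑ d ∈ Finset.Icc 1 ⌊x⌋₊, g d * summatory f (x / d) := by
  have h := ArithmeticFunction.sum_Ioc_mul_eq_sum_sum (toArithmeticFunction g)
    (toArithmeticFunction f) ⌊x⌋₊
  have hI : ∀ N : ℕ, Finset.Ioc 0 N = Finset.Icc 1 N := fun N => by ext; simp; omega
  simp only [hI] at h
  have hne : ∀ {N n : ℕ}, n ∈ Finset.Icc 1 N → n ≠ 0 := fun hn => by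
    rw [Finset.mem_Icc] at hn; omega
  have e1 : summatory r x = ∑ n ∈ Finset.Icc 1 ⌊x⌋₊,
      (toArithmeticFunction g * toArithmeticFunction f) n := by
    refine Finset.sum_congr rfl fun n hn => ?_
    rw [hr n (hne hn), ArithmeticFunction.mul_apply]
    refine Finset.sum_congr rfl fun y hy => ?_
    obtain ⟨h1, h2⟩ := Nat.ne_zero_of_mem_divisorsAntidiagonal hy
    simp [toArithmeticFunction, h1, h2]
  rw [e1, h]
  refine Finset.sum_congr rfl fun d hd => ?_
  rw [summatory, Nat.floor_div_natCast]
  congr 1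
  · simp [toArithmeticFunction, hne hd]
  · refine Finset.sum_congr rfl fun n hn => ?_
    simp [toArithmeticFunction, hne hn]

theorem summatory_convolution_div {f g r : ℕ → ℝ}
    (hr : ∀ n ≠ 0, r n = ∑ x ∈ n.divisorsAntidiagonal, g x.1 * f x.2) {x : ℝ} (hx : 0 < x) :
    summatory r x / x =
      ∑ d ∈ Finset.Icc 1 ⌊x⌋₊, g d / d * (summatory f (x / d) / (x / d)) := by
  rw [summatory_convolution hr, Finset.sum_div]
  refine Finset.sum_congr rfl fun d hd => ?_
  have hd' : (d : ℝ) ≠ 0 := by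
    rw [Finset.mem_Icc] at hd
    exact_mod_cast (by omega : d ≠ 0)
  field_simp

/-- In the mean of g * f the divisor d = 1 contributes the mean of f at x, and each d ≥ 2
contributes it at x/d with weight g(d)/d. These weights sum to q < 1, so the mean of f can be
recovered. -/
theorem tendsto_summatory_div {f g r : ℕ → ℝ} (hf : ∀ n, 0 ≤ f n) (hg : ∀ n, 0 ≤ g n)
    (hg1 : g 1 = 1) {q : ℝ} (hq : HasSum (fun i : ℕ => g (i + 2) / (i + 2 : ℕ)) q) (hq1 : q < 1)
    (hr : ∀ n ≠ 0, r n = ∑ x ∈ n.divisorsAntidiagonal, g x.1 * f x.2) {ρ : ℝ}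
    (h : Tendsto (fun x => summatory r x / x) atTop (nhds ρ)) :
    Tendsto (fun x => summatory f x / x) atTop (nhds (ρ / (1 + q))) := by
  set β : ℝ → ℝ := fun x => summatory f x / x with hβ
  have hβ0 : ∀ x, 0 ≤ β x := summatory_div_nonneg hf
  have hsum : ∀ x, 1 ≤ x →
      summatory r x / x = β x + ∑' i : ℕ, g (i + 2) / (i + 2 : ℕ) * β (x / (i + 2 : ℕ)) := by
    intro x hx
    have h1 : 1 ≤ ⌊x⌋₊ := Nat.le_floor (by simpa using hx)
    have hI : Finset.Icc 1 ⌊x⌋₊ = Finset.Ico 1 (⌊x⌋₊ + 1) := rfl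
    rw [summatory_convolution_div hr (by linarith), hI,
      Finset.sum_eq_sum_Ico_succ_bot (by omega), Finset.sum_Ico_eq_sum_range,
      tsum_eq_sum (s := Finset.range (⌊x⌋₊ + 1 - (1 + 1)))]
    · simp only [hg1, Nat.cast_one, div_one, one_mul, hβ]
      congr 1
      refine Finset.sum_congr rfl fun i _ => ?_
      rw [show 1 + 1 + i = i + 2 by ring]
    · intro i hi
      have h2 : x / ((i + 2 : ℕ) : ℝ) < 1 := by
        rw [div_lt_one (by positivity), ← Nat.floor_lt (by linarith)]
        rw [Finset.mem_range] at hi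
        omega
      simp only [hβ]
      rw [summatory_of_lt_one f h2, zero_div, mul_zero]
  have hc : ∀ i : ℕ, 0 ≤ g (i + 2) / (i + 2 : ℕ) := fun i => div_nonneg (hg _) (Nat.cast_nonneg _)
  obtain ⟨K, hK⟩ := exists_summatory_div_le hf (C := ρ + 1) <| by
    filter_upwards [h.eventually (gt_mem_nhds (lt_add_one ρ)), eventually_ge_atTop 1] with x hx hx1
    rw [hsum x hx1] at hx
    have : 0 ≤ ∑' i : ℕ, g (i + 2) / (i + 2 : ℕ) * β (x / (i + 2 : ℕ)) :=
      tsum_nonneg fun i => mul_nonneg (hc i) (hβ0 _)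
    exact (le_add_of_nonneg_right this).trans hx.le
  refine tendsto_of_tendsto_add_tsum (d := fun i : ℕ => ((i + 2 : ℕ) : ℝ)) (K := K)
    (fun x => ?_) hc hq hq1 (fun i => by positivity) (h.congr' ?_)
  · rw [abs_of_nonneg (hβ0 x)]
    exact hK x
  · filter_upwards [eventually_ge_atTop 1] with x hx using hsum x hx

theorem squareIndicator_eq_ofReal (n : ℕ) : squareIndicator n = ((squareIndicator n).re : ℂ) := by
  rw [squareIndicator]
  split_ifs <;> simp

theorem hasSum_squareIndicator_div :
    HasSum (fun i : ℕ => (squareIndicator (i + 2)).re / (i + 2 : ℕ)) (Real.pi ^ 2 / 6 - 1) := by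
  have h : HasSum _ _ := hasSum_squareIndicator (s := 1) (by norm_num)
  have h1 := Complex.hasSum_re h
  have h2 := (hasSum_nat_add_iff' 2).2 h1
  have e1 : (riemannZeta (2 * 1)).re = Real.pi ^ 2 / 6 := by
    rw [mul_one, riemannZeta_two]
    have : (Real.pi : ℂ) ^ 2 / 6 = ((Real.pi ^ 2 / 6 : ℝ) : ℂ) := by push_cast; rfl
    rw [this, Complex.ofReal_re]
  have e2 : ∀ n : ℕ, n ≠ 0 → (LSeries.term squareIndicator 1 n).re = (squareIndicator n).re / n := by
    intro n hn
    rw [LSeries.term_of_ne_zero hn, Complex.cpow_one, Complex.div_natCast_re]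
  have e3 : ∑ i ∈ Finset.range 2, (LSeries.term squareIndicator 1 i).re = 1 := by
    rw [Finset.sum_range_succ, Finset.sum_range_one, LSeries.term_zero, e2 1 one_ne_zero,
      squareIndicator, if_pos ⟨1, rfl⟩]
    simp
  rw [e1, e3] at h2
  exact h2.congr_fun fun i => (e2 _ (by omega)).symm

/-- Here g is the indicator of the squares, with 1 + q = ζ(2) = π²/6, and (π/4)/(π²/6) = 3/(2π). -/
theorem tendsto_summatory_primitiveSimilarCount :
    Tendsto (fun x => summatory (fun n => primitiveSimilarCount squareLattice n) x / x) atTop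
      (nhds (3 / (2 * Real.pi))) := by
  have h := tendsto_summatory_div (f := fun n => (primitiveSimilarCount squareLattice n : ℝ))
    (g := fun n => (squareIndicator n).re) (fun n => Nat.cast_nonneg _) ?_ ?_
    hasSum_squareIndicator_div ?_ ?_ tendsto_summatory_similarCount
  · convert h using 2
    have := Real.pi_pos
    field_simp
    ring
  · intro n
    rw [squareIndicator]
    split_ifs <;> simp
  · rw [squareIndicator, if_pos ⟨1, rfl⟩, Complex.one_re]
  · have := Real.pi_lt_d2
    nlinarith [Real.pi_pos]
  · intro n hn
    have h := ncard_simSet hn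
    simp only [← similarCount_eq_ncard, ← primitiveSimilarCount_eq_ncard] at h
    rw [← Nat.map_swap_divisorsAntidiagonal, Finset.sum_map]
    have h2 : ((similarCount squareLattice n : ℝ) : ℂ) =
        ((∑ x ∈ n.divisorsAntidiagonal, (squareIndicator x.2).re *
          (primitiveSimilarCount squareLattice x.1 : ℝ) : ℝ) : ℂ) := by
      push_cast
      rw [h]
      refine Finset.sum_congr rfl fun x _ => ?_
      rw [← squareIndicator_eq_ofReal, mul_comm]
    exact_mod_cast h2

/-- Here g is the indicator of {1, 2}, the coefficients of 1 + 2⁻ˢ, so q = 1/2 and the mean is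
multiplied by 2/3. -/
theorem tendsto_summatory_primitiveSimilarCount_two_mul :
    Tendsto (fun x => summatory (fun n => primitiveSimilarCount squareLattice (2 * n)) x / x) atTop
      (nhds (1 / Real.pi)) := by
  have h := tendsto_summatory_div
    (f := fun n => (primitiveSimilarCount squareLattice (2 * n) : ℝ))
    (g := fun n => if n = 1 ∨ n = 2 then 1 else 0) (q := 1 / 2) (fun n => Nat.cast_nonneg _)
    (fun n => by split_ifs <;> simp) (by simp) ?_ (by norm_num) ?_
    tendsto_summatory_primitiveSimilarCount
  · convert h using 2
    have := Real.pi_pos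
    field_simp
    norm_num
  · convert hasSum_single (f := fun i : ℕ =>
      (if i + 2 = 1 ∨ i + 2 = 2 then (1 : ℝ) else 0) / (i + 2 : ℕ)) 0 ?_ using 1
    · norm_num
    · intro i hi
      rw [if_neg (by omega), zero_div]
  · intro n hn
    rw [Nat.sum_divisorsAntidiagonal (f := fun a b => (if a = 1 ∨ a = 2 then (1 : ℝ) else 0) *
      (primitiveSimilarCount squareLattice (2 * b) : ℝ))]
    have e : ∀ i : ℕ, (if i = 1 ∨ i = 2 then (1 : ℝ) else 0) *
        (primitiveSimilarCount squareLattice (2 * (n / i)) : ℝ) =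
        (if i = 1 then (primitiveSimilarCount squareLattice (2 * n) : ℝ) else 0) +
        if i = 2 then (primitiveSimilarCount squareLattice (2 * (n / 2)) : ℝ) else 0 := by
      intro i
      by_cases h1 : i = 1
      · subst h1; simp
      · by_cases h2 : i = 2
        · subst h2; simp
        · simp [h1, h2]
    simp only [e]
    rw [Finset.sum_add_distrib, Finset.sum_ite_eq', Finset.sum_ite_eq', if_pos (by simp [hn]),
      primitiveSimilarCount_eq_add n]
    simp [hn]

/-! ### Logarithmic means and products of means. -/

theorem tendsto_log_div_const_div_log {c : ℝ} (hc : 0 < c) :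
    Tendsto (fun x => Real.log (x / c) / Real.log x) atTop (nhds 1) := by
  have h : Tendsto (fun x => 1 - Real.log c / Real.log x) atTop (nhds (1 - 0)) :=
    tendsto_const_nhds.sub (Real.tendsto_log_atTop.const_div_atTop _)
  rw [sub_zero] at h
  refine h.congr' ?_
  filter_upwards [eventually_gt_atTop 1] with x hx
  rw [Real.log_div (by linarith) hc.ne', sub_div, div_self (Real.log_pos hx).ne']

theorem tendsto_comp_div_const_div_log {G : ℝ → ℝ} {l : ℝ}
    (h : Tendsto (fun x => G x / Real.log x) atTop (nhds l)) {c : ℝ} (hc : 0 < c) :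
    Tendsto (fun x => G (x / c) / Real.log x) atTop (nhds l) := by
  have h1 := (h.comp (tendsto_id.atTop_div_const hc)).mul (tendsto_log_div_const_div_log hc)
  rw [mul_one] at h1
  refine h1.congr' ?_
  filter_upwards [(tendsto_id.atTop_div_const hc).eventually (eventually_gt_atTop (1 : ℝ))] with x hx
  have := (Real.log_pos hx).ne'
  simp only [Function.comp_apply, id] at this ⊢
  rw [div_mul_div_cancel₀ this]

/-- The mean of r is Σ (g(d)/d)F(x/d) over d ≤ x, with F the mean of f. For d ≤ x/Z the factor is
close to α; the remaining d carry total weight G(x) − G(x/Z) = o(log x) against a bounded factor. -/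
theorem tendsto_summatory_convolution {f g r : ℕ → ℝ} (hf : ∀ n, 0 ≤ f n) (hg : ∀ n, 0 ≤ g n)
    (hr : ∀ n ≠ 0, r n = ∑ x ∈ n.divisorsAntidiagonal, g x.1 * f x.2) {α l : ℝ}
    (hα : Tendsto (fun x => summatory f x / x) atTop (nhds α))
    (hl : Tendsto (fun x => summatory (fun n => g n / n) x / Real.log x) atTop (nhds l)) :
    Tendsto (fun x => summatory r x / x / Real.log x) atTop (nhds (α * l)) := by
  set G : ℝ → ℝ := summatory fun n => g n / n with hG
  set F : ℝ → ℝ := fun x => summatory f x / x with hF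
  have hg' : ∀ n : ℕ, 0 ≤ g n / n := fun n => div_nonneg (hg n) (Nat.cast_nonneg n)
  obtain ⟨K, hK⟩ := exists_summatory_div_le hf (C := α + 1)
    ((hα.eventually (gt_mem_nhds (lt_add_one α))).mono fun x hx => hx.le)
  have hα0 : 0 ≤ α := ge_of_tendsto' hα fun x => summatory_div_nonneg hf x
  have hK0 : 0 ≤ K := (summatory_div_nonneg hf 0).trans (hK 0)
  have hFK : ∀ x, |F x - α| ≤ K + α := fun x => by
    have h1 := hK x
    have h2 := summatory_div_nonneg hf x
    rw [abs_le]
    constructor <;> simp only [hF] <;> linarith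
  have hl0 : 0 ≤ l := by
    refine ge_of_tendsto hl ?_
    filter_upwards [eventually_gt_atTop 1] with x hx
    exact div_nonneg (summatory_nonneg hg' x) (Real.log_pos hx).le
  have main : Tendsto (fun x => (summatory r x / x - α * G x) / Real.log x) atTop (nhds 0) := by
    rw [Metric.tendsto_nhds]
    intro ε hε
    -- Chosen so that ηl < ε, with l + 1 avoiding division by 0 when l = 0.
    set η := ε / (2 * (l + 1)) with hη
    have hη0 : 0 < η := by positivity
    obtain ⟨Y, hY⟩ := eventually_atTop.1 (hα.eventually (Metric.closedBall_mem_nhds α hη0))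
    set Z := max Y 1 with hZ
    have hZ0 : 0 < Z := lt_of_lt_of_le one_pos (le_max_right _ _)
    have hZ1 : 1 ≤ Z := le_max_right _ _
    have hlim : Tendsto (fun x => η * (G x / Real.log x) +
        (K + α) * (G x / Real.log x - G (x / Z) / Real.log x)) atTop
        (nhds (η * l + (K + α) * (l - l))) :=
      (hl.const_mul η).add ((hl.sub (tendsto_comp_div_const_div_log hl hZ0)).const_mul _)
    have hlt : η * l + (K + α) * (l - l) < ε := by
      have : η * (2 * (l + 1)) = ε := div_mul_cancel₀ _ (by positivity)
      nlinarith
    filter_upwards [hlim.eventually (gt_mem_nhds hlt), eventually_gt_atTop 1] with x hx hx1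
    have hlog := Real.log_pos hx1
    rw [Real.dist_eq, sub_zero, abs_div, abs_of_pos hlog]
    refine lt_of_le_of_lt ?_ hx
    rw [div_le_iff₀ hlog]
    have hx0 : 0 < x := by linarith
    have e1 : (η * (G x / Real.log x) + (K + α) * (G x / Real.log x - G (x / Z) / Real.log x)) *
        Real.log x = η * G x + (K + α) * (G x - G (x / Z)) := by
      field_simp
    have hsub : Finset.Icc 1 ⌊x / Z⌋₊ ⊆ Finset.Icc 1 ⌊x⌋₊ :=
      Finset.Icc_subset_Icc_right (Nat.floor_mono (div_le_self hx0.le hZ1))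
    have e2 : G x - G (x / Z) = ∑ d ∈ Finset.Icc 1 ⌊x⌋₊ \ Finset.Icc 1 ⌊x / Z⌋₊, g d / d := by
      rw [hG, summatory, summatory, ← Finset.sum_sdiff hsub, add_sub_cancel_right]
    have e3 : summatory r x / x - α * G x =
        ∑ d ∈ Finset.Icc 1 ⌊x⌋₊, g d / d * (F (x / d) - α) := by
      rw [summatory_convolution_div hr hx0, hG, summatory, Finset.mul_sum,
        ← Finset.sum_sub_distrib]
      exact Finset.sum_congr rfl fun d _ => by ring
    have e4 : η * G x = ∑ d ∈ Finset.Icc 1 ⌊x⌋₊ \ Finset.Icc 1 ⌊x / Z⌋₊, g d / d * η +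
        ∑ d ∈ Finset.Icc 1 ⌊x / Z⌋₊, g d / d * η := by
      rw [Finset.sum_sdiff hsub, ← Finset.sum_mul, mul_comm]
      rfl
    rw [e1, e2, e3, e4, Finset.mul_sum, ← Finset.sum_sdiff hsub]
    refine (abs_add_le _ _).trans ?_
    have b1 : |∑ d ∈ Finset.Icc 1 ⌊x / Z⌋₊, g d / d * (F (x / d) - α)| ≤
        ∑ d ∈ Finset.Icc 1 ⌊x / Z⌋₊, g d / d * η := by
      refine (Finset.abs_sum_le_sum_abs _ _).trans (Finset.sum_le_sum fun d hd => ?_)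
      rw [abs_mul, abs_of_nonneg (hg' d)]
      refine mul_le_mul_of_nonneg_left ?_ (hg' d)
      rw [Finset.mem_Icc] at hd
      have hd0 : (0 : ℝ) < d := by exact_mod_cast hd.1
      have hd1 : (d : ℝ) ≤ x / Z := (Nat.le_floor_iff (by positivity)).1 hd.2
      have hd2 : Y ≤ x / d := by
        rw [le_div_iff₀ hZ0] at hd1
        rw [le_div_iff₀ hd0]
        have : Y ≤ Z := le_max_left _ _
        nlinarith
      have := hY _ hd2
      rwa [Real.dist_eq] at this
    have b2 : |∑ d ∈ Finset.Icc 1 ⌊x⌋₊ \ Finset.Icc 1 ⌊x / Z⌋₊, g d / d * (F (x / d) - α)| ≤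
        ∑ d ∈ Finset.Icc 1 ⌊x⌋₊ \ Finset.Icc 1 ⌊x / Z⌋₊, (K + α) * (g d / d) := by
      refine (Finset.abs_sum_le_sum_abs _ _).trans (Finset.sum_le_sum fun d _ => ?_)
      rw [abs_mul, abs_of_nonneg (hg' d), mul_comm (K + α)]
      exact mul_le_mul_of_nonneg_left (hFK _) (hg' d)
    have b3 : 0 ≤ ∑ d ∈ Finset.Icc 1 ⌊x⌋₊ \ Finset.Icc 1 ⌊x / Z⌋₊, g d / d * η :=
      Finset.sum_nonneg fun d _ => mul_nonneg (hg' d) hη0.le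
    linarith
  have h := main.add (hl.const_mul α)
  rw [zero_add] at h
  refine h.congr fun x => ?_
  ring

theorem tendsto_summatory_inv :
    Tendsto (fun x => summatory (fun n => (n : ℝ)⁻¹) x / Real.log x) atTop (nhds 1) := by
  have e : ∀ x, summatory (fun n => (n : ℝ)⁻¹) x = harmonic ⌊x⌋₊ := fun x => by
    rw [harmonic_eq_sum_Icc, summatory]
    push_cast
    rfl
  have hu : Tendsto (fun x => 1 / Real.log x + 1) atTop (nhds (0 + 1)) :=
    (Real.tendsto_log_atTop.const_div_atTop 1).add_const 1
  rw [zero_add] at hu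
  refine tendsto_of_tendsto_of_tendsto_of_le_of_le' tendsto_const_nhds hu ?_ ?_
  · filter_upwards [eventually_gt_atTop 1] with x hx
    rw [le_div_iff₀ (Real.log_pos hx), one_mul, e]
    exact log_le_harmonic_floor x (by linarith)
  · filter_upwards [eventually_gt_atTop 1] with x hx
    have := Real.log_pos hx
    rw [div_le_iff₀ this, add_mul, div_mul_cancel₀ _ this.ne', one_mul, e]
    exact harmonic_floor_le_one_add_log x hx.le

theorem sum_Icc_ite_odd (N : ℕ) : ∑ n ∈ Finset.Icc 1 N, (if Odd n then (n : ℝ)⁻¹ else 0) =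
    ∑ n ∈ Finset.Icc 1 N, (n : ℝ)⁻¹ - (∑ n ∈ Finset.Icc 1 (N / 2), (n : ℝ)⁻¹) / 2 := by
  induction N with
  | zero => simp
  | succ N ih =>
    rw [Finset.sum_Icc_succ_top (by omega), Finset.sum_Icc_succ_top (by omega), ih]
    by_cases h : Odd (N + 1)
    · rw [if_pos h]
      obtain ⟨k, hk⟩ := h
      rw [show (N + 1) / 2 = N / 2 by omega]
      ring
    · rw [if_neg h]
      obtain ⟨k, hk⟩ := Nat.not_odd_iff_even.1 h
      rw [show (N + 1) / 2 = N / 2 + 1 by omega, Finset.sum_Icc_succ_top (by omega),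
        show N / 2 + 1 = k by omega, hk]
      push_cast
      rw [← two_mul, mul_inv]
      ring

theorem tendsto_summatory_inv_odd :
    Tendsto (fun x => summatory (fun n => if Odd n then (n : ℝ)⁻¹ else 0) x / Real.log x) atTop
      (nhds (1 / 2)) := by
  have h := tendsto_summatory_inv.sub
    ((tendsto_comp_div_const_div_log tendsto_summatory_inv two_pos).div_const 2)
  norm_num at h
  refine h.congr fun x => ?_
  have e : ⌊x / 2⌋₊ = ⌊x⌋₊ / 2 := by exact_mod_cast Nat.floor_div_natCast x 2
  simp only [summatory, sum_Icc_ite_odd, e]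
  ring

/-- The deviations are summable, hence negligible against log x. -/
theorem tendsto_summatory_of_abs_sub_le {T w : ℕ → ℝ} {a C : ℝ}
    (h : ∀ n ≠ 0, |T n - a * w n| ≤ C / (n : ℝ) ^ 2) {μ : ℝ}
    (hw : Tendsto (fun x => summatory w x / Real.log x) atTop (nhds μ)) :
    Tendsto (fun x => summatory T x / Real.log x) atTop (nhds (a * μ)) := by
  have hs : Summable fun n : ℕ => C / (n : ℝ) ^ 2 := by
    simpa only [div_eq_mul_one_div C] using
      (Real.summable_one_div_nat_pow.2 one_lt_two).mul_left C
  have hC : ∀ n : ℕ, 0 ≤ C / (n : ℝ) ^ 2 := fun n => by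
    have := (abs_nonneg _).trans (h 1 one_ne_zero)
    simp at this
    positivity
  have main : Tendsto (fun x => (summatory T x - a * summatory w x) / Real.log x) atTop
      (nhds 0) := by
    refine squeeze_zero_norm' ?_
      (Real.tendsto_log_atTop.const_div_atTop (∑' n : ℕ, C / (n : ℝ) ^ 2))
    filter_upwards [eventually_gt_atTop 1] with x hx
    have hlog := Real.log_pos hx
    rw [norm_div, Real.norm_of_nonneg hlog.le]
    gcongr
    rw [summatory, summatory, Finset.mul_sum, ← Finset.sum_sub_distrib]
    refine (norm_sum_le_of_le _ fun n hn => ?_).trans (hs.sum_le_tsum (Finset.Icc 1 ⌊x⌋₊)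
      fun n _ => hC n)
    rw [Finset.mem_Icc] at hn
    exact h n (by omega)
  have h' := main.add (hw.const_mul a)
  rw [zero_add] at h'
  refine h'.congr fun x => ?_
  ring

/-! ### Logarithmic means of the ratio counts. -/

theorem sum_Icc_sum_divisorsAntidiagonal (t : ℕ × ℕ → ℝ) (N : ℕ) :
    ∑ n ∈ Finset.Icc 1 N, ∑ x ∈ n.divisorsAntidiagonal, t x =
      ∑ p ∈ Finset.Icc 1 N, ∑ q ∈ (Finset.Icc 1 N).filter fun q => p * q ≤ N, t (p, q) := by
  have hIoc : ∀ N : ℕ, Finset.Ioc 0 N = Finset.Icc 1 N := fun _ => rfl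
  have h1 : ∀ n ∈ Finset.Icc 1 N, ∑ x ∈ n.divisorsAntidiagonal, t x =
      ∑ x ∈ (Finset.Icc 1 N ×ˢ Finset.Icc 1 N) with x.1 * x.2 = n, t x := by
    intro n hn
    rw [Finset.mem_Icc] at hn
    rw [Nat.divisorsAntidiagonal_eq_prod_filter_of_le (by omega) hn.2, hIoc]
  rw [Finset.sum_congr rfl h1]
  simp only [Finset.sum_filter]
  rw [Finset.sum_comm, Finset.sum_product]
  refine Finset.sum_congr rfl fun p hp => Finset.sum_congr rfl fun q hq => ?_
  rw [Finset.mem_Icc] at hp hq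
  have : 1 ≤ p * q := Nat.mul_pos hp.1 hq.1
  rw [Finset.sum_ite_eq]
  simp [this]

/-- The weight `1 / (p q)` of a pair counted by `ratioCount`. -/
noncomputable def ratioInv (P : ℕ → Prop) [DecidablePred P] (x : ℕ × ℕ) : ℝ :=
  if x.1 < x.2 ∧ x.2 ^ 2 < 3 * x.1 ^ 2 ∧ P x.1 ∧ P x.2 then ((x.1 : ℝ) * x.2)⁻¹ else 0

/-- The sum of the weights of the pairs with given first entry. -/
noncomputable def ratioInvRow (P : ℕ → Prop) [DecidablePred P] (p : ℕ) : ℝ :=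
  ∑ q ∈ Finset.Ioo p ⌈√3 * (p : ℝ)⌉₊, ratioInv P (p, q)

theorem ratioInv_nonneg (P : ℕ → Prop) [DecidablePred P] (x : ℕ × ℕ) : 0 ≤ ratioInv P x := by
  rw [ratioInv]
  split_ifs <;> positivity

theorem ratioInv_eq_zero {P : ℕ → Prop} [DecidablePred P] {p q : ℕ}
    (h : q ∉ Finset.Ioo p ⌈√3 * (p : ℝ)⌉₊) : ratioInv P (p, q) = 0 := by
  rw [mem_Ioo_ceil_sqrt_three] at h
  exact if_neg fun h' => h ⟨h'.1, h'.2.1⟩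

theorem ratioCount_div_eq_sum (P : ℕ → Prop) [DecidablePred P] (n : ℕ) :
    (ratioCount P n : ℝ) / n = ∑ x ∈ n.divisorsAntidiagonal, ratioInv P x := by
  rw [ratioCount, Finset.card_filter]
  push_cast
  rw [Finset.sum_div]
  refine Finset.sum_congr rfl fun x hx => ?_
  rw [ratioInv, ← (Nat.mem_divisorsAntidiagonal.1 hx).1]
  split_ifs <;> simp

section

variable (P : ℕ → Prop) [DecidablePred P]

theorem ratioInv_truncated_le (p N : ℕ) :
    ∑ q ∈ (Finset.Icc 1 N).filter (fun q => p * q ≤ N), ratioInv P (p, q) ≤ ratioInvRow P p := by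
  rw [ratioInvRow, ← Finset.sum_inter_add_sum_sdiff _ (Finset.Ioo p ⌈√3 * (p : ℝ)⌉₊),
    Finset.sum_eq_zero (s := _ \ _) fun q hq => ratioInv_eq_zero (Finset.mem_sdiff.1 hq).2, add_zero]
  exact Finset.sum_le_sum_of_subset_of_nonneg Finset.inter_subset_right
    fun q _ _ => ratioInv_nonneg P _

/-- From q² < 3p² follows q ≤ 2p, hence pq ≤ 2p² ≤ N: the truncation does not cut this row. -/
theorem ratioInvRow_le_truncated {p N : ℕ} (h : 2 * (p * p) ≤ N) :
    ratioInvRow P p ≤ ∑ q ∈ (Finset.Icc 1 N).filter (fun q => p * q ≤ N), ratioInv P (p, q) := by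
  refine Finset.sum_le_sum_of_subset_of_nonneg (fun q hq => ?_) fun q _ _ => ratioInv_nonneg P _
  rw [mem_Ioo_ceil_sqrt_three] at hq
  have hq2 : q ≤ 2 * p := by nlinarith [hq.2]
  rw [Finset.mem_filter, Finset.mem_Icc]
  have hpq : p * q ≤ N := by nlinarith
  have hp : 1 ≤ p := by
    rcases Nat.eq_zero_or_pos p with rfl | hp
    · simp at hq
    · exact hp
  exact ⟨⟨by omega, by nlinarith⟩, hpq⟩

/-- From p < q and pq ≤ x follows p ≤ √x, so only such rows occur. -/
theorem summatory_ratioCount_div_le {x : ℝ} (hx : 1 ≤ x) :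
    summatory (fun n => (ratioCount P n : ℝ) / n) x ≤ summatory (ratioInvRow P) √x := by
  have hx0 : 0 ≤ x := by linarith
  simp only [summatory, ratioCount_div_eq_sum]
  rw [sum_Icc_sum_divisorsAntidiagonal]
  have hsub : Finset.Icc 1 ⌊√x⌋₊ ⊆ Finset.Icc 1 ⌊x⌋₊ :=
    Finset.Icc_subset_Icc_right (Nat.floor_mono ((Real.sqrt_le_left hx0).2 (by nlinarith)))
  rw [← Finset.sum_subset hsub]
  · exact Finset.sum_le_sum fun p _ => ratioInv_truncated_le P p _
  · intro p hp hp'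
    refine Finset.sum_eq_zero fun q hq => ratioInv_eq_zero fun hq' => hp' ?_
    rw [Finset.mem_filter] at hq
    rw [Finset.mem_Icc] at hp ⊢
    refine ⟨hp.1, ?_⟩
    rw [Nat.le_floor_iff (Real.sqrt_nonneg _)]
    refine Real.le_sqrt_of_sq_le ?_
    have h1 : p * p ≤ ⌊x⌋₊ :=
      (Nat.mul_le_mul_left p (Finset.mem_Ioo.1 hq').1.le).trans hq.2
    rw [Nat.le_floor_iff hx0] at h1
    push_cast at h1
    rwa [sq]

theorem summatory_ratioInvRow_le {x : ℝ} (hx : 1 ≤ x) :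
    summatory (ratioInvRow P) √(x / 2) ≤ summatory (fun n => (ratioCount P n : ℝ) / n) x := by
  have hx0 : 0 ≤ x := by linarith
  simp only [summatory, ratioCount_div_eq_sum]
  rw [sum_Icc_sum_divisorsAntidiagonal]
  have hsub : Finset.Icc 1 ⌊√(x / 2)⌋₊ ⊆ Finset.Icc 1 ⌊x⌋₊ :=
    Finset.Icc_subset_Icc_right (Nat.floor_mono ((Real.sqrt_le_left hx0).2 (by nlinarith)))
  refine le_trans (Finset.sum_le_sum fun p hp => ratioInvRow_le_truncated P (N := ⌊x⌋₊) ?_)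
    (Finset.sum_le_sum_of_subset_of_nonneg hsub fun p _ _ =>
      Finset.sum_nonneg fun q _ => ratioInv_nonneg P _)
  rw [Finset.mem_Icc, Nat.le_floor_iff (Real.sqrt_nonneg _)] at hp
  have h1 := hp.2
  rw [Real.le_sqrt (Nat.cast_nonneg _) (by positivity)] at h1
  rw [Nat.le_floor_iff hx0]
  push_cast
  nlinarith

/-- The sum over pq ≤ x lies between the full rows p ≤ √(x/2) and p ≤ √x; the halving of u is log √x
= (log x)/2. -/
theorem tendsto_summatory_ratioCount_div {u : ℝ}
    (h : Tendsto (fun x => summatory (ratioInvRow P) x / Real.log x) atTop (nhds u)) :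
    Tendsto (fun x => summatory (fun n => (ratioCount P n : ℝ) / n) x / Real.log x) atTop
      (nhds (u / 2)) := by
  have h1 : Tendsto (fun x => summatory (ratioInvRow P) √x / Real.log x) atTop (nhds (u / 2)) := by
    refine ((h.comp Real.tendsto_sqrt_atTop).div_const 2).congr' ?_
    filter_upwards [eventually_gt_atTop 0] with x hx
    rw [Function.comp_apply, Real.log_sqrt hx.le]
    ring
  refine tendsto_of_tendsto_of_tendsto_of_le_of_le'
    (tendsto_comp_div_const_div_log h1 two_pos) h1 ?_ ?_
  · filter_upwards [eventually_gt_atTop 1] with x hx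
    have := Real.log_pos hx
    gcongr
    exact summatory_ratioInvRow_le P hx.le
  · filter_upwards [eventually_gt_atTop 1] with x hx
    have := Real.log_pos hx
    gcongr
    exact summatory_ratioCount_div_le P hx.le

theorem ratioInvRow_ofReal (p : ℕ) : (ratioInvRow P p : ℂ) =
    ∑ q ∈ Finset.Ioo p ⌈√3 * (p : ℝ)⌉₊, ratioTerm P 1 (p, q) := by
  rw [ratioInvRow, Complex.ofReal_sum]
  refine Finset.sum_congr rfl fun q hq => ?_
  by_cases hP : P p ∧ P q
  · rw [ratioTerm_of_mem hq hP.1 hP.2, ratioInv]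
    rw [mem_Ioo_ceil_sqrt_three] at hq
    rw [if_pos ⟨hq.1, hq.2, hP⟩]
    simp
  · rw [ratioTerm_of_not hP, ratioInv, if_neg fun h => hP h.2.2, Complex.ofReal_zero]

end

/-- The comparison with the integral at s = 1, where m·m⁻¹ = 1 and c(1) = log √3. -/
theorem abs_stepSumReal_div_sub_le {δ m : ℕ} (hδ : 0 < δ) (hm : 0 < m) :
    |(m : ℝ)⁻¹ * stepSumReal δ m 1 - Real.log √3 / δ * (m : ℝ)⁻¹| ≤ 1 / (m : ℝ) ^ 2 := by
  have hδ' : (0 : ℝ) < δ := by exact_mod_cast hδ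
  have hm' : (0 : ℝ) < m := by exact_mod_cast hm
  have h1 := stepSumReal_le hδ hm zero_le_one
  have h2 := le_stepSumReal hδ hm zero_le_one
  rw [Real.rpow_neg_one, inv_mul_cancel₀ hm'.ne', one_mul, sqrtThreeIntegralReal_one] at h1 h2
  have e : (m : ℝ)⁻¹ * stepSumReal δ m 1 - Real.log √3 / δ * (m : ℝ)⁻¹ =
      (m : ℝ)⁻¹ * (δ : ℝ)⁻¹ * (δ * stepSumReal δ m 1 - Real.log √3) := by
    field_simp
  have h3 : |δ * stepSumReal δ m 1 - Real.log √3| ≤ δ * (m : ℝ)⁻¹ := by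
    rw [abs_le]
    constructor
    · linarith
    · have : 0 ≤ δ * (m : ℝ)⁻¹ := by positivity
      linarith
  rw [e, abs_mul, abs_of_pos (by positivity : 0 < (m : ℝ)⁻¹ * (δ : ℝ)⁻¹)]
  calc _ ≤ (m : ℝ)⁻¹ * (δ : ℝ)⁻¹ * (δ * (m : ℝ)⁻¹) := by gcongr
    _ = _ := by field_simp

theorem ratioInvRow_true (p : ℕ) :
    ratioInvRow (fun _ => True) p = (p : ℝ)⁻¹ * stepSumReal 1 p 1 := by
  have h := ratioInvRow_ofReal (fun _ => True) p
  have h1 := stepSum_ofReal 1 p 1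
  rw [Complex.ofReal_one] at h1
  rw [← evenTerm_eq_row, evenTerm_eq, h1, Complex.cpow_neg_one] at h
  apply Complex.ofReal_injective
  rw [h]
  push_cast
  rfl

theorem ratioInvRow_odd (k : ℕ) :
    ratioInvRow Odd (2 * k + 1) = ((2 * k + 1 : ℕ) : ℝ)⁻¹ * stepSumReal 2 (2 * k + 1) 1 := by
  have h := ratioInvRow_ofReal Odd (2 * k + 1)
  have h1 := stepSum_ofReal 2 (2 * k + 1) 1
  rw [Complex.ofReal_one] at h1
  rw [← oddTerm_eq_row, oddTerm_eq, h1, Complex.cpow_neg_one] at h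
  apply Complex.ofReal_injective
  rw [h]
  push_cast
  rfl

theorem ratioInvRow_odd_of_not {p : ℕ} (hp : ¬ Odd p) : ratioInvRow Odd p = 0 :=
  Finset.sum_eq_zero fun _ _ => if_neg fun h => hp h.2.2.1

theorem tendsto_summatory_ratioCount_true :
    Tendsto (fun x => summatory (fun n => (ratioCount (fun _ => True) n : ℝ) / n) x / Real.log x)
      atTop (nhds (Real.log 3 / 4)) := by
  have h := tendsto_summatory_ratioCount_div (fun _ => True) (tendsto_summatory_of_abs_sub_le
    (T := ratioInvRow fun _ => True) (a := Real.log √3 / (1 : ℕ)) (C := 1) (fun n hn => ?_)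
    tendsto_summatory_inv)
  · convert h using 2
    rw [Real.log_sqrt (by norm_num)]
    push_cast
    ring
  · rw [ratioInvRow_true]
    exact abs_stepSumReal_div_sub_le one_pos (Nat.pos_of_ne_zero hn)

/-- Compared with the unrestricted case, the spacing 2 of the odd q and the density 1/2 of the odd p
each contribute a factor 1/2. -/
theorem tendsto_summatory_ratioCount_odd :
    Tendsto (fun x => summatory (fun n => (ratioCount Odd n : ℝ) / n) x / Real.log x)
      atTop (nhds (Real.log 3 / 16)) := by
  have h := tendsto_summatory_ratioCount_div Odd (tendsto_summatory_of_abs_sub_le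
    (T := ratioInvRow Odd) (a := Real.log √3 / (2 : ℕ)) (C := 1) (fun n hn => ?_)
    tendsto_summatory_inv_odd)
  · convert h using 2
    rw [Real.log_sqrt (by norm_num)]
    push_cast
    ring
  · split_ifs with ho
    · obtain ⟨k, rfl⟩ := ho
      rw [ratioInvRow_odd]
      exact abs_stepSumReal_div_sub_le two_pos (by omega)
    · rw [ratioInvRow_odd_of_not ho, mul_zero, sub_zero, abs_zero]
      positivity

/-! ### The asymptotic formula. -/

theorem sum_Icc_ite_two_dvd (F : ℕ → ℝ) (N : ℕ) :
    ∑ n ∈ Finset.Icc 1 N, (if 2 ∣ n then F (n / 2) else 0) = ∑ m ∈ Finset.Icc 1 (N / 2), F m := by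
  induction N with
  | zero => simp
  | succ N ih =>
    rw [Finset.sum_Icc_succ_top (by omega), ih]
    split_ifs with h
    · rw [show (N + 1) / 2 = N / 2 + 1 by omega, Finset.sum_Icc_succ_top (by omega)]
    · rw [show (N + 1) / 2 = N / 2 by omega, add_zero]

theorem tendsto_ASquare_div :
    Tendsto (fun x => ASquare x / x / Real.log x) atTop (nhds (Real.log 3 / (2 * Real.pi))) := by
  set rE : ℕ → ℝ := fun n => ∑ x ∈ n.divisorsAntidiagonal,
    (ratioCount (fun _ => True) x.1 : ℝ) * (primitiveSimilarCount squareLattice x.2 : ℝ) with hrE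
  set rO : ℕ → ℝ := fun n => ∑ x ∈ n.divisorsAntidiagonal,
    (ratioCount Odd x.1 : ℝ) * (primitiveSimilarCount squareLattice (2 * x.2) : ℝ) with hrO
  have hE := tendsto_summatory_convolution
    (f := fun n => (primitiveSimilarCount squareLattice n : ℝ))
    (g := fun n => (ratioCount (fun _ => True) n : ℝ)) (r := rE) (fun n => Nat.cast_nonneg _)
    (fun n => Nat.cast_nonneg _) (fun n _ => rfl) tendsto_summatory_primitiveSimilarCount
    tendsto_summatory_ratioCount_true
  have hO := tendsto_summatory_convolution
    (f := fun n => (primitiveSimilarCount squareLattice (2 * n) : ℝ))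
    (g := fun n => (ratioCount Odd n : ℝ)) (r := rO) (fun n => Nat.cast_nonneg _)
    (fun n => Nat.cast_nonneg _) (fun n _ => rfl) tendsto_summatory_primitiveSimilarCount_two_mul
    tendsto_summatory_ratioCount_odd
  have hR : Tendsto (fun x => summatory (fun n => similarCount squareLattice n) x / x / Real.log x)
      atTop (nhds 0) := tendsto_summatory_similarCount.div_atTop Real.tendsto_log_atTop
  -- The square sublattices contribute only O(x). In the even part the weight 2 cancels against the
  -- argument x/2, as 2·rE-sum(x/2)/x is a mean at x/2; the odd part keeps its weight 2.
  have h := (hR.add (tendsto_comp_div_const_div_log hE two_pos)).add (hO.const_mul 2)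
  have e : 0 + 3 / (2 * Real.pi) * (Real.log 3 / 4) + 2 * (1 / Real.pi * (Real.log 3 / 16)) =
      Real.log 3 / (2 * Real.pi) := by
    have := Real.pi_pos
    field_simp
    ring
  rw [e] at h
  refine h.congr fun x => ?_
  have hfl : ⌊x / 2⌋₊ = ⌊x⌋₊ / 2 := by exact_mod_cast Nat.floor_div_natCast x 2
  have hA : ASquare x = summatory (fun n => similarCount squareLattice n) x +
      2 * summatory rE (x / 2) + 2 * summatory rO x := by
    rw [ASquare, summatory, summatory, summatory, hfl, ← sum_Icc_ite_two_dvd rE, Finset.mul_sum,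
      Finset.mul_sum, ← Finset.sum_add_distrib, ← Finset.sum_add_distrib]
    refine Finset.sum_congr rfl fun n hn => ?_
    rw [aSquare_eq (by rw [Finset.mem_Icc] at hn; omega)]
    push_cast
    rfl
  rw [hA]
  ring

theorem ASquare_asymptotic :
    (fun x : ℝ => ASquare x - Real.log 3 / (2 * Real.pi) * (x * Real.log x))
      =o[atTop] (fun x : ℝ => x * Real.log x) := by
  refine (isLittleO_iff_tendsto' ?_).2 ?_
  · filter_upwards [eventually_gt_atTop 1] with x hx h
    exact absurd h (mul_pos (by linarith) (Real.log_pos hx)).ne'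
  · have h := tendsto_ASquare_div.sub_const (Real.log 3 / (2 * Real.pi))
    rw [sub_self] at h
    refine h.congr' ?_
    filter_upwards [eventually_gt_atTop 1] with x hx
    have h1 : x * Real.log x ≠ 0 := (mul_pos (by linarith) (Real.log_pos hx)).ne'
    rw [sub_div, mul_div_cancel_right₀ _ h1, div_div]

open SquareLattice in
theorem theorem1 :
    -- the Dirichlet series, with the factors and double sums that occur in it
    (∀ s : ℂ, 1 < s.re →
      LSeriesHasSum (fun n => (similarCount squareLattice n : ℂ)) s
        (riemannZeta s * chiNegFour.LFunction s) ∧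
      LSeriesHasSum (fun n => (primitiveSimilarCount squareLattice n : ℂ)) s
        (riemannZeta s * chiNegFour.LFunction s / riemannZeta (2 * s)) ∧
      Summable (evenTerm s) ∧ Summable (oddTerm s) ∧
      LSeriesHasSum (fun n => (aSquare n : ℂ)) s
        (PhiSquare s + PhiWrEven s + PhiWrOdd s)) ∧
    -- meromorphic continuation to `Re s > 1/2` and the poles in `Re s ≥ 1`
    (∃ F : ℂ → ℂ,
      (∀ s : ℂ, 1 < s.re → F s = PhiSquareWr s) ∧
      MeromorphicOn F {s : ℂ | 1 / 2 < s.re} ∧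
      meromorphicOrderAt F 1 = -2 ∧
      ∀ s : ℂ, 1 ≤ s.re → s ≠ 1 → AnalyticAt ℂ F s) ∧
    -- the bounds on the half-axis; `<` on `ℂ` compares real parts and says that the
    -- imaginary parts agree
    (∀ s : ℝ, 1 < s →
      (PhiSquareWr s).im = 0 ∧ (PhiSquare s).im = 0 ∧ (DSquare s).im = 0 ∧
      DSquare s - PhiSquare s < PhiSquareWr s ∧
      PhiSquareWr s < DSquare s + PhiSquare s) ∧
    -- the asymptotic growth
    (fun x : ℝ => ASquare x - Real.log 3 / (2 * Real.pi) * (x * Real.log x))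
      =o[atTop] (fun x : ℝ => x * Real.log x) :=
  ⟨fun _ hs => ⟨hasSum_similarCount hs, hasSum_primitiveSimilarCount hs, summable_evenTerm hs,
      summable_oddTerm hs, hasSum_aSquare hs⟩,
    exists_continuation, fun _ hs => bounds_of_one_lt hs, ASquare_asymptotic⟩
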